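/- Let $k$ be a commutative ring. All modules are $(\mathbb N,\mathbb Z)$-bigraded $k$-modules, with shift $E[a,b]_{st}=E_{s-a,t-b}$ and the Koszul sign rule ($f\otimes g$ applied to $w\otimes y$ has the sign $(-1)^{sp+tq}$ if $w$ has bidegree $(s,t)$ and $g$ has bidegree $[p,q]$). A \emph{$dA_\infty$-algebra} is a bigraded module $E$ with maps $m_{ij}\colon E^{\otimes j}\to E[i,2-(i+j)]$ ($i\ge 0$, $j\ge 1$) and a unit $\eta\colon k\to E$ such that for all $u\ge0$, $v\ge1$ $$\sum_{i+p=u,\ j+q=v+1,\ r+1+t=j}(-1)^{rq+t+pj}\,m_{ij}(\mathbf 1^{\otimes r}\otimes m_{pq}\otimes\mathbf 1^{\otimes t})=0,$$ and such that $\eta$ is a strict unit: $m_{01}\eta=0$, $m_{02}(\eta\otimes\mathbf 1)=\mathbf 1=m_{02}(\mathbf 1\otimes\eta)$, and $m_{ij}$ with $i+j\ge3$ vanishes if one argument is the unit. A \emph{map} $E\to F$ of $dA_\infty$-algebras is a family $f_{pq}\colon E^{\otimes q}\to F[p,1-(p+q)]$ ($p\ge 0$, $q\ge 1$) with, for all $u\ge0$,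 $v\ge1$, $$\sum_{i+p=u,\ j+q=v+1,\ r+1+t=j}(-1)^{rq+t+pj}f_{ij}(\mathbf 1^{\otimes r}\otimes m^E_{pq}\otimes\mathbf 1^{\otimes t})=\sum_{i+p_1+\dots+p_j=u,\ q_1+\dots+q_j=v}(-1)^{\sigma}m^F_{ij}(f_{p_1q_1}\otimes\dots\otimes f_{p_jq_j}),$$ $$\sigma=u+\sum_{w=1}^{j-1}\Bigl(jp_w+w(q_{j-w}-p_w)+q_{j-w}\sum_{s=j-w+1}^{j}(p_s+q_s)\Bigr),$$ with $f_{01}\eta_E=\eta_F$, and with $f_{pq}$ for $p+q\ge2$ vanishing if one argument is the unit. It is an \emph{$E_2$-equivalence} if $f_{01}$ induces an isomorphism on the iterated homology, first with respect to $m_{01}$ and then with respect to $m_{11}$. A dga (with differential of degree $-1$) is a $dA_\infty$-algebra concentrated in horizontal degree $0$, with $m_{01}=d$, $m_{02}$ the product, and all other $m_{ij}=0$. A \emph{minimal model} of a $k$-dga $A$ is a $dA_\infty$-algebra $E$ with $m_{01}^E=0$ that is $k$-projective in every bidegree, together with an $E_2$-equivalence of $dA_\infty$-algebras $f\colon E\to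 A$. A \emph{termwise $k$-projective resolution} of a graded $k$-algebra $\Lambda$ is a bidga $R$ with trivial vertical differential (a bigraded algebra with a horizontal differential $d_1$ of bidegree $[1,0]$ satisfying the Leibniz rule), $k$-projective in every bidegree, with a map of bidgas $\varepsilon\colon R\to\Lambda$ that is an $E_2$-equivalence; maps of resolutions are maps of bidgas over $\Lambda$. For a map $R\to S$ of such bidgas, let $C^{rst}(R,S)=\operatorname{Hom}_k(R^{\otimes r},S[s,t])$ for $r\ge 0$ and $s,t\in\mathbb Z$, with differentials $$d_{HH}c=\mu(\mathbf 1\otimes c)+(-1)^{r+1}\mu(c\otimes\mathbf 1)+\sum_{1\le j\le r}(-1)^jc(\mathbf 1^{\otimes j-1}\otimes\mu\otimes\mathbf 1^{\otimes r-j}),\qquad d_{Hom}c=d_1c-(-1)^{s}\sum_{1\le j\le r}c(\mathbf 1^{\otimes j-1}\otimes d_1\otimes\mathbf 1^{\otimes r-j}).$$ Let $HH^{q,t}(R,S)$ be the cohomology in degree $q$ of the total complex $\mathrm{Tot}^{q,t}=\prod_{r+s=q}C^{rst}(R,S)$ with differential $d_{Hom}-(-1)^qd_{HH}$. Let $dHH^{q,t}(\Lambda)$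 be the module of all families $(z_R)$, $z_R\in HH^{q,t}(R,R)$, indexed by the termwise $k$-projective resolutions $R$ of $\Lambda$, such that $\alpha_*z_R=\alpha^*z_S$ in $HH^{q,t}(R,S)$ for all maps $\alpha\colon R\to S$ of resolutions. \textbf{Proposition.} Let $A$ be a $k$-dga. For every minimal model $f\colon E\to A$, the bidga $(E,m^E_{11},m^E_{02})$, augmented to $H_*(A)$ by the map induced by $f_{01}$, is a termwise $k$-projective resolution of $H_*(A)$; the projection $dHH^{3,-1}(H_*(A))\to HH^{3,-1}(E,E)$ is an isomorphism; and $m^E_{03}+m^E_{12}+m^E_{21}$ is a cocycle in the total complex computing $HH^{3,-1}(E,E)$. Its class does not depend on the choice of the minimal model: there is an element $\gamma_A\in dHH^{3,-1}(H_*(A))$ such that for every minimal model $E\to A$ the image of $\gamma_A$ in $HH^{3,-1}(E,E)$ is the class of $m^E_{03}+m^E_{12}+m^E_{21}$. -/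

import Mathlib

universe u

noncomputable section

namespace Dainf

open DirectSum

/-! ### Bigraded modules and the Koszul sign -/

/-- An `(ℕ, ℤ)`-bigraded `k`-module, given as its total module `⨁ E_{st}` with the internal
decomposition. The first index is written in `ℤ`, and the pieces of negative first index vanish. -/
structure BigradedModule (k : Type u) [CommRing k] where
  carrier : Type u
  [addCommGroup : AddCommGroup carrier]
  [module : Module k carrier]
  piece : ℤ × ℤ → Submodule k carrier
  isInternal : DirectSum.IsInternal piece
  piece_neg : ∀ s t : ℤ, s < 0 → piece (s, t) = ⊥

attribute [instance] BigradedModule.addCommGroup BigradedModule.module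

variable {k : Type u} [CommRing k]

/-- The sign operator of the Koszul convention: on an element of bidegree `(s, t)` it is
multiplication by `(-1) ^ (s * a + t * b)`. It is applied to every element past which a map of
bidegree `[a, b]` is moved. -/
def BigradedModule.sgn (E : BigradedModule k) (a b : ℤ) : E.carrier →ₗ[k] E.carrier :=
  (DirectSum.toModule k (ℤ × ℤ) E.carrier fun st =>
      ((st.1 * a + st.2 * b).negOnePow : ℤ) • (E.piece st).subtype) ∘ₗ
    (LinearEquiv.ofBijective (DirectSum.coeLinearMap E.piece) E.isInternal).symm.toLinearMap

theorem BigradedModule.sgn_of_mem (E : BigradedModule k) (a b : ℤ) {st : ℤ × ℤ} {x : E.carrier}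
    (hx : x ∈ E.piece st) : E.sgn a b x = ((st.1 * a + st.2 * b).negOnePow : ℤ) • x := by
  have h : (LinearEquiv.ofBijective (DirectSum.coeLinearMap E.piece) E.isInternal).symm x =
      DirectSum.lof k (ℤ × ℤ) (fun i => E.piece i) st ⟨x, hx⟩ := by
    rw [LinearEquiv.symm_apply_eq]
    exact (DirectSum.coeLinearMap_lof (A := E.piece) (R := k) st ⟨x, hx⟩).symm
  rw [BigradedModule.sgn, LinearMap.comp_apply, LinearEquiv.coe_coe, h, DirectSum.toModule_lof]
  rfl

theorem BigradedModule.induction (E : BigradedModule k) {P : E.carrier → Prop} (h0 : P 0)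
    (hom : ∀ st x, x ∈ E.piece st → P x) (add : ∀ x y, P x → P y → P (x + y)) (x) : P x := by
  have hx : x ∈ iSup E.piece := by
    rw [E.isInternal.submodule_iSup_eq_top]; trivial
  exact Submodule.iSup_induction E.piece (motive := P) hx hom h0 add

theorem BigradedModule.sgn_zero_zero (E : BigradedModule k) (x : E.carrier) :
    E.sgn 0 0 x = x := by
  induction x using E.induction with
  | h0 => simp
  | hom st x hx => rw [E.sgn_of_mem 0 0 hx]; simp
  | add x y hx hy => rw [map_add, hx, hy]

/-- A multilinear map `E × ... × E → F` (that is, a linear map `E^{⊗ j} → F`) is a map of bigraded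
modules `E^{⊗ j} → F[a, b]`; here `F[a, b]_{st} = F_{s - a, t - b}`. -/
def IsHomogeneous (E F : BigradedModule k) {j : ℕ}
    (f : MultilinearMap k (fun _ : Fin j => E.carrier) F.carrier) (a b : ℤ) : Prop :=
  ∀ (deg : Fin j → ℤ × ℤ) (x : Fin j → E.carrier), (∀ l, x l ∈ E.piece (deg l)) →
    f x ∈ F.piece (∑ l, deg l - (a, b))

/-- The arguments of the outer map in a composite with `1^{⊗ r} ⊗ g ⊗ 1^{⊗ t}`, where `g` takes
`q` arguments and has bidegree `[a, b]`. The argument list `x 0, x 1, ...` is extended to an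
infinite sequence, of which only the initial part is used. -/
def BigradedModule.insertAt (E : BigradedModule k) (a b : ℤ) {q : ℕ}
    (g : (Fin q → E.carrier) → E.carrier) (r : ℕ) (x : ℕ → E.carrier) : ℕ → E.carrier :=
  fun l => if l < r then E.sgn a b (x l)
    else if l = r then g (fun c => x (r + c))
    else x (l + q - 1)

/-! ### Derived A-infinity algebras and their maps -/

/-- A (strictly unital) derived A-infinity algebra: maps `m i j : E^{⊗ j} → E[i, 2 - (i + j)]` for
`i ≥ 0`, `j ≥ 1` and a unit. The index `j = 0` does not occur in the definition; the
corresponding entry is set to zero. -/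
structure DAlgebra (k : Type u) [CommRing k] extends BigradedModule k where
  m : (i j : ℕ) → MultilinearMap k (fun _ : Fin j => carrier) carrier
  m_zero : ∀ i, m i 0 = 0
  one : carrier
  one_mem : one ∈ piece (0, 0)
  homogeneous : ∀ i j, 1 ≤ j →
    IsHomogeneous toBigradedModule toBigradedModule (m i j) i (2 - (i + j))
  rel : ∀ u v : ℕ, 1 ≤ v → ∀ x : ℕ → carrier,
    ∑ ip ∈ Finset.HasAntidiagonal.antidiagonal u,
      ∑ jq ∈ (Finset.HasAntidiagonal.antidiagonal (v + 1)).filter (fun jq => 1 ≤ jq.1 ∧ 1 ≤ jq.2),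
        ∑ rt ∈ Finset.HasAntidiagonal.antidiagonal (jq.1 - 1),
          (-1 : ℤ) ^ (rt.1 * jq.2 + rt.2 + ip.2 * jq.1) •
            m ip.1 jq.1 (fun l => toBigradedModule.insertAt ip.2 (2 - (ip.2 + jq.2))
              (m ip.2 jq.2) rt.1 x l) = 0
  m_one_unit : m 0 1 (fun _ => one) = 0
  one_mul : ∀ x, m 0 2 ![one, x] = x
  mul_one : ∀ x, m 0 2 ![x, one] = x
  m_unit : ∀ i j, 1 ≤ j → 3 ≤ i + j → ∀ (x : Fin j → carrier) (r : Fin j), x r = one →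
    m i j x = 0

/-- The exponent of the sign in front of `m_{ij}(f_{p_1 q_1} ⊗ ... ⊗ f_{p_j q_j})`, that is
`u + ∑_w (j p_w + w (q_{j-w} - p_w) + q_{j-w} ∑_{s > j-w} (p_s + q_s))`, with the terms sorted
by the (here zero-based) index of `p` and `q`. -/
def mapSignExponent (u j : ℕ) (p q : Fin j → ℕ) : ℕ :=
  u + ∑ a : Fin j, (j - 1 - (a : ℕ)) * (p a + q a) +
    ∑ a : Fin j, ∑ b ∈ Finset.Ioi a, q a * (p b + q b)

/-- A map of derived A-infinity algebras: maps `f p q : E^{⊗ q} → F[p, 1 - (p + q)]` for `p ≥ 0`,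
`q ≥ 1` (the entry `q = 0`, which does not occur in the definition, is set to zero). -/
structure DMap (E F : DAlgebra k) where
  f : (p q : ℕ) → MultilinearMap k (fun _ : Fin q => E.carrier) F.carrier
  f_zero : ∀ p, f p 0 = 0
  homogeneous : ∀ p q, 1 ≤ q →
    IsHomogeneous E.toBigradedModule F.toBigradedModule (f p q) p (1 - (p + q))
  rel : ∀ u v : ℕ, 1 ≤ v → ∀ x : ℕ → E.carrier,
    ∑ ip ∈ Finset.HasAntidiagonal.antidiagonal u,
      ∑ jq ∈ (Finset.HasAntidiagonal.antidiagonal (v + 1)).filter (fun jq => 1 ≤ jq.1 ∧ 1 ≤ jq.2),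
        ∑ rt ∈ Finset.HasAntidiagonal.antidiagonal (jq.1 - 1),
          (-1 : ℤ) ^ (rt.1 * jq.2 + rt.2 + ip.2 * jq.1) •
            f ip.1 jq.1 (fun l => E.insertAt ip.2 (2 - (ip.2 + jq.2))
              (E.m ip.2 jq.2) rt.1 x l) =
    ∑ j ∈ Finset.Icc 1 v, ∑ iP ∈ Finset.HasAntidiagonal.antidiagonal u,
      ∑ p ∈ Finset.Nat.antidiagonalTuple j iP.2,
        ∑ q ∈ (Finset.Nat.antidiagonalTuple j v).filter (fun q => ∀ a, 1 ≤ q a),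
          (-1 : ℤ) ^ mapSignExponent u j p q •
            F.m iP.1 j (fun a => f (p a) (q a) (fun c =>
              E.sgn (∑ b ∈ Finset.Ioi a, (p b : ℤ))
                (∑ b ∈ Finset.Ioi a, (1 - ((p b : ℤ) + q b)))
                (x (∑ b ∈ Finset.Iio a, q b + c))))
  f_one : f 0 1 (fun _ => E.one) = F.one
  f_unit : ∀ p q, 1 ≤ q → 2 ≤ p + q → ∀ (x : Fin q → E.carrier) (r : Fin q), x r = E.one →
    f p q x = 0

/-- The linear endomorphism `m_{i1}`. -/
def DAlgebra.diff (E : DAlgebra k) (i : ℕ) : E.carrier →ₗ[k] E.carrier :=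
  (MultilinearMap.ofSubsingleton k E.carrier E.carrier (0 : Fin 1)).symm (E.m i 1)

/-- The linear map `f_{01}`. -/
def DMap.linear {E F : DAlgebra k} (f : DMap E F) : E.carrier →ₗ[k] F.carrier :=
  (MultilinearMap.ofSubsingleton k E.carrier F.carrier (0 : Fin 1)).symm (f.f 0 1)

theorem update_zero_two {V : Type u} (x y z : V) : Function.update ![z, y] 0 x = ![x, y] := by
  ext i; fin_cases i <;> simp

theorem update_one_two {V : Type u} (x y z : V) : Function.update ![x, z] 1 y = ![x, y] := by
  ext i; fin_cases i <;> simp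

/-- The bilinear map `m_{02}`. -/
def DAlgebra.mul (E : DAlgebra k) : E.carrier →ₗ[k] E.carrier →ₗ[k] E.carrier :=
  LinearMap.mk₂ k (fun x y => E.m 0 2 ![x, y])
    (fun x x₁ y => by
      have h := (E.m 0 2).map_update_add ![0, y] 0 x x₁
      rwa [update_zero_two, update_zero_two, update_zero_two] at h)
    (fun c x y => by
      have h := (E.m 0 2).map_update_smul ![0, y] 0 c x
      rwa [update_zero_two, update_zero_two] at h)
    (fun x y y₁ => by
      have h := (E.m 0 2).map_update_add ![x, 0] 1 y y₁
      rwa [update_one_two, update_one_two, update_one_two] at h)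
    (fun c x y => by
      have h := (E.m 0 2).map_update_smul ![x, 0] 1 c y
      rwa [update_one_two, update_one_two] at h)

theorem filter_antidiagonal_two : (Finset.HasAntidiagonal.antidiagonal (1 + 1)).filter
    (fun jq : ℕ × ℕ => 1 ≤ jq.1 ∧ 1 ≤ jq.2) = {(1, 1)} := by decide

theorem filter_antidiagonal_three : (Finset.HasAntidiagonal.antidiagonal (2 + 1)).filter
    (fun jq : ℕ × ℕ => 1 ≤ jq.1 ∧ 1 ≤ jq.2) = {(1, 2), (2, 1)} := by decide

theorem filter_antidiagonal_four : (Finset.HasAntidiagonal.antidiagonal (3 + 1)).filter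
    (fun jq : ℕ × ℕ => 1 ≤ jq.1 ∧ 1 ≤ jq.2) = {(1, 3), (2, 2), (3, 1)} := by decide

/-! ### `E_2`-equivalences

The iterated homology with respect to `d₀` and then `d₁`, formed on total modules; since all maps
are homogeneous it is the direct sum of the groups `H^h_s(H^v_t)`, and a homogeneous map is an
isomorphism if and only if it is one in each bidegree. -/

section IteratedHomology

variable {V W : Type u} [AddCommGroup V] [Module k V] [AddCommGroup W] [Module k W]

/-- Elements which are cycles for `d₀` and whose `d₀`-homology class is a cycle for `d₁`. -/
def iterCycles (d₀ d₁ : V →ₗ[k] V) : Submodule k V :=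
  LinearMap.ker d₀ ⊓ (LinearMap.range d₀).comap d₁

/-- Elements of the form `d₀ y + d₁ z` with `d₀ z = 0`. -/
def iterBoundaries (d₀ d₁ : V →ₗ[k] V) : Submodule k V :=
  LinearMap.range d₀ ⊔ (LinearMap.ker d₀).map d₁

/-- The iterated homology `H^h(H^v)`. -/
abbrev IterHomology (d₀ d₁ : V →ₗ[k] V) : Type u :=
  iterCycles d₀ d₁ ⧸ (iterBoundaries d₀ d₁).submoduleOf (iterCycles d₀ d₁)

/-- The linear map `f` induces an isomorphism on iterated homology. -/
def InducesIterIso (d₀ d₁ : V →ₗ[k] V) (e₀ e₁ : W →ₗ[k] W) (f : V →ₗ[k] W) : Prop :=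
  ∃ φ : IterHomology d₀ d₁ ≃ₗ[k] IterHomology e₀ e₁,
    ∀ x : iterCycles d₀ d₁, ∃ h : f x ∈ iterCycles e₀ e₁,
      φ (Submodule.Quotient.mk x) = Submodule.Quotient.mk ⟨f x, h⟩

end IteratedHomology

/-- `E_2`-equivalences of derived A-infinity algebras. -/
def DMap.IsE2Equivalence {E F : DAlgebra k} (f : DMap E F) : Prop :=
  InducesIterIso (E.diff 0) (E.diff 1) (F.diff 0) (F.diff 1) f.linear

/-! ### Differential graded algebras and their homology algebras -/

/-- A `ℤ`-graded `k`-algebra. -/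
structure GradedAlg (k : Type u) [CommRing k] where
  carrier : Type u
  [ring : Ring carrier]
  [algebra : Algebra k carrier]
  grading : ℤ → Submodule k carrier
  [graded : GradedAlgebra grading]

attribute [instance] GradedAlg.ring GradedAlg.algebra GradedAlg.graded

/-- A differential graded `k`-algebra, with differential of degree `-1`. -/
structure DGA (k : Type u) [CommRing k] extends GradedAlg k where
  d : carrier →ₗ[k] carrier
  d_mem : ∀ t x, x ∈ grading t → d x ∈ grading (t - 1)
  d_d : ∀ x, d (d x) = 0
  leibniz : ∀ t x y, x ∈ grading t → d (x * y) = d x * y + (t.negOnePow : ℤ) • (x * d y)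

namespace DGA

variable (A : DGA k)

theorem d_one : A.d 1 = 0 := by
  have h := A.leibniz 0 1 1 (SetLike.GradedOne.one_mem (A := A.grading))
  simpa using h

theorem d_mul_of_cycle (x y : A.carrier) (hy : A.d y = 0) : A.d (x * y) = A.d x * y := by
  induction x using DirectSum.Decomposition.inductionOn A.grading with
  | zero => simp
  | homogeneous x => simp [A.leibniz _ _ y x.2, hy]
  | add x x₁ h h₁ => simp [add_mul, h, h₁]

theorem d_component (x : A.carrier) (t : ℤ) :
    A.d (DirectSum.decompose A.grading x t) = DirectSum.decompose A.grading (A.d x) (t - 1) := by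
  induction x using DirectSum.Decomposition.inductionOn A.grading with
  | zero => simp
  | @homogeneous i x =>
    by_cases h : i = t
    · subst h
      rw [DirectSum.decompose_of_mem_same _ x.2,
        DirectSum.decompose_of_mem_same _ (A.d_mem _ _ x.2)]
    · rw [DirectSum.decompose_of_mem_ne _ x.2 h,
        DirectSum.decompose_of_mem_ne _ (A.d_mem _ _ x.2) (by omega), map_zero]
  | add x x₁ h h₁ => simp [DirectSum.decompose_add, h, h₁]

/-- The subalgebra of cycles. -/
def cycles : Subalgebra k A.carrier where
  carrier := {x | A.d x = 0}
  mul_mem' {x y} hx hy := by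
    have hx : A.d x = 0 := hx
    simp [A.d_mul_of_cycle x y hy, hx]
  add_mem' {x y} hx hy := by
    have hx : A.d x = 0 := hx
    have hy : A.d y = 0 := hy
    simp [hx, hy]
  algebraMap_mem' c := by simp [Algebra.algebraMap_eq_smul_one, d_one]

theorem mul_d_mem_range (x b : A.carrier) (hx : A.d x = 0) :
    x * A.d b ∈ LinearMap.range A.d := by
  classical
  rw [← DirectSum.sum_support_decompose A.grading x, Finset.sum_mul]
  refine Submodule.sum_mem _ fun t _ => ?_
  have h := A.leibniz t _ b (DirectSum.decompose A.grading x t).2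
  rw [A.d_component, hx, DirectSum.decompose_zero] at h
  refine ⟨(t.negOnePow : ℤ) • ((DirectSum.decompose A.grading x t : A.carrier) * b), ?_⟩
  rw [map_zsmul, h]
  rcases Int.units_eq_one_or t.negOnePow with h1 | h1 <;> simp [h1]

/-- The ideal of boundaries in the algebra of cycles. -/
def boundaries : Ideal A.cycles where
  carrier := {z | (z : A.carrier) ∈ LinearMap.range A.d}
  add_mem' h h₁ := Submodule.add_mem (LinearMap.range A.d) h h₁
  zero_mem' := Submodule.zero_mem (LinearMap.range A.d)
  smul_mem' x z hz := by
    obtain ⟨b, hb⟩ := hz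
    have h := A.mul_d_mem_range x b x.2
    rw [hb] at h
    exact h

theorem mem_boundaries {z : A.cycles} : z ∈ A.boundaries ↔ ∃ b, A.d b = z := Iff.rfl

instance : A.boundaries.IsTwoSided where
  mul_mem_of_left {z} x hz := by
    obtain ⟨b, hb⟩ := A.mem_boundaries.mp hz
    exact ⟨b * x, by rw [A.d_mul_of_cycle b x x.2, hb]; rfl⟩

/-- The homology module `H_*(A)`, an algebra as the quotient of cycles by boundaries. -/
abbrev Homology : Type u := A.cycles ⧸ A.boundaries

/-- The homology class of a cycle. -/
abbrev cls : A.cycles →ₐ[k] A.Homology := Ideal.Quotient.mkₐ k A.boundaries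

/-- Classes of cycles of degree `t`. -/
def homologyGrading (t : ℤ) : Submodule k A.Homology :=
  ((A.grading t).comap A.cycles.val.toLinearMap).map A.cls.toLinearMap

theorem homologyGrading_isInternal : DirectSum.IsInternal A.homologyGrading := by
  classical
  rw [DirectSum.isInternal_submodule_iff_iSupIndep_and_iSup_eq_top]
  constructor
  · intro i
    rw [Submodule.disjoint_def]
    rintro _ ⟨z, hz, rfl⟩ hz₁
    have key : ∀ h ∈ ⨆ j, ⨆ (_ : j ≠ i), A.homologyGrading j,
        ∃ w : A.cycles, A.cls w = h ∧
          (DirectSum.decompose A.grading (w : A.carrier) i : A.carrier) = 0 := by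
      intro h hh
      rw [iSup_subtype'] at hh
      refine Submodule.iSup_induction _ (motive := fun h => ∃ w : A.cycles, A.cls w = h ∧
          (DirectSum.decompose A.grading (w : A.carrier) i : A.carrier) = 0) hh ?_ ?_ ?_
      · rintro ⟨j, hj⟩ _ ⟨w, hw, rfl⟩
        exact ⟨w, rfl, DirectSum.decompose_of_mem_ne _ hw hj⟩
      · exact ⟨0, map_zero _, by simp⟩
      · rintro _ _ ⟨w, rfl, hw⟩ ⟨w₁, rfl, hw₁⟩
        exact ⟨w + w₁, map_add _ _ _, by simp [DirectSum.decompose_add, hw, hw₁]⟩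
    obtain ⟨w, hw, hw0⟩ := key _ hz₁
    have hb : z - w ∈ A.boundaries := Ideal.Quotient.eq.mp hw.symm
    obtain ⟨b, hb⟩ := A.mem_boundaries.mp hb
    refine Ideal.Quotient.eq_zero_iff_mem.mpr ⟨DirectSum.decompose A.grading b (i + 1), ?_⟩
    rw [A.d_component, hb, add_sub_cancel_right]
    have hz : (z : A.carrier) ∈ A.grading i := hz
    simp [DirectSum.decompose_sub, hw0, DirectSum.decompose_of_mem_same _ hz]
  · rw [eq_top_iff]
    rintro h -
    obtain ⟨z, rfl⟩ := Ideal.Quotient.mk_surjective h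
    have hc : ∀ t, A.d (DirectSum.decompose A.grading (z : A.carrier) t) = 0 := fun t => by
      have hz : A.d z = 0 := z.2
      rw [A.d_component, hz]
      simp
    have hz : z = ∑ t ∈ (DirectSum.decompose A.grading (z : A.carrier)).support,
        (⟨DirectSum.decompose A.grading (z : A.carrier) t, hc t⟩ : A.cycles) := by
      apply Subtype.ext
      rw [AddSubmonoidClass.coe_finsetSum]
      exact (DirectSum.sum_support_decompose A.grading (z : A.carrier)).symm
    rw [hz, map_sum]
    refine Submodule.sum_mem _ fun t _ => Submodule.mem_iSup_of_mem t ⟨_, ?_, rfl⟩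
    exact (DirectSum.decompose A.grading (z : A.carrier) t).2

instance : GradedAlgebra A.homologyGrading where
  one_mem := ⟨1, SetLike.GradedOne.one_mem (A := A.grading), map_one A.cls⟩
  mul_mem := by
    rintro i j _ _ ⟨z, hz, rfl⟩ ⟨w, hw, rfl⟩
    exact ⟨z * w, SetLike.GradedMul.mul_mem (A := A.grading) hz hw, map_mul A.cls _ _⟩
  toDecomposition := A.homologyGrading_isInternal.chooseDecomposition

/-- The graded algebra `H_*(A)`. -/
def homology : GradedAlg k where
  carrier := A.Homology
  grading := A.homologyGrading

/-- The underlying bigraded module, concentrated in horizontal degree `0`. -/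
abbrev toBigradedModule : BigradedModule k where
  carrier := A.carrier
  piece st := if st.1 = 0 then A.grading st.2 else ⊥
  isInternal := by
    have h := DirectSum.Decomposition.isInternal A.grading
    rw [DirectSum.isInternal_submodule_iff_iSupIndep_and_iSup_eq_top] at h ⊢
    refine ⟨?_, ?_⟩
    · rintro ⟨s, t⟩
      by_cases hs : s = 0
      · subst hs
        simp only [if_true]
        refine (h.1 t).mono_right (iSup₂_le ?_)
        rintro ⟨s₁, t₁⟩ hne
        split_ifs with h1
        · simp only at h1
          subst h1
          exact le_iSup₂_of_le t₁ (fun h2 => hne (by rw [h2])) le_rfl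
        · exact bot_le
      · simp [hs]
    · rw [eq_top_iff, ← h.2]
      exact iSup_le fun t => le_iSup_of_le (0, t) (by simp)
  piece_neg s t hs := by simp [hs.ne]

/-- The structure maps of a dga: only `m_{01} = d` and `m_{02}`, the product, are non-zero. -/
def op : (i j : ℕ) → MultilinearMap k (fun _ : Fin j => A.carrier) A.carrier
  | 0, 1 => MultilinearMap.ofSubsingleton k A.carrier A.carrier 0 A.d
  | 0, 2 => MultilinearMap.mkPiAlgebraFin k 2 A.carrier
  | _, _ => 0

theorem op_eq_zero (i j : ℕ) (h : ¬ (i = 0 ∧ (j = 1 ∨ j = 2))) : A.op i j = 0 := by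
  unfold op
  split <;> simp_all

theorem op_one (x : Fin 1 → A.carrier) : A.op 0 1 x = A.d (x 0) := rfl

theorem op_two (x : Fin 2 → A.carrier) : A.op 0 2 x = x 0 * x 1 := by
  simp [op, MultilinearMap.mkPiAlgebraFin_apply]

theorem eq_zero_or_of_mem {st : ℤ × ℤ} {x : A.carrier} (hx : x ∈ A.toBigradedModule.piece st) :
    x = 0 ∨ st.1 = 0 ∧ x ∈ A.grading st.2 := by
  by_cases h : st.1 = 0
  · exact Or.inr ⟨h, by simpa [h] using hx⟩
  · exact Or.inl (by simpa [h] using hx)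

theorem mem_piece {st : ℤ × ℤ} {x : A.carrier} (h : st.1 = 0) (hx : x ∈ A.grading st.2) :
    x ∈ A.toBigradedModule.piece st := by
  simpa [h] using hx

theorem op_sgn_mul (x y : A.carrier) :
    A.d (x * y) = A.d x * y + A.toBigradedModule.sgn 0 1 x * A.d y := by
  induction x using DirectSum.Decomposition.inductionOn A.grading with
  | zero => simp
  | @homogeneous i x =>
    rw [A.leibniz _ _ y x.2,
      A.toBigradedModule.sgn_of_mem 0 1 (st := (0, i)) (A.mem_piece rfl x.2)]
    simp [mul_assoc]
  | add x x₁ h h₁ =>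
    rw [add_mul, map_add, h, h₁, map_add, map_add, add_mul, add_mul]
    abel

theorem sgn_zero_even (n : ℤ) (hn : Even n) (x : A.carrier) :
    A.toBigradedModule.sgn 0 n x = x := by
  induction x using DirectSum.Decomposition.inductionOn A.grading with
  | zero => exact map_zero _
  | @homogeneous i x =>
    rw [A.toBigradedModule.sgn_of_mem 0 n (st := (0, i)) (A.mem_piece rfl x.2),
      Int.negOnePow_even _ (by simpa using hn.mul_left i)]
    exact one_zsmul _
  | add x x₁ h h₁ => rw [map_add, h, h₁]

/-- A dga as a derived A-infinity algebra concentrated in horizontal degree `0`. -/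
def toDAlgebra : DAlgebra k where
  toBigradedModule := A.toBigradedModule
  m := A.op
  m_zero i := A.op_eq_zero i 0 (by omega)
  one := (1 : A.carrier)
  one_mem := by simpa using SetLike.GradedOne.one_mem (A := A.grading)
  homogeneous := by
    intro i j _ deg x hx
    by_cases h : i = 0 ∧ (j = 1 ∨ j = 2)
    · obtain ⟨rfl, rfl | rfl⟩ := h
      · rw [op_one]
        rcases A.eq_zero_or_of_mem (hx 0) with h0 | ⟨h0, h0'⟩
        · rw [h0, map_zero]
          exact Submodule.zero_mem _
        · exact A.mem_piece (by simp [h0]) (by simpa using A.d_mem _ _ h0')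
      · rw [op_two]
        rcases A.eq_zero_or_of_mem (hx 0) with h0 | ⟨h0, h0'⟩
        · rw [h0, zero_mul]
          exact Submodule.zero_mem _
        rcases A.eq_zero_or_of_mem (hx 1) with h1 | ⟨h1, h1'⟩
        · rw [h1, mul_zero]
          exact Submodule.zero_mem _
        exact A.mem_piece (by simp [h0, h1])
          (by simpa using SetLike.GradedMul.mul_mem (A := A.grading) h0' h1')
    · rw [A.op_eq_zero i j h]
      exact Submodule.zero_mem _
  rel := by
    intro u v hv x
    by_cases huv : u = 0 ∧ v ≤ 3
    · obtain ⟨rfl, hv3⟩ := huv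
      obtain rfl | rfl | rfl : v = 1 ∨ v = 2 ∨ v = 3 := by omega
      · rw [filter_antidiagonal_two]
        simp [BigradedModule.insertAt, op_one, A.d_d]
      · rw [filter_antidiagonal_three]
        simp [BigradedModule.insertAt, op_one, op_two, Finset.Nat.antidiagonal_succ]
        rw [A.op_sgn_mul]
        abel
      · rw [filter_antidiagonal_four]
        have h3 : A.op 0 3 = 0 := A.op_eq_zero 0 3 (by omega)
        simp [BigradedModule.insertAt, op_two, Finset.Nat.antidiagonal_succ, h3]
        rw [A.sgn_zero_even 0 Even.zero, mul_assoc]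
        abel_nf
        exact map_zero A.d
    · refine Finset.sum_eq_zero fun ip hip => Finset.sum_eq_zero fun jq hjq =>
        Finset.sum_eq_zero fun rt hrt => ?_
      simp only [Finset.mem_filter, Finset.HasAntidiagonal.mem_antidiagonal] at hip hjq hrt
      by_cases h1 : ip.1 = 0 ∧ (jq.1 = 1 ∨ jq.1 = 2)
      · have h2 : A.op ip.2 jq.2 = 0 := A.op_eq_zero _ _ (by omega)
        have h3 := (A.op ip.1 jq.1).map_coord_zero (m := fun l => A.toBigradedModule.insertAt ip.2
          (2 - (ip.2 + jq.2)) (A.op ip.2 jq.2) rt.1 x l) ⟨rt.1, by omega⟩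
          (by simp [BigradedModule.insertAt, h2])
        rw [h3, smul_zero]
      · rw [A.op_eq_zero _ _ h1]
        simp
  m_one_unit := A.d_one
  one_mul x := (A.op_two _).trans (_root_.one_mul (x : A.carrier))
  mul_one x := (A.op_two _).trans (_root_.mul_one (x : A.carrier))
  m_unit i j _ h x r _ := by
    rw [A.op_eq_zero i j (by omega)]
    rfl

end DGA

/-! ### Bidgas with trivial vertical differential, and resolutions of graded algebras -/

/-- The data of a bidga with trivial vertical differential: a bigraded module with a bilinear
multiplication, a unit and a horizontal differential `d = m_{11}`. -/
structure BidgaData (k : Type u) [CommRing k] extends BigradedModule k where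
  mul : carrier →ₗ[k] carrier →ₗ[k] carrier
  one : carrier
  d : carrier →ₗ[k] carrier

/-- The laws of a bidga with trivial vertical differential: a monoid in bicomplexes whose first
differential vanishes. -/
structure BidgaData.IsBidga (E : BidgaData k) : Prop where
  mul_mem : ∀ st st' x y, x ∈ E.piece st → y ∈ E.piece st' → E.mul x y ∈ E.piece (st + st')
  one_mem : E.one ∈ E.piece (0, 0)
  d_mem : ∀ s t x, x ∈ E.piece (s, t) → E.d x ∈ E.piece (s - 1, t)
  mul_assoc : ∀ x y z, E.mul (E.mul x y) z = E.mul x (E.mul y z)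
  one_mul : ∀ x, E.mul E.one x = x
  mul_one : ∀ x, E.mul x E.one = x
  d_d : ∀ x, E.d (E.d x) = 0
  leibniz : ∀ s t x y, x ∈ E.piece (s, t) →
    E.d (E.mul x y) = E.mul (E.d x) y + (s.negOnePow : ℤ) • E.mul x (E.d y)

/-- Maps of bidgas. -/
structure IsBidgaMap (E F : BidgaData k) (φ : E.carrier →ₗ[k] F.carrier) : Prop where
  map_mem : ∀ st x, x ∈ E.piece st → φ x ∈ F.piece st
  map_mul : ∀ x y, φ (E.mul x y) = F.mul (φ x) (φ y)
  map_one : φ E.one = F.one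
  map_d : ∀ x, φ (E.d x) = F.d (φ x)

theorem IsBidgaMap.id (E : BidgaData k) : IsBidgaMap E E LinearMap.id :=
  ⟨fun _ _ h => h, fun _ _ => rfl, rfl, fun _ => rfl⟩

theorem IsBidgaMap.map_sgn {E F : BidgaData k} {φ : E.carrier →ₗ[k] F.carrier}
    (h : IsBidgaMap E F φ) (a b : ℤ) (x : E.carrier) : φ (E.sgn a b x) = F.sgn a b (φ x) := by
  induction x using E.induction with
  | h0 => simp
  | hom st x hx => rw [E.sgn_of_mem a b hx, F.sgn_of_mem a b (h.map_mem _ _ hx), map_zsmul]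
  | add x y hx hy => simp [hx, hy]

/-- A bidga (with trivial vertical differential) over a graded algebra `Λ`, as mere data. -/
structure ResolutionData (Λ : GradedAlg k) extends BidgaData k where
  aug : carrier →ₗ[k] Λ.carrier

/-- Termwise `k`-projective resolutions of `Λ`: bidgas with trivial vertical differential that are
`k`-projective in every bidegree, with a map of bidgas to `Λ` (regarded as concentrated in
horizontal degree `0`, with trivial differentials) that is an `E_2`-equivalence. -/
structure ResolutionData.IsResolution {Λ : GradedAlg k} (R : ResolutionData Λ) : Prop where
  isBidga : R.toBidgaData.IsBidga
  projective : ∀ st, Module.Projective k (R.piece st)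
  aug_mem : ∀ t x, x ∈ R.piece (0, t) → R.aug x ∈ Λ.grading t
  aug_zero : ∀ s t x, s ≠ 0 → x ∈ R.piece (s, t) → R.aug x = 0
  aug_mul : ∀ x y, R.aug (R.mul x y) = R.aug x * R.aug y
  aug_one : R.aug R.one = 1
  aug_d : ∀ x, R.aug (R.d x) = 0
  isE2 : InducesIterIso 0 R.d 0 0 R.aug

/-- Termwise `k`-projective resolutions of a graded algebra. -/
structure Resolution (Λ : GradedAlg k) extends ResolutionData Λ where
  isResolution : toResolutionData.IsResolution

/-- Maps of resolutions: maps of bidgas over `Λ`; they are automatically `E_2`-equivalences. -/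
structure ResolutionMap {Λ : GradedAlg k} (R S : Resolution Λ) where
  map : R.carrier →ₗ[k] S.carrier
  isBidgaMap : IsBidgaMap R.toBidgaData S.toBidgaData map
  aug_map : ∀ x, S.aug (map x) = R.aug x

/-! ### The Hochschild complex

`C^{rst}(E, F)` consists of the maps of bigraded modules `E^{⊗ r} → F[s, t]`, where `r ≥ 0` and
`s, t` are integers. The bidga `F` is an `E`-bimodule through a map of bidgas `φ : E → F`.
An element of total degree `q` has one component in `C^{r, q - r, t}` for every `r`. -/

section Hochschild

variable {E F G : BidgaData k}

/-- Families of multilinear maps, one for every number `r` of arguments. -/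
abbrev Cochain (E F : BidgaData k) : Type u :=
  (r : ℕ) → MultilinearMap k (fun _ : Fin r => E.carrier) F.carrier

/-- The Hochschild differential `d_HH c` of a component `c` of bidegree `[s, t]`, given by its
values. -/
def hochDiff (φ : E.carrier →ₗ[k] F.carrier) (s t : ℤ) {r : ℕ}
    (c : MultilinearMap k (fun _ : Fin r => E.carrier) F.carrier)
    (x : Fin (r + 1) → E.carrier) : F.carrier :=
  F.mul (φ (E.sgn s t (x 0))) (c (Fin.tail x)) +
    (-1 : ℤ) ^ (r + 1) • F.mul (c (Fin.init x)) (φ (x (Fin.last r))) +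
    ∑ j : Fin r, (-1 : ℤ) ^ ((j : ℕ) + 1) •
      c (Fin.contractNth j.castSucc (fun a b => E.mul a b) x)

/-- The differential `d_Hom c` induced by the horizontal differentials of `E` and `F`, of a
component `c` of horizontal degree `s`, given by its values. -/
def homDiff (s : ℤ) {r : ℕ} (c : MultilinearMap k (fun _ : Fin r => E.carrier) F.carrier)
    (x : Fin r → E.carrier) : F.carrier :=
  F.d (c x) - (s.negOnePow : ℤ) • ∑ j : Fin r,
    c (fun l => if l < j then E.sgn 1 0 (x l) else if l = j then E.d (x l) else x l)

/-- The total differential `d_Hom - (-1)^q d_HH` on cochains of total degree `q`, by its values. -/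
def totDiff (φ : E.carrier →ₗ[k] F.carrier) (q t : ℤ) (c : Cochain E F) :
    (r : ℕ) → (Fin r → E.carrier) → F.carrier
  | 0, x => homDiff q (c 0) x
  | r + 1, x => homDiff (q - (r + 1)) (c (r + 1)) x -
      (q.negOnePow : ℤ) • hochDiff φ (q - r) t (c r) x

theorem hochDiff_add (φ : E.carrier →ₗ[k] F.carrier) (s t : ℤ) {r : ℕ}
    (c c' : MultilinearMap k (fun _ : Fin r => E.carrier) F.carrier) (x) :
    hochDiff φ s t (c + c') x = hochDiff φ s t c x + hochDiff φ s t c' x := by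
  simp only [hochDiff, _root_.add_apply, map_add, LinearMap.add_apply, smul_add,
    Finset.sum_add_distrib]
  abel

theorem hochDiff_smul (φ : E.carrier →ₗ[k] F.carrier) (s t : ℤ) {r : ℕ} (a : k)
    (c : MultilinearMap k (fun _ : Fin r => E.carrier) F.carrier) (x) :
    hochDiff φ s t (a • c) x = a • hochDiff φ s t c x := by
  simp only [hochDiff, _root_.smul_apply, map_smul, LinearMap.smul_apply, smul_add,
    Finset.smul_sum, smul_comm a]

theorem homDiff_add (s : ℤ) {r : ℕ}
    (c c' : MultilinearMap k (fun _ : Fin r => E.carrier) F.carrier) (x) :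
    homDiff s (c + c') x = homDiff s c x + homDiff s c' x := by
  simp only [homDiff, _root_.add_apply, map_add, smul_add, Finset.sum_add_distrib]
  abel

theorem homDiff_smul (s : ℤ) {r : ℕ} (a : k)
    (c : MultilinearMap k (fun _ : Fin r => E.carrier) F.carrier) (x) :
    homDiff s (a • c) x = a • homDiff s c x := by
  simp only [homDiff, _root_.smul_apply, map_smul, smul_sub, ← Finset.smul_sum, smul_comm a]

theorem totDiff_add (φ : E.carrier →ₗ[k] F.carrier) (q t : ℤ) (c c' : Cochain E F) (r : ℕ) (x) :
    totDiff φ q t (c + c') r x = totDiff φ q t c r x + totDiff φ q t c' r x := by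
  cases r with
  | zero => exact homDiff_add _ _ _ _
  | succ r =>
    simp only [totDiff, Pi.add_apply, homDiff_add, hochDiff_add, smul_add]
    abel

theorem totDiff_smul (φ : E.carrier →ₗ[k] F.carrier) (q t : ℤ) (a : k) (c : Cochain E F) (r : ℕ)
    (x) : totDiff φ q t (a • c) r x = a • totDiff φ q t c r x := by
  cases r with
  | zero => exact homDiff_smul _ _ _ _
  | succ r => simp only [totDiff, Pi.smul_apply, homDiff_smul, hochDiff_smul, smul_sub, smul_comm a]

/-- The cochains of total degree `q` and internal degree `t`: the product of the
`C^{r, q - r, t}(E, F)` over all `r`. -/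
def cochains (E F : BidgaData k) (q t : ℤ) : Submodule k (Cochain E F) where
  carrier := {c | ∀ r : ℕ,
    IsHomogeneous E.toBigradedModule F.toBigradedModule (c r) (q - r) t}
  add_mem' h h' r deg x hx := Submodule.add_mem _ (h r deg x hx) (h' r deg x hx)
  zero_mem' _ _ _ _ := Submodule.zero_mem _
  smul_mem' a _ h r deg x hx := Submodule.smul_mem _ a (h r deg x hx)

/-- The cocycles of the total complex. -/
def cocycles (φ : E.carrier →ₗ[k] F.carrier) (q t : ℤ) : Submodule k (Cochain E F) where
  carrier := {c | c ∈ cochains E F q t ∧ ∀ r x, totDiff φ q t c r x = 0}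
  add_mem' h h' := ⟨Submodule.add_mem _ h.1 h'.1, fun r x => by
    rw [totDiff_add, h.2, h'.2, add_zero]⟩
  zero_mem' := ⟨Submodule.zero_mem _, fun r x => by
    have h := totDiff_smul φ q t 0 (0 : Cochain E F) r x
    rwa [zero_smul, zero_smul] at h⟩
  smul_mem' a c h := ⟨Submodule.smul_mem _ a h.1, fun r x => by
    rw [totDiff_smul, h.2, smul_zero]⟩

/-- The coboundaries of the total complex. -/
def coboundaries (φ : E.carrier →ₗ[k] F.carrier) (q t : ℤ) : Submodule k (Cochain E F) where
  carrier := {c | ∃ b ∈ cochains E F (q - 1) t, ∀ r x, totDiff φ (q - 1) t b r x = c r x}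
  add_mem' := by
    rintro _ _ ⟨b, hb, h⟩ ⟨b', hb', h'⟩
    exact ⟨b + b', Submodule.add_mem _ hb hb', fun r x => by rw [totDiff_add, h, h']; rfl⟩
  zero_mem' := ⟨0, Submodule.zero_mem _, fun r x => by
    have h := totDiff_smul φ (q - 1) t 0 (0 : Cochain E F) r x
    rw [zero_smul, zero_smul] at h
    rw [h]; rfl⟩
  smul_mem' := by
    rintro a _ ⟨b, hb, h⟩
    exact ⟨a • b, Submodule.smul_mem _ a hb, fun r x => by rw [totDiff_smul, h]; rfl⟩

/-- The graded Hochschild cohomology `HH^{q,t}(E, F)`, where `F` is an `E`-bimodule through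
`φ : E → F`. -/
abbrev HH (φ : E.carrier →ₗ[k] F.carrier) (q t : ℤ) : Type u :=
  cocycles φ q t ⧸ (coboundaries φ q t).submoduleOf (cocycles φ q t)

/-- The class of a cocycle. -/
def HH.mk (φ : E.carrier →ₗ[k] F.carrier) (q t : ℤ) (c : Cochain E F)
    (hc : c ∈ cocycles φ q t) : HH φ q t :=
  Submodule.Quotient.mk ⟨c, hc⟩

/-- Composition of cochains with a map of the coefficients. -/
def pushCochain (φ : F.carrier →ₗ[k] G.carrier) : Cochain E F →ₗ[k] Cochain E G where
  toFun c r := φ.compMultilinearMap (c r)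
  map_add' c c' := by ext r x; simp
  map_smul' a c := by ext r x; simp

/-- Composition of cochains with the tensor powers of a map of the arguments. -/
def pullCochain (φ : E.carrier →ₗ[k] F.carrier) : Cochain F G →ₗ[k] Cochain E G where
  toFun c r := (c r).compLinearMap fun _ => φ
  map_add' c c' := by ext r x; simp
  map_smul' a c := by ext r x; simp

theorem push_mem {φ : F.carrier →ₗ[k] G.carrier} (hφ : IsBidgaMap F G φ) {q t : ℤ}
    {c : Cochain E F} (hc : c ∈ cochains E F q t) : pushCochain φ c ∈ cochains E G q t :=
  fun r deg x hx => hφ.map_mem _ _ (hc r deg x hx)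

theorem pull_mem {φ : E.carrier →ₗ[k] F.carrier} (hφ : IsBidgaMap E F φ) {q t : ℤ}
    {c : Cochain F G} (hc : c ∈ cochains F G q t) : pullCochain φ c ∈ cochains E G q t :=
  fun r deg _ hx => hc r deg _ fun l => hφ.map_mem _ _ (hx l)

theorem totDiff_push {φ : E.carrier →ₗ[k] F.carrier} (hφ : IsBidgaMap E F φ) (q t : ℤ)
    (c : Cochain E E) (r : ℕ) (x) :
    totDiff φ q t (pushCochain φ c) r x = φ (totDiff LinearMap.id q t c r x) := by
  cases r with
  | zero => simp [totDiff, homDiff, pushCochain, hφ.map_d]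
  | succ r => simp [totDiff, homDiff, hochDiff, pushCochain, hφ.map_d, hφ.map_mul]

theorem totDiff_pull {φ : E.carrier →ₗ[k] F.carrier} (hφ : IsBidgaMap E F φ) (q t : ℤ)
    (c : Cochain F F) (r : ℕ) (x : Fin r → E.carrier) :
    totDiff φ q t (pullCochain φ c) r x = totDiff LinearMap.id q t c r (fun l => φ (x l)) := by
  have h1 : ∀ (r : ℕ) (s : ℤ) (x : Fin r → E.carrier),
      homDiff s (pullCochain φ c r) x = homDiff s (c r) (fun l => φ (x l)) := by
    intro r s x
    simp only [homDiff, pullCochain, LinearMap.coe_mk, AddHom.coe_mk,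
      MultilinearMap.compLinearMap_apply]
    congr 3
    funext j
    congr 1
    funext l
    split_ifs
    · exact hφ.map_sgn _ _ _
    · exact hφ.map_d _
    · rfl
  cases r with
  | zero => exact h1 _ _ _
  | succ r =>
    have h2 : ∀ s : ℤ, hochDiff φ s t (pullCochain φ c r) x =
        hochDiff LinearMap.id s t (c r) (fun l => φ (x l)) := by
      intro s
      simp only [hochDiff, pullCochain, LinearMap.coe_mk, AddHom.coe_mk,
        MultilinearMap.compLinearMap_apply, LinearMap.id_apply, hφ.map_sgn]
      congr 1
      refine Finset.sum_congr rfl fun j _ => ?_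
      congr 2
      funext l
      simp only [Fin.contractNth]
      split_ifs
      · rfl
      · exact hφ.map_mul _ _
      · rfl
    simp only [totDiff, h1, h2]

/-- The map `φ_* : HH(E, E) → HH(E, F)`. -/
def HH.push {φ : E.carrier →ₗ[k] F.carrier} (hφ : IsBidgaMap E F φ) (q t : ℤ) :
    HH (LinearMap.id : E.carrier →ₗ[k] E.carrier) q t →ₗ[k] HH φ q t :=
  Submodule.mapQ _ _
    ((pushCochain φ).restrict (p := cocycles LinearMap.id q t) (q := cocycles φ q t)
      fun c hc => ⟨push_mem hφ hc.1, fun r x => by rw [totDiff_push hφ, hc.2, map_zero]⟩)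
    (by
      rintro ⟨c, hc⟩ ⟨b, hb, h⟩
      exact ⟨pushCochain φ b, push_mem hφ hb, fun r x => by rw [totDiff_push hφ, h]; rfl⟩)

/-- The map `φ^* : HH(F, F) → HH(E, F)`. -/
def HH.pull {φ : E.carrier →ₗ[k] F.carrier} (hφ : IsBidgaMap E F φ) (q t : ℤ) :
    HH (LinearMap.id : F.carrier →ₗ[k] F.carrier) q t →ₗ[k] HH φ q t :=
  Submodule.mapQ _ _
    ((pullCochain φ).restrict (p := cocycles LinearMap.id q t) (q := cocycles φ q t)
      fun c hc => ⟨pull_mem hφ hc.1, fun r x => by rw [totDiff_pull hφ, hc.2]⟩)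
    (by
      rintro ⟨c, hc⟩ ⟨b, hb, h⟩
      exact ⟨pullCochain φ b, pull_mem hφ hb, fun r x => by rw [totDiff_pull hφ, h]; rfl⟩)

end Hochschild

/-! ### Derived Hochschild cohomology -/

/-- `HH^{q,t}(R, R)`. -/
abbrev SelfHH (R : BidgaData k) (q t : ℤ) : Type u :=
  HH (LinearMap.id : R.carrier →ₗ[k] R.carrier) q t

/-- The derived Hochschild cohomology `dHH^{q,t}(Λ)`: the groups `HH^{q,t}(R, R)` of all termwise
`k`-projective resolutions `R → Λ`, identified along
`α_* : HH(R, R) → HH(R, S) ← HH(S, S) : α^*` for all maps `α : R → S` of resolutions. An element is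
a compatible choice of an element of every `HH^{q,t}(R, R)`. -/
def dHochschild (Λ : GradedAlg k) (q t : ℤ) :
    Submodule k ((R : Resolution Λ) → SelfHH R.toBidgaData q t) where
  carrier := {z | ∀ (R S : Resolution Λ) (α : ResolutionMap R S),
    HH.push α.isBidgaMap q t (z R) = HH.pull α.isBidgaMap q t (z S)}
  add_mem' h h' R S α := by simp only [Pi.add_apply, map_add, h R S α, h' R S α]
  zero_mem' R S α := by simp only [Pi.zero_apply, map_zero]
  smul_mem' a z h R S α := by simp only [Pi.smul_apply, map_smul, h R S α]

/-- The comparison map `dHH^{q,t}(Λ) → HH^{q,t}(R, R)` for a resolution `R → Λ`. -/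
def dHochschild.eval {Λ : GradedAlg k} (R : Resolution Λ) (q t : ℤ) :
    dHochschild Λ q t →ₗ[k] SelfHH R.toBidgaData q t :=
  LinearMap.proj R ∘ₗ (dHochschild Λ q t).subtype

/-! ### Minimal models -/

/-- A minimal model of a dga `A`: a derived A-infinity algebra `E` which is minimal and
`k`-projective in every bidegree, with an `E_2`-equivalence `E → A`. -/
structure MinimalModel (A : DGA k) where
  E : DAlgebra k
  minimal : E.m 0 1 = 0
  projective : ∀ st, Module.Projective k (E.piece st)
  f : DMap E A.toDAlgebra
  isE2 : f.IsE2Equivalence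

namespace MinimalModel

variable {A : DGA k} (M : MinimalModel A)

/-- The bigraded module `E` with multiplication `m_{02}` and differential `m_{11}`. -/
def toBidgaData : BidgaData k where
  toBigradedModule := M.E.toBigradedModule
  mul := M.E.mul
  one := M.E.one
  d := M.E.diff 1

theorem d_linear (x : M.E.carrier) : A.d (M.f.linear x) = 0 := by
  have h := M.f.rel 0 1 le_rfl (fun _ => x)
  rw [filter_antidiagonal_two] at h
  simp [BigradedModule.insertAt, M.minimal, Finset.Nat.antidiagonalTuple_one,
    Finset.filter_singleton, mapSignExponent] at h
  rw [(M.f.f 0 1).map_coord_zero 0 rfl, M.E.sgn_zero_zero] at h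
  exact h.symm

/-- The augmentation `E → H_*(A)`, sending `x` to the homology class of `f_{01}(x)`. -/
def aug : M.E.carrier →ₗ[k] A.homology.carrier :=
  A.cls.toLinearMap ∘ₗ
    M.f.linear.codRestrict (Subalgebra.toSubmodule A.cycles) (fun x => M.d_linear x)

/-- The bidga `(E, m_{11}, m_{02})` with its augmentation to `H_*(A)`. -/
def toResolutionData : ResolutionData A.homology where
  toBidgaData := M.toBidgaData
  aug := M.aug

/-- The cochain `m_{03} + m_{12} + m_{21}`: its component with three arguments is `m_{03}`, that
with two is `m_{12}`, that with one is `m_{21}`, and the others vanish. -/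
def cochain : Cochain M.toBidgaData M.toBidgaData
  | 1 => M.E.m 2 1
  | 2 => M.E.m 1 2
  | 3 => M.E.m 0 3
  | _ => 0

end MinimalModel

end Dainf

end

/-! Write Λ for the algebra H_*(A). The proof has three strands: every single resolution computes
dHH(Λ), a minimal model carries a cocycle on its own resolution, and the comparison between
resolutions matches the classes of different minimal models.

Invariance. The augmentation of a resolution R is a surjection with acyclic kernel
(`ResolutionData.IsResolution.isTrivialFibration`). The total Hochschild complex is a product over
the number r of arguments, and its columns are the complexes Hom(R^{⊗r}, -). Since R is projective
and bounded below, columns with acyclic coefficients are exact (`exists_homD_eq`), and exact columns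
make the total complex exact, because the equation can be solved one component after the other
(`exists_totD`). Hence HH(R, R) → HH(R, Λ) is an isomorphism (`augHH_bijective`). A trivial
fibration R → S of resolutions is a deformation retraction of complexes, and its homotopy extends to
tensor powers; so HH(S, Λ) → HH(R, Λ) is an isomorphism as well
(`ResolutionMap.restrict_bijective`). By `push_eq_pull_iff`, compatibility of a family of classes
can be tested in the groups HH(R, Λ). Tensor powers are never formed: everything is done by currying
the first argument and induction on r.

Comparison. Two resolutions S and R are dominated by `span S R`, the free bidga which has one
generator for each cycle of words and each compatible label in the fibre product of S and R over Λ.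
Both projections are trivial fibrations, and the construction is functorial in S because a map S →
S' merely changes labels. The zigzag S ← `span S R` → R therefore transports a class from R to every
S, and functoriality makes the transported classes compatible (`dHochschild.eval_bijective`).

The class. For a minimal model, the structure equations with u + v = 3 say that E is a bidga, and
those with u + v = 4 say that m_{03} + m_{12} + m_{21} is a cocycle. The equations for f with u + v
= 2 say that f_{02} and f_{11} are homotopies which make f_{01} compatible with products and with
m_{11}. Those with u + v = 3 express f_{01} of m_{03}, m_{12} and m_{21}, up to boundaries, in terms
of f_{01}, f_{02} and f_{11} alone. So the image of the cocycle in HH(E, Λ) is the obstruction of a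
`HomotopyMap` (`MinimalModel.isObstruction`). The gain is that homotopy maps can be restricted along
any map of bidgas; no higher structure has to be lifted to the span. Two homotopy maps on a
projective bidga which agree in homology satisfy f' - f = d g for some g, and g yields a cochain
whose differential is the difference of the obstructions (`HomotopyMap.sub_mem_coboundaries`).
Applied to the span of two minimal models, this identifies their classes. -/

noncomputable section

namespace Dainf

open DirectSum

/-! ### Multilinear maps in one variable at a time -/

section Multilinear

variable {k : Type u} [CommRing k] {U V W X : Type u} [AddCommGroup U] [Module k U]
  [AddCommGroup V] [Module k V] [AddCommGroup W] [Module k W] [AddCommGroup X] [Module k X]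

/-- Multilinear maps `V × ... × V → W` with `r` arguments. -/
abbrev Mult (k : Type u) [CommRing k] (V W : Type u) [AddCommGroup V] [Module k V]
    [AddCommGroup W] [Module k W] (r : ℕ) : Type u :=
  MultilinearMap k (fun _ : Fin r => V) W

/-- Separation of the first argument. -/
def cur {r : ℕ} : Mult k V W (r + 1) ≃ₗ[k] (V →ₗ[k] Mult k V W r) :=
  multilinearCurryLeftEquiv k (fun _ : Fin (r + 1) => V) W

/-- Insertion of a first argument. -/
def unc {r : ℕ} (f : V →ₗ[k] Mult k V W r) : Mult k V W (r + 1) := cur.symm f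

@[simp] theorem cur_unc {r : ℕ} (f : V →ₗ[k] Mult k V W r) : cur (unc f) = f :=
  LinearEquiv.apply_symm_apply _ _

theorem cur_apply {r : ℕ} (c : Mult k V W (r + 1)) (x : V) (y : Fin r → V) :
    cur c x y = c (Fin.cons x y) := rfl

theorem apply_eq_cur {r : ℕ} (c : Mult k V W (r + 1)) (x : Fin (r + 1) → V) :
    c x = cur c (x 0) (Fin.tail x) := by
  rw [cur_apply, Fin.cons_self_tail]

theorem mult_ext {r : ℕ} {c c' : Mult k V W (r + 1)} (h : ∀ x, cur c x = cur c' x) : c = c' :=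
  cur.injective (LinearMap.ext h)

@[simp] theorem cur_comp {r : ℕ} (ψ : W →ₗ[k] X) (c : Mult k V W (r + 1)) (x : V) :
    cur (ψ.compMultilinearMap c) x = ψ.compMultilinearMap (cur c x) := rfl

theorem cur_compLinearMap {r : ℕ} (α : U →ₗ[k] V) (c : Mult k V W (r + 1)) (x : U) :
    cur (c.compLinearMap fun _ => α) x = (cur c (α x)).compLinearMap fun _ => α := by
  ext y
  simp only [cur_apply, MultilinearMap.compLinearMap_apply]
  congr 1
  funext i
  refine Fin.cases ?_ (fun i => ?_) i <;> simp

/-- The sum of the multilinear maps obtained by applying `D` to one argument and `σ` to all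
arguments before it. -/
def derivArgs (D σ : V →ₗ[k] V) : (r : ℕ) → Mult k V W r →ₗ[k] Mult k V W r
  | 0 => 0
  | r + 1 => cur.symm.toLinearMap ∘ₗ
      (LinearMap.lcomp k _ D + (LinearMap.llcomp k V _ _ (derivArgs D σ r)) ∘ₗ
        LinearMap.lcomp k _ σ) ∘ₗ cur.toLinearMap

@[simp] theorem derivArgs_zero (D σ : V →ₗ[k] V) (c : Mult k V W 0) : derivArgs D σ 0 c = 0 := rfl

-- This recursion and its analogue `cur_contract` replace computations with sums over positions:
-- identities below follow by induction on the number of arguments, with only the first argument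
-- visible.
@[simp] theorem cur_derivArgs (D σ : V →ₗ[k] V) {r : ℕ} (c : Mult k V W (r + 1)) (x : V) :
    cur (derivArgs D σ (r + 1) c) x = cur c (D x) + derivArgs D σ r (cur c (σ x)) := by
  simp [derivArgs]

/-- Multiplication of the first argument by an element `x` on the left. -/
def headMul (μ : V →ₗ[k] V →ₗ[k] V) (x : V) {r : ℕ} (c : Mult k V W (r + 1)) :
    Mult k V W (r + 1) :=
  unc (cur c ∘ₗ μ x)

@[simp] theorem cur_headMul (μ : V →ₗ[k] V →ₗ[k] V) (x y : V) {r : ℕ} (c : Mult k V W (r + 1)) :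
    cur (headMul μ x c) y = cur c (μ x y) := by
  simp [headMul]

/-- The alternating sum of the multilinear maps obtained by multiplying two adjacent arguments. -/
def contract (μ : V →ₗ[k] V →ₗ[k] V) : (r : ℕ) → Mult k V W r →ₗ[k] Mult k V W (r + 1)
  | 0 => 0
  | r + 1 => -(cur.symm.toLinearMap ∘ₗ
      ((LinearMap.llcomp k V _ _ cur.symm.toLinearMap) ∘ₗ (LinearMap.lcomp k _ μ) ∘ₗ
          (LinearMap.llcomp k V V (Mult k V W r)) +
        LinearMap.llcomp k V _ _ (contract μ r)) ∘ₗ cur.toLinearMap)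

@[simp] theorem contract_zero (μ : V →ₗ[k] V →ₗ[k] V) (c : Mult k V W 0) :
    contract μ 0 c = 0 := rfl

@[simp] theorem cur_contract (μ : V →ₗ[k] V →ₗ[k] V) {r : ℕ} (c : Mult k V W (r + 1)) (x : V) :
    cur (contract μ (r + 1) c) x = -headMul μ x c - contract μ r (cur c x) := by
  simp [contract, headMul, unc]
  abel_nf
  rfl

/-- Multiplication of the value by the image of a new last argument. -/
def mulLast (ρ : W →ₗ[k] V →ₗ[k] X) {r : ℕ} : Mult k V W r →ₗ[k] Mult k V X (r + 1) where
  toFun c := (ρ.compMultilinearMap c).uncurryRight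
  map_add' c c' := by ext; simp
  map_smul' a c := by ext; simp

theorem mulLast_apply (ρ : W →ₗ[k] V →ₗ[k] X) {r : ℕ} (c : Mult k V W r) (x : Fin (r + 1) → V) :
    mulLast ρ c x = ρ (c (Fin.init x)) (x (Fin.last r)) := rfl

@[simp] theorem cur_mulLast (ρ : W →ₗ[k] V →ₗ[k] X) {r : ℕ} (c : Mult k V W (r + 1)) (x : V) :
    cur (mulLast ρ c) x = mulLast ρ (cur c x) := by
  ext y
  simp only [cur_apply, mulLast_apply]
  congr 2
  congr 1
  funext i
  refine Fin.cases ?_ (fun i => ?_) i <;> simp [Fin.init]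

theorem cur_mulLast_zero (ρ : W →ₗ[k] V →ₗ[k] X) (c : Mult k V W 0) (x : V) (y : Fin 0 → V) :
    cur (mulLast ρ c) x y = ρ (c y) x := by
  simp only [cur_apply, mulLast_apply]
  congr 2
  congr 1
  exact Subsingleton.elim _ _

/-- Multiplication of the value by the image of a new first argument. -/
def mulFirst (l : V →ₗ[k] W →ₗ[k] X) {r : ℕ} : Mult k V W r →ₗ[k] Mult k V X (r + 1) where
  toFun c := unc
    { toFun := fun x => (l x).compMultilinearMap c
      map_add' := by intros; ext; simp
      map_smul' := by intros; ext; simp }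
  map_add' c c' := by
    refine mult_ext fun x => ?_
    simp only [map_add, cur_unc, LinearMap.add_apply]
    ext; simp
  map_smul' a c := by
    refine mult_ext fun x => ?_
    simp only [map_smul, cur_unc, LinearMap.smul_apply]
    ext; simp

@[simp] theorem cur_mulFirst (l : V →ₗ[k] W →ₗ[k] X) {r : ℕ} (c : Mult k V W r) (x : V) :
    cur (mulFirst l c) x = (l x).compMultilinearMap c := by
  simp [mulFirst]

/-- Links the recursion to the explicit sum in `homDiff`: the summand j = 0 is the first term of the
recursion. `contract_apply` does the same for `hochDiff`. -/
theorem derivArgs_apply (D σ : V →ₗ[k] V) {r : ℕ} (c : Mult k V W r) (x : Fin r → V) :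
    derivArgs D σ r c x =
      ∑ j, c (fun l => if l < j then σ (x l) else if l = j then D (x l) else x l) := by
  induction r with
  | zero => simp
  | succ r ih =>
    rw [apply_eq_cur, cur_derivArgs, _root_.add_apply, ih, Fin.sum_univ_succ]
    congr 1
    · rw [cur_apply]
      congr 1
      funext l
      refine Fin.cases ?_ (fun l => ?_) l <;> simp [Fin.tail]
    · refine Finset.sum_congr rfl fun j _ => ?_
      rw [cur_apply]
      congr 1
      funext l
      refine Fin.cases ?_ (fun l => ?_) l <;> simp [Fin.tail]

theorem contract_apply (μ : V →ₗ[k] V →ₗ[k] V) {r : ℕ} (c : Mult k V W r) (x : Fin (r + 1) → V) :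
    contract μ r c x = ∑ j : Fin r, (-1 : ℤ) ^ ((j : ℕ) + 1) •
      c (Fin.contractNth j.castSucc (fun a b => μ a b) x) := by
  induction r with
  | zero => simp
  | succ r ih =>
    rw [apply_eq_cur, cur_contract, _root_.sub_apply, _root_.neg_apply, ih, Fin.sum_univ_succ,
      sub_eq_add_neg, ← Finset.sum_neg_distrib]
    congr 1
    · rw [apply_eq_cur, cur_headMul, cur_apply]
      simp only [Fin.val_zero, zero_add, pow_one, neg_smul, one_smul]
      congr 2
      funext l
      refine Fin.cases ?_ (fun l => ?_) l <;> simp [Fin.tail, Fin.contractNth]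
    · refine Finset.sum_congr rfl fun j _ => ?_
      rw [cur_apply, ← neg_smul, Fin.val_succ, pow_succ _ ((j : ℕ) + 1), mul_neg_one]
      congr 2
      funext l
      refine Fin.cases ?_ (fun l => ?_) l
      · simp [Fin.contractNth]
      · simp [Fin.tail, Fin.contractNth]

/-! Relations between the operations. -/

theorem comp_derivArgs (D σ : V →ₗ[k] V) (ψ : W →ₗ[k] X) {r : ℕ} (c : Mult k V W r) :
    ψ.compMultilinearMap (derivArgs D σ r c) = derivArgs D σ r (ψ.compMultilinearMap c) := by
  induction r with
  | zero => ext; simp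
  | succ r ih => refine mult_ext fun x => ?_; simp [← ih]

theorem comp_contract (μ : V →ₗ[k] V →ₗ[k] V) (ψ : W →ₗ[k] X) {r : ℕ} (c : Mult k V W r) :
    ψ.compMultilinearMap (contract μ r c) = contract μ r (ψ.compMultilinearMap c) := by
  ext x
  simp [contract_apply]

/-- The mixed terms apply `D` to the first argument and to a later one. They occur twice, through σ
∘ D and D ∘ σ, and cancel because these are opposite. -/
theorem derivArgs_sq (D σ : V →ₗ[k] V) (h : ∀ x, D (D x) = 0) (hσ : ∀ x, σ (D x) = -D (σ x))
    {r : ℕ} (c : Mult k V W r) : derivArgs D σ r (derivArgs D σ r c) = 0 := by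
  induction r with
  | zero => rfl
  | succ r ih =>
    refine mult_ext fun x => ?_
    simp only [cur_derivArgs, map_add, h, ih, hσ, map_neg, map_zero, LinearMap.zero_apply]
    abel

theorem headMul_contract (μ : V →ₗ[k] V →ₗ[k] V) (hμ : ∀ x y z, μ (μ x y) z = μ x (μ y z))
    {r : ℕ} (c : Mult k V W (r + 1)) (x : V) :
    headMul μ x (contract μ (r + 1) c) = contract μ (r + 1) (headMul μ x c) := by
  refine mult_ext fun y => ?_
  simp only [cur_headMul, cur_contract]
  congr 2
  refine mult_ext fun z => ?_
  simp only [cur_headMul, hμ]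

/-- Associativity is used only through `headMul_contract`; once `headMul` commutes with `contract`,
the two mixed terms in the recursion have opposite signs. -/
theorem contract_sq (μ : V →ₗ[k] V →ₗ[k] V) (hμ : ∀ x y z, μ (μ x y) z = μ x (μ y z))
    {r : ℕ} (c : Mult k V W r) : contract μ (r + 1) (contract μ r c) = 0 := by
  induction r with
  | zero => simp
  | succ r ih =>
    refine mult_ext fun x => ?_
    simp only [cur_contract, headMul_contract μ hμ, map_sub, map_neg, ih, map_zero,
      LinearMap.zero_apply]
    abel

theorem headMul_derivArgs (μ : V →ₗ[k] V →ₗ[k] V) (D σ : V →ₗ[k] V)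
    (hσ : ∀ x y, σ (μ x y) = μ (σ x) (σ y)) (hD : ∀ x y, D (μ x y) = μ (D x) y + μ (σ x) (D y))
    {r : ℕ} (c : Mult k V W (r + 1)) (x : V) :
    headMul μ x (derivArgs D σ (r + 1) c) =
      headMul μ (D x) c + derivArgs D σ (r + 1) (headMul μ (σ x) c) := by
  refine mult_ext fun y => ?_
  simp only [cur_headMul, cur_derivArgs, map_add, LinearMap.add_apply, hσ, hD]
  abel

/-- This is the Leibniz rule for the σ-derivation `D` in disguise: `D` of a product of neighbouring
arguments is the sum of its effects on the two factors. -/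
theorem contract_derivArgs (μ : V →ₗ[k] V →ₗ[k] V) (D σ : V →ₗ[k] V)
    (hσ : ∀ x y, σ (μ x y) = μ (σ x) (σ y)) (hD : ∀ x y, D (μ x y) = μ (D x) y + μ (σ x) (D y))
    {r : ℕ} (c : Mult k V W r) :
    contract μ r (derivArgs D σ r c) = derivArgs D σ (r + 1) (contract μ r c) := by
  induction r with
  | zero => simp
  | succ r ih =>
    refine mult_ext fun x => ?_
    simp only [cur_contract, cur_derivArgs, headMul_derivArgs μ D σ hσ hD, map_add, ih, map_sub,
      map_neg]
    abel

theorem mulFirst_mulFirst (μ : V →ₗ[k] V →ₗ[k] V) (l : V →ₗ[k] W →ₗ[k] W)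
    (hl : ∀ x y w, l (μ x y) w = l x (l y w)) {r : ℕ} (c : Mult k V W r) :
    contract μ (r + 1) (mulFirst l c) + mulFirst l (contract μ r c) + mulFirst l (mulFirst l c) =
      0 := by
  refine mult_ext fun x => ?_
  simp only [map_add, LinearMap.add_apply, cur_contract, cur_mulFirst, comp_contract, map_zero,
    LinearMap.zero_apply]
  have h : headMul μ x (mulFirst l c) = (l x).compMultilinearMap (mulFirst l c) := by
    refine mult_ext fun y => ?_
    ext z
    simp [hl]
  rw [h]
  abel

theorem mulFirst_mulLast (l : V →ₗ[k] W →ₗ[k] W) (ρ : W →ₗ[k] V →ₗ[k] W)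
    (h : ∀ x w y, ρ (l x w) y = l x (ρ w y)) {r : ℕ} (c : Mult k V W r) :
    mulFirst l (mulLast ρ c) = mulLast ρ (mulFirst l c) := by
  refine mult_ext fun x => ?_
  ext y
  simp [mulLast_apply, h]

/-- All inner products except the last one already occur in `mulLast ρ (contract μ r c)`. The
remaining one multiplies the last two arguments, so it becomes two successive right actions, with
the sign of position r. -/
theorem contract_mulLast (μ : V →ₗ[k] V →ₗ[k] V) (ρ : W →ₗ[k] V →ₗ[k] W)
    (h : ∀ w x y, ρ (ρ w x) y = ρ w (μ x y)) {r : ℕ} (c : Mult k V W r) :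
    contract μ (r + 1) (mulLast ρ c) - mulLast ρ (contract μ r c) =
      (-1 : ℤ) ^ (r + 1) • mulLast ρ (mulLast ρ c) := by
  induction r with
  | zero =>
    ext x
    have h1 : c (Fin.init (Fin.contractNth 0 (fun a b => μ a b) x)) =
        c (Fin.init (Fin.init x)) := congrArg c (Subsingleton.elim _ _)
    simp [contract_apply, mulLast_apply, h]
    simp [h1, Fin.contractNth, Fin.init]
  | succ r ih =>
    refine mult_ext fun x => ?_
    have h1 : headMul μ x (mulLast ρ c) = mulLast ρ (headMul μ x c) := by
      refine mult_ext fun y => ?_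
      simp
    have h2 := ih (cur c x)
    simp only [map_sub, LinearMap.sub_apply, cur_contract, cur_mulLast, h1, map_neg,
      map_zsmul, LinearMap.smul_apply]
    rw [pow_succ, mul_neg_one, neg_smul, ← h2]
    abel

end Multilinear

/-! ### Bigraded modules and homogeneous multilinear maps -/

section Graded

variable {k : Type u} [CommRing k]

theorem negOnePow_add_zsmul {M : Type u} [AddCommGroup M] (a b : ℤ) (x : M) :
    ((a + b).negOnePow : ℤ) • x = (a.negOnePow : ℤ) • (b.negOnePow : ℤ) • x := by
  rw [Int.negOnePow_add, smul_smul]; rfl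

theorem negOnePow_zsmul_self {M : Type u} [AddCommGroup M] (a : ℤ) (x : M) :
    (a.negOnePow : ℤ) • (a.negOnePow : ℤ) • x = x := by
  rw [← negOnePow_add_zsmul, Int.negOnePow_even _ ⟨a, rfl⟩]; simp

namespace BigradedModule

variable (E : BigradedModule k)

theorem linearMap_ext {E : BigradedModule k} {W : Type u} [AddCommGroup W] [Module k W]
    {f g : E.carrier →ₗ[k] W} (h : ∀ st x, x ∈ E.piece st → f x = g x) : f = g := by
  ext x
  induction x using E.induction with
  | h0 => simp
  | hom st x hx => exact h st x hx
  | add x y hx hy => simp [hx, hy]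

theorem sgn_mem (a b : ℤ) {st : ℤ × ℤ} {x : E.carrier} (hx : x ∈ E.piece st) :
    E.sgn a b x ∈ E.piece st := by
  rw [E.sgn_of_mem a b hx]; exact Submodule.smul_of_tower_mem _ _ hx

theorem sgn_add (a b a' b' : ℤ) (x : E.carrier) :
    E.sgn (a + a') (b + b') x = E.sgn a b (E.sgn a' b' x) := by
  induction x using E.induction with
  | h0 => simp
  | hom st x hx =>
    rw [E.sgn_of_mem a' b' hx, map_zsmul, E.sgn_of_mem a b hx, E.sgn_of_mem _ _ hx, smul_comm,
      ← negOnePow_add_zsmul]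
    congr 3; ring
  | add x y hx hy => simp [hx, hy]

theorem sgn_comm (a b a' b' : ℤ) (x : E.carrier) :
    E.sgn a b (E.sgn a' b' x) = E.sgn a' b' (E.sgn a b x) := by
  rw [← sgn_add, ← sgn_add, add_comm a, add_comm b]

theorem sgn_sgn (a b : ℤ) (x : E.carrier) : E.sgn a b (E.sgn a b x) = x := by
  induction x using E.induction with
  | h0 => simp
  | hom st x hx => rw [E.sgn_of_mem a b hx, map_zsmul, E.sgn_of_mem a b hx, negOnePow_zsmul_self]
  | add x y hx hy => simp [hx, hy]

/-- A linear map of bidegree `[p, q]` commutes with the sign operators up to a sign. -/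
theorem sgn_map {E F : BigradedModule k} (f : E.carrier →ₗ[k] F.carrier) (p q : ℤ)
    (hf : ∀ s t x, x ∈ E.piece (s, t) → f x ∈ F.piece (s - p, t - q)) (a b : ℤ) (x : E.carrier) :
    F.sgn a b (f x) = ((p * a + q * b).negOnePow : ℤ) • f (E.sgn a b x) := by
  induction x using E.induction with
  | h0 => simp
  | hom st x hx =>
    rw [E.sgn_of_mem a b hx, F.sgn_of_mem a b (hf _ _ _ hx), map_zsmul]
    have h : st.1 * a + st.2 * b = (p * a + q * b) + ((st.1 - p) * a + (st.2 - q) * b) := by ring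
    rw [h, negOnePow_add_zsmul (p * a + q * b), negOnePow_zsmul_self]
  | add x y hx hy => simp [hx, hy]

/-- The projection to a bidegree. -/
def proj (st : ℤ × ℤ) : E.carrier →ₗ[k] E.piece st :=
  DirectSum.component k (ℤ × ℤ) (fun i => E.piece i) st ∘ₗ
    (LinearEquiv.ofBijective (DirectSum.coeLinearMap E.piece) E.isInternal).symm.toLinearMap

theorem proj_of_mem {st : ℤ × ℤ} {x : E.carrier} (hx : x ∈ E.piece st) :
    E.proj st x = ⟨x, hx⟩ := by
  have h : (LinearEquiv.ofBijective (DirectSum.coeLinearMap E.piece) E.isInternal).symm x =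
      DirectSum.lof k (ℤ × ℤ) (fun i => E.piece i) st ⟨x, hx⟩ := by
    rw [LinearEquiv.symm_apply_eq]
    exact (DirectSum.coeLinearMap_lof (A := E.piece) (R := k) st ⟨x, hx⟩).symm
  rw [proj, LinearMap.comp_apply, LinearEquiv.coe_coe, h, DirectSum.component.lof_self]

theorem proj_of_mem_ne {st st' : ℤ × ℤ} {x : E.carrier} (hx : x ∈ E.piece st) (h' : st ≠ st') :
    E.proj st' x = 0 := by
  have h : (LinearEquiv.ofBijective (DirectSum.coeLinearMap E.piece) E.isInternal).symm x =
      DirectSum.lof k (ℤ × ℤ) (fun i => E.piece i) st ⟨x, hx⟩ := by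
    rw [LinearEquiv.symm_apply_eq]
    exact (DirectSum.coeLinearMap_lof (A := E.piece) (R := k) st ⟨x, hx⟩).symm
  rw [proj, LinearMap.comp_apply, LinearEquiv.coe_coe, h, DirectSum.component.of, dif_neg h']

/-- Homogeneous linear maps commute with the projections. -/
theorem map_proj {E F : BigradedModule k} (f : E.carrier →ₗ[k] F.carrier) (ab : ℤ × ℤ)
    (hf : ∀ st x, x ∈ E.piece st → f x ∈ F.piece (st - ab)) (st : ℤ × ℤ) (x : E.carrier) :
    f (E.proj st x) = F.proj (st - ab) (f x) := by
  induction x using E.induction with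
  | h0 => simp
  | hom st' x hx =>
    by_cases h : st' = st
    · subst h
      rw [E.proj_of_mem hx, F.proj_of_mem (hf _ _ hx)]
    · rw [E.proj_of_mem_ne hx h, F.proj_of_mem_ne (hf _ _ hx) (fun h' => h (sub_left_injective h'))]
      simp
  | add x y hx hy => simp [hx, hy]

/-- A linear map may be prescribed on the homogeneous elements. -/
theorem exists_glue {W : Type u} [AddCommGroup W] [Module k W]
    (b : (st : ℤ × ℤ) → E.piece st →ₗ[k] W) :
    ∃ f : E.carrier →ₗ[k] W, ∀ st (x : E.piece st), f x = b st x := by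
  refine ⟨(DirectSum.toModule k (ℤ × ℤ) W b) ∘ₗ
    (LinearEquiv.ofBijective (DirectSum.coeLinearMap E.piece) E.isInternal).symm.toLinearMap,
    fun st x => ?_⟩
  have h : (LinearEquiv.ofBijective (DirectSum.coeLinearMap E.piece) E.isInternal).symm x =
      DirectSum.lof k (ℤ × ℤ) (fun i => E.piece i) st x := by
    rw [LinearEquiv.symm_apply_eq]
    exact (DirectSum.coeLinearMap_lof (A := E.piece) (R := k) st x).symm
  rw [LinearMap.comp_apply, LinearEquiv.coe_coe, h, DirectSum.toModule_lof]

end BigradedModule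

/-- Multilinear maps of bidegree `[s, t]` from a bigraded module to a module with a family of
submodules. -/
def homInto (E : BigradedModule k) {X : Type u} [AddCommGroup X] [Module k X]
    (W : ℤ × ℤ → Submodule k X) (r : ℕ) (s t : ℤ) : Submodule k (Mult k E.carrier X r) where
  carrier := {c | ∀ (deg : Fin r → ℤ × ℤ) (x : Fin r → E.carrier),
    (∀ l, x l ∈ E.piece (deg l)) → c x ∈ W (∑ l, deg l - (s, t))}
  add_mem' h h' deg x hx := Submodule.add_mem _ (h deg x hx) (h' deg x hx)
  zero_mem' _ _ _ := Submodule.zero_mem _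
  smul_mem' a _ h deg x hx := Submodule.smul_mem _ a (h deg x hx)

section HomInto

variable {E F : BigradedModule k} {X Y : Type u} [AddCommGroup X] [Module k X]
  [AddCommGroup Y] [Module k Y] {W : ℤ × ℤ → Submodule k X} {W' : ℤ × ℤ → Submodule k Y}

theorem mem_homInto_zero {s t : ℤ} {c : Mult k E.carrier X 0} :
    c ∈ homInto E W 0 s t ↔ c ![] ∈ W (-s, -t) := by
  constructor
  · intro h
    simpa using h ![] ![] (fun l => l.elim0)
  · intro h deg x _
    rw [Subsingleton.elim x ![]]
    simpa using h

/-- Homogeneity in currying form: freezing a first argument of bidegree (a, b) lowers the bidegree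
of the map by (a, b). This reduces all statements about degrees to one variable. -/
theorem mem_homInto_succ {r : ℕ} {s t : ℤ} {c : Mult k E.carrier X (r + 1)} :
    c ∈ homInto E W (r + 1) s t ↔
      ∀ a b x, x ∈ E.piece (a, b) → cur c x ∈ homInto E W r (s - a) (t - b) := by
  constructor
  · intro h a b x hx deg y hy
    have h1 := h (Fin.cons (a, b) deg) (Fin.cons x y) (fun l => by
      refine Fin.cases ?_ (fun l => ?_) l <;> simp [hx, hy])
    rw [cur_apply]
    convert h1 using 2
    rw [Fin.sum_univ_succ]
    simp only [Fin.cons_zero, Fin.cons_succ]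
    ext <;> simp <;> ring
  · intro h deg x hx
    rw [apply_eq_cur]
    have h1 := h (deg 0).1 (deg 0).2 (x 0) (hx 0) (fun l => deg l.succ) (Fin.tail x)
      (fun l => hx l.succ)
    convert h1 using 2
    rw [Fin.sum_univ_succ]
    ext <;> simp <;> ring

theorem comp_mem_homInto {ψ : X →ₗ[k] Y} {p q : ℤ}
    (hψ : ∀ s t x, x ∈ W (s, t) → ψ x ∈ W' (s - p, t - q)) {r : ℕ} {s t : ℤ}
    {c : Mult k E.carrier X r} (hc : c ∈ homInto E W r s t) :
    ψ.compMultilinearMap c ∈ homInto E W' r (s + p) (t + q) := fun deg x hx => by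
  have h := hψ _ _ _ (hc deg x hx)
  change ψ (c x) ∈ _
  convert h using 2
  ext <;> simp <;> ring

theorem compLinearMap_mem_homInto {α : E.carrier →ₗ[k] F.carrier}
    (hα : ∀ st x, x ∈ E.piece st → α x ∈ F.piece st) {r : ℕ} {s t : ℤ}
    {c : Mult k F.carrier X r} (hc : c ∈ homInto F W r s t) :
    (c.compLinearMap fun _ => α) ∈ homInto E W r s t :=
  fun deg _ hx => hc deg _ fun l => hα _ _ (hx l)

theorem derivArgs_mem_homInto {D σ : E.carrier →ₗ[k] E.carrier} {p q : ℤ}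
    (hD : ∀ s t x, x ∈ E.piece (s, t) → D x ∈ E.piece (s - p, t - q))
    (hσ : ∀ st x, x ∈ E.piece st → σ x ∈ E.piece st) {r : ℕ} {s t : ℤ}
    {c : Mult k E.carrier X r} (hc : c ∈ homInto E W r s t) :
    derivArgs D σ r c ∈ homInto E W r (s + p) (t + q) := by
  induction r generalizing s t with
  | zero => exact Submodule.zero_mem _
  | succ r ih =>
    rw [mem_homInto_succ] at hc ⊢
    intro a b x hx
    rw [cur_derivArgs]
    refine Submodule.add_mem _ ?_ ?_
    · have h := hc _ _ _ (hD _ _ _ hx)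
      rwa [show s - (a - p) = s + p - a by ring, show t - (b - q) = t + q - b by ring] at h
    · have h := ih (hc _ _ _ (hσ _ _ hx))
      rwa [show s - a + p = s + p - a by ring, show t - b + q = t + q - b by ring] at h

theorem headMul_mem_homInto {μ : E.carrier →ₗ[k] E.carrier →ₗ[k] E.carrier}
    (hμ : ∀ st st' x y, x ∈ E.piece st → y ∈ E.piece st' → μ x y ∈ E.piece (st + st'))
    {r : ℕ} {s t a b : ℤ} {x : E.carrier} (hx : x ∈ E.piece (a, b))
    {c : Mult k E.carrier X (r + 1)} (hc : c ∈ homInto E W (r + 1) s t) :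
    headMul μ x c ∈ homInto E W (r + 1) (s - a) (t - b) := by
  rw [mem_homInto_succ] at hc ⊢
  intro a' b' y hy
  have h := hc _ _ _ (hμ _ _ _ _ hx hy)
  rw [cur_headMul]
  rwa [sub_sub, sub_sub]

theorem contract_mem_homInto {μ : E.carrier →ₗ[k] E.carrier →ₗ[k] E.carrier}
    (hμ : ∀ st st' x y, x ∈ E.piece st → y ∈ E.piece st' → μ x y ∈ E.piece (st + st'))
    {r : ℕ} {s t : ℤ} {c : Mult k E.carrier X r} (hc : c ∈ homInto E W r s t) :
    contract μ r c ∈ homInto E W (r + 1) s t := by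
  induction r generalizing s t with
  | zero => exact Submodule.zero_mem _
  | succ r ih =>
    rw [mem_homInto_succ]
    intro a b x hx
    rw [cur_contract]
    exact Submodule.sub_mem _ (Submodule.neg_mem _ (headMul_mem_homInto hμ hx hc))
      (ih (mem_homInto_succ.1 hc a b x hx))

theorem mulFirst_mem_homInto {l : E.carrier →ₗ[k] X →ₗ[k] Y}
    (hl : ∀ st st' x y, x ∈ E.piece st → y ∈ W st' → l x y ∈ W' (st + st'))
    {r : ℕ} {s t : ℤ} {c : Mult k E.carrier X r} (hc : c ∈ homInto E W r s t) :
    mulFirst l c ∈ homInto E W' (r + 1) s t := by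
  rw [mem_homInto_succ]
  intro a b x hx
  rw [cur_mulFirst]
  refine comp_mem_homInto (p := -a) (q := -b) (fun s t y hy => ?_) hc
  have h := hl _ _ _ _ hx hy
  convert h using 2
  ext <;> simp <;> ring

theorem mulLast_mem_homInto {ρ : X →ₗ[k] E.carrier →ₗ[k] Y}
    (hρ : ∀ st st' y x, y ∈ W st → x ∈ E.piece st' → ρ y x ∈ W' (st + st'))
    {r : ℕ} {s t : ℤ} {c : Mult k E.carrier X r} (hc : c ∈ homInto E W r s t) :
    mulLast ρ c ∈ homInto E W' (r + 1) s t := by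
  intro deg x hx
  rw [mulLast_apply]
  have h := hρ _ _ _ _ (hc (Fin.init deg) (Fin.init x) (fun l => hx _)) (hx (Fin.last r))
  convert h using 2
  rw [Fin.sum_univ_castSucc]
  simp only [Fin.init]
  abel

/-- The values of a homogeneous multilinear map and the sign operators. -/
theorem sgn_apply_of_mem_homInto {r : ℕ} {s t : ℤ} {c : Mult k E.carrier F.carrier r}
    (hc : c ∈ homInto E F.piece r s t) (a b : ℤ) :
    (F.sgn a b).compMultilinearMap c =
      ((s * a + t * b).negOnePow : ℤ) • (c.compLinearMap fun _ => E.sgn a b) := by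
  induction r generalizing s t with
  | zero =>
    ext x
    rw [Subsingleton.elim x ![]]
    rw [mem_homInto_zero] at hc
    simp only [LinearMap.compMultilinearMap_apply, _root_.smul_apply,
      MultilinearMap.compLinearMap_apply, F.sgn_of_mem a b hc]
    rw [show -s * a + -t * b = -(s * a + t * b) by ring, Int.negOnePow_neg]
    congr 2
    exact Subsingleton.elim _ _
  | succ r ih =>
    rw [mem_homInto_succ] at hc
    refine cur.injective (BigradedModule.linearMap_ext fun st x hx => ?_)
    rw [cur_comp, ih (hc _ _ x hx), map_zsmul, LinearMap.smul_apply, cur_compLinearMap,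
      E.sgn_of_mem a b hx, map_zsmul]
    ext y
    simp only [_root_.smul_apply, MultilinearMap.compLinearMap_apply]
    rw [← negOnePow_add_zsmul]
    have h : s * a + t * b + (st.1 * a + st.2 * b) =
      (s - st.1) * a + (t - st.2) * b + ((st.1 * a + st.2 * b) + (st.1 * a + st.2 * b)) := by ring
    rw [h, Int.negOnePow_add _ (st.1 * a + st.2 * b + _),
      Int.negOnePow_even (st.1 * a + st.2 * b + _) ⟨_, rfl⟩, mul_one]

end HomInto

end Graded

/-! ### The total differential squares to zero -/

section Differential

variable {k : Type u} [CommRing k] {E F G : BidgaData k}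

theorem BidgaData.IsBidga.d_mem' (hE : E.IsBidga) (s t : ℤ) (x : E.carrier)
    (hx : x ∈ E.piece (s, t)) : E.d x ∈ E.piece (s - 1, t - 0) := by
  rw [sub_zero]; exact hE.d_mem s t x hx

theorem BidgaData.IsBidga.sgn_d (hE : E.IsBidga) (a b : ℤ) (x : E.carrier) :
    E.sgn a b (E.d x) = (a.negOnePow : ℤ) • E.d (E.sgn a b x) := by
  have h := BigradedModule.sgn_map (E := E.toBigradedModule) (F := E.toBigradedModule) E.d 1 0
    hE.d_mem' a b x
  simpa using h

theorem BidgaData.IsBidga.sgn_one_zero_d (hE : E.IsBidga) (x : E.carrier) :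
    E.sgn 1 0 (E.d x) = -E.d (E.sgn 1 0 x) := by
  rw [hE.sgn_d]; simp

theorem BidgaData.IsBidga.sgn_mul (hE : E.IsBidga) (a b : ℤ) (x y : E.carrier) :
    E.sgn a b (E.mul x y) = E.mul (E.sgn a b x) (E.sgn a b y) := by
  induction x using E.induction with
  | h0 => simp
  | hom st x hx =>
    induction y using E.induction with
    | h0 => simp
    | hom st' y hy =>
      rw [E.sgn_of_mem a b hx, E.sgn_of_mem a b hy, E.sgn_of_mem a b (hE.mul_mem _ _ _ _ hx hy),
        map_zsmul, map_zsmul, LinearMap.smul_apply, ← negOnePow_add_zsmul]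
      congr 3
      simp only [Prod.fst_add, Prod.snd_add]
      ring
    | add y y' hy hy' => simp [hy, hy']
  | add x x' hx hx' => simp [hx, hx']

/-- With the sign operator in place of the sign, both sides are linear in `x`, so the Leibniz rule
needs no homogeneity. -/
theorem BidgaData.IsBidga.d_mul (hE : E.IsBidga) (x y : E.carrier) :
    E.d (E.mul x y) = E.mul (E.d x) y + E.mul (E.sgn 1 0 x) (E.d y) := by
  induction x using E.induction with
  | h0 => simp
  | hom st x hx => 
    rw [hE.leibniz _ _ x y hx, E.sgn_of_mem 1 0 hx, _root_.mul_one, mul_zero, add_zero, map_zsmul,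
      LinearMap.smul_apply]
  | add x x' hx hx' => simp only [map_add, LinearMap.add_apply, hx, hx']; abel

/-- The action of a bidga on the right of another one, through a map. -/
def rightAct (φ : E.carrier →ₗ[k] F.carrier) : F.carrier →ₗ[k] E.carrier →ₗ[k] F.carrier :=
  F.mul.compl₂ φ

/-- The action of a bidga on the left of another one, through a map, with a Koszul sign. -/
def leftAct (φ : E.carrier →ₗ[k] F.carrier) (s t : ℤ) :
    E.carrier →ₗ[k] F.carrier →ₗ[k] F.carrier :=
  F.mul ∘ₗ φ ∘ₗ E.sgn s t

@[simp] theorem rightAct_apply (φ : E.carrier →ₗ[k] F.carrier) (y : F.carrier) (x : E.carrier) :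
    rightAct φ y x = F.mul y (φ x) := rfl

@[simp] theorem leftAct_apply (φ : E.carrier →ₗ[k] F.carrier) (s t : ℤ) (y : F.carrier)
    (x : E.carrier) : leftAct φ s t x y = F.mul (φ (E.sgn s t x)) y := rfl

/-- The Hochschild differential as a linear map. -/
def hochD (φ : E.carrier →ₗ[k] F.carrier) (s t : ℤ) (r : ℕ) :
    Mult k E.carrier F.carrier r →ₗ[k] Mult k E.carrier F.carrier (r + 1) :=
  mulFirst (leftAct φ s t) + (-1 : ℤ) ^ (r + 1) • mulLast (rightAct φ) + contract E.mul r

/-- The differential induced by the horizontal differentials, as a linear map. -/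
def homD (s : ℤ) (r : ℕ) :
    Mult k E.carrier F.carrier r →ₗ[k] Mult k E.carrier F.carrier r :=
  LinearMap.compMultilinearMapₗ k F.d - (s.negOnePow : ℤ) • derivArgs E.d (E.sgn 1 0) r

theorem homD_apply (s : ℤ) (r : ℕ) (c : Mult k E.carrier F.carrier r) :
    homD s r c = F.d.compMultilinearMap c - (s.negOnePow : ℤ) • derivArgs E.d (E.sgn 1 0) r c :=
  rfl

theorem hochD_apply (φ : E.carrier →ₗ[k] F.carrier) (s t : ℤ) (r : ℕ)
    (c : Mult k E.carrier F.carrier r) :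
    hochD φ s t r c = mulFirst (leftAct φ s t) c + (-1 : ℤ) ^ (r + 1) • mulLast (rightAct φ) c +
      contract E.mul r c := rfl

theorem homDiff_eq (s : ℤ) {r : ℕ} (c : Mult k E.carrier F.carrier r) (x : Fin r → E.carrier) :
    homDiff s c x = homD s r c x := by
  simp [homDiff, homD_apply, derivArgs_apply]

theorem hochDiff_eq (φ : E.carrier →ₗ[k] F.carrier) (s t : ℤ) {r : ℕ}
    (c : Mult k E.carrier F.carrier r) (x : Fin (r + 1) → E.carrier) :
    hochDiff φ s t c x = hochD φ s t r c x := by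
  simp [hochDiff, hochD_apply, contract_apply, mulLast_apply, apply_eq_cur (mulFirst _ c)]

/-- The total differential as a linear map. -/
def totD (φ : E.carrier →ₗ[k] F.carrier) (q t : ℤ) : Cochain E F →ₗ[k] Cochain E F where
  toFun c
    | 0 => homD q 0 (c 0)
    | r + 1 => homD (q - (r + 1)) (r + 1) (c (r + 1)) - (q.negOnePow : ℤ) • hochD φ (q - r) t r (c r)
  map_add' c c' := by
    funext r
    cases r with
    | zero => simp
    | succ r => simp; abel
  map_smul' a c := by
    funext r
    cases r with
    | zero => simp
    | succ r => simp [smul_sub, smul_comm a]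

@[simp] theorem totD_zero (φ : E.carrier →ₗ[k] F.carrier) (q t : ℤ) (c : Cochain E F) :
    totD φ q t c 0 = homD q 0 (c 0) := rfl

@[simp] theorem totD_succ (φ : E.carrier →ₗ[k] F.carrier) (q t : ℤ) (c : Cochain E F) (r : ℕ) :
    totD φ q t c (r + 1) = homD (q - (r + 1)) (r + 1) (c (r + 1)) -
      (q.negOnePow : ℤ) • hochD φ (q - r) t r (c r) := rfl

theorem totDiff_eq (φ : E.carrier →ₗ[k] F.carrier) (q t : ℤ) (c : Cochain E F) (r : ℕ)
    (x : Fin r → E.carrier) : totDiff φ q t c r x = totD φ q t c r x := by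
  cases r with
  | zero => simp [totDiff, homDiff_eq]
  | succ r => simp [totDiff, homDiff_eq, hochDiff_eq]

theorem mem_cocycles_iff {φ : E.carrier →ₗ[k] F.carrier} {q t : ℤ} {c : Cochain E F} :
    c ∈ cocycles φ q t ↔ c ∈ cochains E F q t ∧ totD φ q t c = 0 := by
  refine and_congr_right fun _ => ?_
  simp only [totDiff_eq, funext_iff, MultilinearMap.ext_iff]
  rfl

theorem mem_coboundaries_iff {φ : E.carrier →ₗ[k] F.carrier} {q t : ℤ} {c : Cochain E F} :
    c ∈ coboundaries φ q t ↔ ∃ b ∈ cochains E F (q - 1) t, totD φ (q - 1) t b = c := by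
  refine exists_congr fun b => and_congr_right fun _ => ?_
  simp only [totDiff_eq, funext_iff, MultilinearMap.ext_iff]

variable (hE : E.IsBidga) (hF : F.IsBidga) {φ : E.carrier →ₗ[k] F.carrier} (hφ : IsBidgaMap E F φ)

-- The family `W` is left free because two cases are needed: all of `F.piece`, and the graded kernel
-- of a trivial fibration. The same holds for `hochD_mem_homInto`.
include hE in
theorem homD_mem_homInto {W : ℤ × ℤ → Submodule k F.carrier}
    (hW : ∀ s t x, x ∈ W (s, t) → F.d x ∈ W (s - 1, t)) {s t : ℤ} {r : ℕ}
    {c : Mult k E.carrier F.carrier r} (hc : c ∈ homInto E.toBigradedModule W r s t) :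
    homD s r c ∈ homInto E.toBigradedModule W r (s + 1) t := by
  rw [homD_apply]
  refine Submodule.sub_mem _ ?_ (Submodule.smul_of_tower_mem _ _ ?_)
  · have h := comp_mem_homInto (p := 1) (q := 0) (W' := W) (ψ := F.d)
      (fun s t x hx => by rw [sub_zero]; exact hW s t x hx) hc
    rwa [add_zero] at h
  · have h := derivArgs_mem_homInto (p := 1) (q := 0) hE.d_mem'
      (fun st x hx => E.sgn_mem 1 0 hx) hc
    rwa [add_zero] at h

include hE hφ in
theorem hochD_mem_homInto {W : ℤ × ℤ → Submodule k F.carrier}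
    (hl : ∀ st st' x y, x ∈ F.piece st → y ∈ W st' → F.mul x y ∈ W (st + st'))
    (hr : ∀ st st' x y, x ∈ W st → y ∈ F.piece st' → F.mul x y ∈ W (st + st')) {s t : ℤ} {r : ℕ}
    {c : Mult k E.carrier F.carrier r} (hc : c ∈ homInto E.toBigradedModule W r s t) :
    hochD φ s t r c ∈ homInto E.toBigradedModule W (r + 1) s t := by
  rw [hochD_apply]
  refine Submodule.add_mem _ (Submodule.add_mem _ ?_ (Submodule.smul_of_tower_mem _ _ ?_)) ?_
  · exact mulFirst_mem_homInto (E := E.toBigradedModule)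
      (fun st st' x y hx hy => hl _ _ _ _ (hφ.map_mem _ _ (E.sgn_mem s t hx)) hy) hc
  · exact mulLast_mem_homInto (E := E.toBigradedModule) (fun st st' y x hy hx => hr _ _ _ _ hy (hφ.map_mem _ _ hx)) hc
  · exact contract_mem_homInto hE.mul_mem hc

include hE in
theorem homD_homD (hF : ∀ x, F.d (F.d x) = 0) (s : ℤ) (r : ℕ) (c : Mult k E.carrier F.carrier r) :
    homD (s + 1) r (homD s r c) = 0 := by
  have h0 : F.d.compMultilinearMap (F.d.compMultilinearMap c) = 0 := by ext; simp [hF]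
  simp only [homD_apply, h0, map_sub, map_zsmul, ← comp_derivArgs,
    derivArgs_sq E.d (E.sgn 1 0) hE.d_d hE.sgn_one_zero_d, Int.negOnePow_succ]
  simp

include hE hF hφ in
theorem hochD_hochD (s t : ℤ) (r : ℕ) (c : Mult k E.carrier F.carrier r) :
    hochD φ s t (r + 1) (hochD φ s t r c) = 0 := by
  have h1 := mulFirst_mulFirst E.mul (leftAct φ s t)
    (by intro x y w; simp [hE.sgn_mul, hφ.map_mul, hF.mul_assoc]) c
  have h2 := mulFirst_mulLast (leftAct φ s t) (rightAct φ)
    (by intro x w y; simp [hF.mul_assoc]) c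
  have h3 := contract_mulLast E.mul (rightAct φ)
    (by intro x w y; simp [hF.mul_assoc, hφ.map_mul]) c
  have h4 := contract_sq E.mul hE.mul_assoc c
  rw [sub_eq_iff_eq_add] at h3
  replace h1 := eq_neg_of_add_eq_zero_left ((add_assoc _ _ _).symm.trans h1)
  simp only [hochD_apply, map_add, map_zsmul, smul_add, h1, h2, h3, h4]
  rw [pow_succ _ (r + 1)]
  rcases neg_one_pow_eq_or ℤ (r + 1) with h | h
  · simp only [h, one_mul, one_smul, neg_smul]
    abel
  · simp only [h, neg_mul_neg, one_mul, one_smul, neg_smul]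
    abel

-- The left action, the right action and the inner products commute with the horizontal differential
-- separately. Only the right action needs `c` to be homogeneous, since there the differential moves
-- past the value of `c`.
include hE hF hφ in
theorem homD_hochD {s t : ℤ} {r : ℕ} {c : Mult k E.carrier F.carrier r}
    (hc : c ∈ homInto E.toBigradedModule F.piece r s t) :
    homD s (r + 1) (hochD φ s t r c) = hochD φ (s + 1) t r (homD s r c) := by
  have hcomm : ∀ c' : Mult k E.carrier F.carrier (r + 1), F.d.compMultilinearMap
      ((-1 : ℤ) ^ (r + 1) • c') = (-1 : ℤ) ^ (r + 1) • F.d.compMultilinearMap c' := by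
    intro c'; ext; simp
  have hadd : ∀ c' c'' : Mult k E.carrier F.carrier (r + 1), F.d.compMultilinearMap (c' + c'') =
      F.d.compMultilinearMap c' + F.d.compMultilinearMap c'' := by
    intro c' c''; ext; simp
  have hB : F.d.compMultilinearMap (contract E.mul r c) -
      (s.negOnePow : ℤ) • derivArgs E.d (E.sgn 1 0) (r + 1) (contract E.mul r c) =
      contract E.mul r (homD s r c) := by
    rw [homD_apply, map_sub, map_zsmul, comp_contract,
      contract_derivArgs E.mul E.d (E.sgn 1 0) (hE.sgn_mul 1 0) hE.d_mul]
  -- Raising s by one changes the sign in the left action by the operator `sgn 1 0`, which is the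
  -- sign in the Leibniz rule.
  have hL : F.d.compMultilinearMap (mulFirst (leftAct φ s t) c) -
      (s.negOnePow : ℤ) • derivArgs E.d (E.sgn 1 0) (r + 1) (mulFirst (leftAct φ s t) c) =
      mulFirst (leftAct φ (s + 1) t) (homD s r c) := by
    refine mult_ext fun x => ?_
    rw [map_sub, map_zsmul, LinearMap.sub_apply, LinearMap.smul_apply, cur_derivArgs, cur_comp,
      cur_mulFirst, cur_mulFirst, cur_mulFirst, cur_mulFirst, ← comp_derivArgs]
    ext y
    have h1 : E.sgn (s + 1) t x = E.sgn 1 0 (E.sgn s t x) := by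
      rw [← E.sgn_add, add_comm 1 s, zero_add]
    simp only [homD_apply, _root_.sub_apply, _root_.smul_apply, _root_.add_apply,
      LinearMap.compMultilinearMap_apply, leftAct_apply, hF.d_mul, map_sub, map_zsmul, h1,
      hE.sgn_d, ← hφ.map_sgn, ← hφ.map_d, LinearMap.smul_apply, smul_add, negOnePow_zsmul_self,
      E.sgn_comm s t]
    abel
  have hR : F.d.compMultilinearMap (mulLast (rightAct φ) c) -
      (s.negOnePow : ℤ) • derivArgs E.d (E.sgn 1 0) (r + 1) (mulLast (rightAct φ) c) =
      mulLast (rightAct φ) (homD s r c) := by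
    -- The new last argument is differentiated after `sgn 1 0` has been applied to all earlier ones;
    -- `h3` below moves these operators to the value of `c`.
    have h2 : derivArgs E.d (E.sgn 1 0) (r + 1) (mulLast (rightAct φ) c) =
        mulLast (rightAct φ) (derivArgs E.d (E.sgn 1 0) r c) +
        mulLast (rightAct (φ ∘ₗ E.d)) (c.compLinearMap fun _ => E.sgn 1 0) := by
      clear hcomm hadd hB hL hc
      induction r with
      | zero =>
        refine mult_ext fun x => ?_
        ext y
        simp [cur_mulLast_zero, MultilinearMap.compLinearMap_apply]
        exact congrArg (fun w => F.mul (c w) (φ (E.d x))) (Subsingleton.elim _ _)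
      | succ r ih =>
        refine mult_ext fun x => ?_
        simp only [cur_derivArgs, cur_mulLast, map_add, LinearMap.add_apply, ih,
          cur_compLinearMap]
        abel
    have h3 := sgn_apply_of_mem_homInto hc 1 0
    rw [h2, homD_apply, map_sub, map_zsmul, smul_add]
    ext y
    have h4 := congrArg (fun c' => c' (Fin.init y)) h3
    simp only [LinearMap.compMultilinearMap_apply, _root_.smul_apply, mul_one, mul_zero,
      add_zero] at h4
    simp only [_root_.sub_apply, _root_.smul_apply, _root_.add_apply, mulLast_apply,
      LinearMap.compMultilinearMap_apply, rightAct_apply, hF.d_mul, h4, hφ.map_d,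
      LinearMap.comp_apply, map_zsmul, LinearMap.smul_apply]
    abel
  rw [hochD_apply, hochD_apply, ← hL, ← hR, ← hB, homD_apply]
  simp only [map_add, map_zsmul, hadd, hcomm, smul_add, smul_sub]
  rw [smul_comm ((-1 : ℤ) ^ (r + 1))]
  abel

-- The two differentials square to zero and commute; the factor `-(-1)^q` changes sign from degree q
-- to q + 1, so that the mixed terms cancel.
include hE hF hφ in
theorem totD_totD {q t : ℤ} {c : Cochain E F} (hc : c ∈ cochains E F q t) :
    totD φ (q + 1) t (totD φ q t c) = 0 := by
  have key : ∀ r : ℕ, homD (q - r) (r + 1) (hochD φ (q - r) t r (c r)) =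
      hochD φ (q - r + 1) t r (homD (q - r) r (c r)) := fun r =>
    homD_hochD hE hF hφ (hc r)
  funext r
  rcases r with _ | _ | r
  · exact homD_homD hE hF.d_d q 0 _
  · have h := key 0
    have h2 := homD_homD hE hF.d_d (q - 1) 1 (c 1)
    simp only [totD_succ, totD_zero, map_sub, map_zsmul]
    simp at h h2 ⊢
    rw [h2, h, Int.negOnePow_succ]
    simp
  · have h := key (r + 1)
    have h2 := homD_homD hE hF.d_d (q - (r + 2)) (r + 2) (c (r + 2))
    have h3 := hochD_hochD hE hF hφ (q - r) t r (c r)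
    simp only [totD_succ, map_sub, map_zsmul, Nat.cast_add, Nat.cast_one] at h ⊢
    rw [show q + 1 - ((r : ℤ) + 1 + 1) = q - (r + 1) by ring,
      show q + 1 - ((r : ℤ) + 1) = q - r by ring] at *
    rw [show q - (r + 2 : ℤ) + 1 = q - (r + 1) by ring] at h2
    rw [show q - (r + 1 : ℤ) + 1 = q - r by ring] at h
    rw [show q - ((r : ℤ) + 1 + 1) = q - (r + 2) by ring, h2, h, h3, Int.negOnePow_succ]
    simp

include hE hF hφ in
theorem totD_mem_cochains {q t : ℤ} {c : Cochain E F} (hc : c ∈ cochains E F q t) :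
    totD φ q t c ∈ cochains E F (q + 1) t := by
  intro r
  cases r with
  | zero =>
    have h := homD_mem_homInto hE (W := F.piece) hF.d_mem (hc 0)
    simp at h ⊢
    exact h
  | succ r =>
    have h := homD_mem_homInto hE (W := F.piece) hF.d_mem (hc (r + 1))
    have h' := hochD_mem_homInto hE hφ hF.mul_mem hF.mul_mem (hc r)
    rw [totD_succ]
    push_cast at h ⊢
    rw [show q - (r + 1 : ℤ) + 1 = q + 1 - (r + 1) by ring] at h
    rw [show q - (r : ℤ) = q + 1 - (r + 1) by ring] at h'
    rw [show q - (r : ℤ) = q + 1 - (r + 1) by ring]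
    exact Submodule.sub_mem _ h (Submodule.smul_of_tower_mem _ _ h')

end Differential

/-! ### Lifting along projective bigraded modules -/

section Lifting

variable {k : Type u} [CommRing k] {X Y : Type u} [AddCommGroup X] [Module k X]
  [AddCommGroup Y] [Module k Y]

/-- Elementwise lifts of a linear map on a bigraded module with projective pieces may be chosen
linearly. -/
theorem BigradedModule.exists_lift (E : BigradedModule k)
    (hE : ∀ st, Module.Projective k (E.piece st)) (p : ℤ × ℤ → Prop)
    (A : ℤ × ℤ → Submodule k X) (δ : ℤ × ℤ → X →ₗ[k] Y) (g : E.carrier →ₗ[k] Y)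
    (h : ∀ st x, p st → x ∈ E.piece st → ∃ y ∈ A st, δ st y = g x) :
    ∃ b : E.carrier →ₗ[k] X, ∀ st x, p st → x ∈ E.piece st → b x ∈ A st ∧ δ st (b x) = g x := by
  have key : ∀ st, ∃ b : E.piece st →ₗ[k] X, p st → ∀ x, b x ∈ A st ∧ δ st (b x) = g x := by
    intro st
    by_cases hp : p st
    · have := hE st
      let δ' : A st →ₗ[k] Y := δ st ∘ₗ (A st).subtype
      have hg : ∀ x : E.piece st, g x ∈ LinearMap.range δ' := fun x => by
        obtain ⟨y, hy, hy'⟩ := h st x hp x.2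
        exact ⟨⟨y, hy⟩, hy'⟩
      obtain ⟨b, hb⟩ := Module.projective_lifting_property δ'.rangeRestrict
        ((g ∘ₗ (E.piece st).subtype).codRestrict _ hg) δ'.surjective_rangeRestrict
      refine ⟨(A st).subtype ∘ₗ b, fun _ x => ⟨(b x).2, ?_⟩⟩
      exact congrArg Subtype.val (LinearMap.congr_fun hb x)
    · exact ⟨0, fun h => absurd h hp⟩
  choose b hb using key
  obtain ⟨f, hf⟩ := E.exists_glue b
  refine ⟨f, fun st x hp hx => ?_⟩
  rw [hf st ⟨x, hx⟩]
  exact hb st hp ⟨x, hx⟩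

/-- Linear maps of degree `s` from a non-negatively graded complex of projective modules to an
exact complex which are cocycles are coboundaries. -/
theorem BigradedModule.exists_primitive (E : BigradedModule k)
    (hE : ∀ st, Module.Projective k (E.piece st)) (D : E.carrier →ₗ[k] E.carrier)
    (hD : ∀ s t x, x ∈ E.piece (s, t) → D x ∈ E.piece (s - 1, t)) (hDD : ∀ x, D (D x) = 0)
    (A : ℤ → ℤ → Submodule k X) (δ : ℤ → X →ₗ[k] X)
    (hA : ∀ s t x, x ∈ A s t → δ s x = 0 → ∃ y ∈ A (s - 1) t, δ (s - 1) y = x) (s t : ℤ)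
    (c : E.carrier →ₗ[k] X) (hc : ∀ a b x, x ∈ E.piece (a, b) → c x ∈ A (s - a) (t - b))
    (hδ : ∀ a b x, x ∈ E.piece (a, b) → δ (s - a) (c x) = (s.negOnePow : ℤ) • c (D x)) :
    ∃ f : E.carrier →ₗ[k] X, (∀ a b x, x ∈ E.piece (a, b) → f x ∈ A (s - 1 - a) (t - b)) ∧
      ∀ a b x, x ∈ E.piece (a, b) →
        δ (s - 1 - a) (f x) + (s.negOnePow : ℤ) • f (D x) = c x := by
  -- Induction on the horizontal degree n. The equation is recorded on cycles only: the next step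
  -- applies `β` to elements `D x`, and there the term with `f (D x)` is absent.
  let Good : ℕ → (E.carrier →ₗ[k] X) → Prop := fun n β => ∀ b x, x ∈ E.piece (n, b) →
    β x ∈ A (s - 1 - n) (t - b) ∧ (D x = 0 → δ (s - 1 - n) (β x) = c x)
  have h0 : ∃ β, Good 0 β := by
    obtain ⟨β, hβ⟩ := E.exists_lift hE (fun st => st.1 = 0) (fun st => A (s - 1 - st.1) (t - st.2))
      (fun st => δ (s - 1 - st.1)) c (by
        rintro ⟨a, b⟩ x rfl hx
        have h1 : D x = 0 := by
          have h := hD _ _ _ hx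
          rw [E.piece_neg _ _ (by omega)] at h
          simpa using h
        have h := hA _ _ _ (hc _ _ _ hx) (by rw [hδ _ _ _ hx, h1, map_zero, smul_zero])
        simp only [sub_zero] at h ⊢
        exact h)
    refine ⟨β, fun b x hx => ?_⟩
    have h := hβ (0, b) x rfl hx
    exact ⟨h.1, fun _ => h.2⟩
  have step : ∀ n (β : {β // Good n β}), ∃ β' : {β // Good (n + 1) β},
      ∀ b x, x ∈ E.piece ((n + 1 : ℕ), b) →
        δ (s - 1 - (n + 1 : ℕ)) (β'.1 x) + (s.negOnePow : ℤ) • β.1 (D x) = c x := by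
    rintro n ⟨β, hβ⟩
    obtain ⟨β', hβ'⟩ := E.exists_lift hE (fun st => st.1 = (n + 1 : ℕ))
      (fun st => A (s - 1 - st.1) (t - st.2))
      (fun st => δ (s - 1 - st.1)) (c - (s.negOnePow : ℤ) • β ∘ₗ D) (by
        rintro ⟨a, b⟩ x rfl hx
        have hx' := hD _ _ _ hx
        rw [show ((n + 1 : ℕ) : ℤ) - 1 = n by push_cast; ring] at hx'
        obtain ⟨h1, h2⟩ := hβ b _ hx'
        rw [show s - 1 - (n : ℤ) = s - (n + 1 : ℕ) by push_cast; ring] at h1 h2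
        have h := hA (s - (n + 1 : ℕ)) (t - b) (c x - (s.negOnePow : ℤ) • β (D x))
          (Submodule.sub_mem _ (hc _ _ _ hx) (Submodule.smul_of_tower_mem _ _ h1)) (by
            rw [map_sub, map_zsmul, hδ _ _ _ hx, h2 (hDD x), sub_self])
        rw [show s - ((n + 1 : ℕ) : ℤ) - 1 = s - 1 - (n + 1 : ℕ) by ring] at h
        exact h)
    refine ⟨⟨β', fun b x hx => ?_⟩, fun b x hx => ?_⟩
    · have h := hβ' (_, b) x rfl hx
      refine ⟨h.1, fun hx' => ?_⟩
      rw [h.2]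
      simp [hx']
    · rw [(hβ' (_, b) x rfl hx).2]
      simp
  obtain ⟨β₀, hβ₀⟩ := h0
  choose next hnext using step
  let seq : ∀ n, {β // Good n β} := fun n => Nat.rec ⟨β₀, hβ₀⟩ (fun n β => next n β) n
  have hseq : ∀ n, seq (n + 1) = next n (seq n) := fun n => rfl
  -- The value of `toNat` on negative degrees does not matter, as those pieces vanish.
  obtain ⟨f, hf⟩ := E.exists_glue fun st => (seq st.1.toNat).1 ∘ₗ (E.piece st).subtype
  have hf' : ∀ (n : ℕ) b x, x ∈ E.piece (n, b) → f x = (seq n).1 x := fun n b x hx => by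
    have h := hf (n, b) ⟨x, hx⟩
    simpa using h
  have hneg : ∀ a b x, x ∈ E.piece (a, b) → a < 0 → x = 0 := fun a b x hx ha => by
    rw [E.piece_neg _ _ ha] at hx
    simpa using hx
  refine ⟨f, fun a b x hx => ?_, fun a b x hx => ?_⟩
  · rcases lt_or_ge a 0 with ha | ha
    · rw [hneg a b x hx ha, map_zero]
      exact Submodule.zero_mem _
    · lift a to ℕ using ha
      rw [hf' a b x hx]
      exact ((seq a).2 b x hx).1
  · rcases lt_or_ge a 0 with ha | ha
    · rw [hneg a b x hx ha]
      simp
    · lift a to ℕ using ha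
      have hdx := hD _ _ _ hx
      rcases a with _ | a
      · have h1 : D x = 0 := hneg _ _ _ hdx (by simp)
        rw [hf' 0 b x hx, h1, map_zero, smul_zero, add_zero]
        exact ((seq 0).2 b x hx).2 h1
      · rw [show ((a + 1 : ℕ) : ℤ) - 1 = a by push_cast; ring] at hdx
        rw [hf' _ b x hx, hf' _ b _ hdx, hseq]
        exact hnext a (seq a) b x hx

/-- Projectivity of tensor powers, used one argument at a time: Hom out of r + 1 factors is Hom from
`E` into Hom out of r factors, and the inductive hypothesis supplies the elementwise lifts. -/
theorem exists_lift_homInto {E : BigradedModule k} (hE : ∀ st, Module.Projective k (E.piece st))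
    {W : ℤ × ℤ → Submodule k X} {W' : ℤ × ℤ → Submodule k Y} {ψ : X →ₗ[k] Y}
    (hψ : ∀ st y, y ∈ W' st → ∃ x ∈ W st, ψ x = y) {r : ℕ} {s t : ℤ}
    {c : Mult k E.carrier Y r} (hc : c ∈ homInto E W' r s t) :
    ∃ b ∈ homInto E W r s t, ψ.compMultilinearMap b = c := by
  induction r generalizing s t with
  | zero =>
    obtain ⟨x, hx, hx'⟩ := hψ _ _ (mem_homInto_zero.1 hc)
    refine ⟨MultilinearMap.constOfIsEmpty k _ x, mem_homInto_zero.2 hx, ?_⟩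
    ext y
    rw [Subsingleton.elim y ![], ← hx']
    rfl
  | succ r ih =>
    obtain ⟨b, hb⟩ := E.exists_lift hE (fun _ => True)
      (fun st => homInto E W r (s - st.1) (t - st.2))
      (fun _ => LinearMap.compMultilinearMapₗ k ψ) (cur c)
      (fun st x _ hx => ih (mem_homInto_succ.1 hc _ _ x hx))
    refine ⟨unc b, ?_, ?_⟩
    · rw [mem_homInto_succ]
      intro a' b' x hx
      rw [cur_unc]
      exact (hb _ _ trivial hx).1
    · refine cur.injective (BigradedModule.linearMap_ext fun st x hx => ?_)
      rw [cur_comp, cur_unc]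
      exact (hb _ _ trivial hx).2

end Lifting

/-! ### Exactness of the columns and of the total complex. -/

section Columns

variable {k : Type u} [CommRing k] {E F G : BidgaData k}

/-- After currying, the differential is that of the Hom complex from `E` to the Hom complex with r
arguments, the situation of `BigradedModule.exists_primitive`. -/
theorem cur_homD (s : ℤ) {r : ℕ} (c : Mult k E.carrier F.carrier (r + 1)) {a b : ℤ} {x : E.carrier}
    (hx : x ∈ E.piece (a, b)) : cur (homD s (r + 1) c) x =
      homD (s - a) r (cur c x) - (s.negOnePow : ℤ) • cur c (E.d x) := by
  rw [homD_apply, homD_apply, map_sub, map_zsmul, LinearMap.sub_apply, LinearMap.smul_apply,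
    cur_derivArgs, cur_comp, E.sgn_of_mem 1 0 hx, map_zsmul, map_zsmul, smul_add,
    ← negOnePow_add_zsmul]
  have h : (s + (a * 1 + b * 0)).negOnePow = (s - a).negOnePow := by
    rw [show s + (a * 1 + b * 0) = s - a + (a + a) by ring, Int.negOnePow_add,
      Int.negOnePow_even (a + a) ⟨_, rfl⟩, _root_.mul_one]
  rw [h]
  abel

/-- The columns of the Hochschild complex with values in an exact complex are exact. -/
theorem exists_homD_eq (hE : E.IsBidga) (hP : ∀ st, Module.Projective k (E.piece st))
    {W : ℤ × ℤ → Submodule k F.carrier}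
    (hW : ∀ s t x, x ∈ W (s, t) → F.d x = 0 → ∃ y ∈ W (s + 1, t), F.d y = x) {r : ℕ} {s t : ℤ}
    {c : Mult k E.carrier F.carrier r} (hc : c ∈ homInto E.toBigradedModule W r s t)
    (h : homD s r c = 0) :
    ∃ b ∈ homInto E.toBigradedModule W r (s - 1) t, homD (s - 1) r b = c := by
  induction r generalizing s t with
  | zero =>
    obtain ⟨x, hx, hx'⟩ := hW _ _ _ (mem_homInto_zero.1 hc) (by
      have h' := congrArg (fun c' => c' ![]) h
      simpa [homD_apply] using h')
    rw [show -s + 1 = -(s - 1) by ring] at hx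
    refine ⟨MultilinearMap.constOfIsEmpty k _ x, mem_homInto_zero.2 hx, ?_⟩
    ext y
    rw [Subsingleton.elim y ![], ← hx']
    simp [homD_apply]
  | succ r ih =>
    -- The target is the Hom complex with r arguments, which is exact by the inductive hypothesis.
    obtain ⟨b, hb, hb'⟩ := E.exists_primitive hP E.d hE.d_mem hE.d_d
      (fun s t => homInto E.toBigradedModule W r s t) (fun s => homD (F := F) s r)
      (fun s t x hx hx' => ih hx hx') s t (cur c) (mem_homInto_succ.1 hc) (fun a b x hx => by
        have h1 := cur_homD s c hx
        rw [h, map_zero, LinearMap.zero_apply, eq_comm, sub_eq_zero] at h1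
        exact h1)
    refine ⟨unc b, ?_, ?_⟩
    · rw [mem_homInto_succ]
      intro a' b' x hx
      rw [cur_unc]
      exact hb _ _ _ hx
    · refine cur.injective (BigradedModule.linearMap_ext fun st x hx => ?_)
      rw [cur_homD _ _ hx, cur_unc, ← hb' _ _ x hx, Int.negOnePow_sub]
      simp

/-- Component r of the differential sees no component beyond r. Hence a sequence of cochains that
becomes stationary in each component has a limit with the expected differential. -/
theorem totD_congr (φ : E.carrier →ₗ[k] F.carrier) (q t : ℤ) {b b' : Cochain E F} {r : ℕ}
    (h : ∀ i ≤ r, b i = b' i) : totD φ q t b r = totD φ q t b' r := by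
  cases r with
  | zero => rw [totD_zero, totD_zero, h 0 le_rfl]
  | succ r => rw [totD_succ, totD_succ, h r (Nat.le_succ r), h (r + 1) le_rfl]

/-- If the columns of the Hochschild complex are exact, then so is the total complex. Here the
cochains are restricted to submodules `A`, and exactness is meant modulo submodules `Q`. -/
theorem exists_totD (φ : E.carrier →ₗ[k] F.carrier) (q t : ℤ)
    (A Q : (r : ℕ) → ℤ → Submodule k (Mult k E.carrier F.carrier r))
    (hcol : ∀ r s c, c ∈ A r s → homD s r c ∈ Q r (s + 1) →
      ∃ b ∈ A r (s - 1), c - homD (s - 1) r b ∈ Q r s)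
    (hA : ∀ b : Cochain E F, (∀ r : ℕ, b r ∈ A r (q - 1 - r)) →
      ∀ r : ℕ, totD φ (q - 1) t b r ∈ A r (q - r))
    (hQ : ∀ r s c, c ∈ Q r s → hochD φ s t r c ∈ Q (r + 1) s)
    (hsq : ∀ b : Cochain E F, (∀ r : ℕ, b r ∈ A r (q - 1 - r)) →
      totD φ q t (totD φ (q - 1) t b) = 0)
    (c : Cochain E F) (hc : ∀ r : ℕ, c r ∈ A r (q - r))
    (hDc : ∀ r : ℕ, totD φ q t c r ∈ Q r (q + 1 - r)) :
    ∃ b : Cochain E F, (∀ r : ℕ, b r ∈ A r (q - 1 - r)) ∧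
      ∀ r : ℕ, (c - totD φ (q - 1) t b) r ∈ Q r (q - r) := by
  -- The error `c - totD b` is to lie in `Q` in all components below n; each step repairs one more
  -- component.
  let Good : ℕ → Cochain E F → Prop := fun n b => (∀ r : ℕ, b r ∈ A r (q - 1 - r)) ∧
    ∀ r < n, (c - totD φ (q - 1) t b) r ∈ Q r (q - r)
  have step : ∀ n (b : {b // Good n b}), ∃ b' : {b // Good (n + 1) b},
      ∀ r < n, b'.1 r = b.1 r := by
    rintro n ⟨b, hb, hb'⟩
    set e := c - totD φ (q - 1) t b with he
    have heA : ∀ r : ℕ, e r ∈ A r (q - r) := fun r => Submodule.sub_mem _ (hc r) (hA b hb r)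
    have hDe : totD φ q t e = totD φ q t c := by rw [he, map_sub, hsq b hb, sub_zero]
    -- Component n of the differential of the error lies in `Q` and consists of `homD` of component
    -- n and a Hochschild term from component n - 1; the latter is in `Q` already.
    have heQ : homD (q - n) n (e n) ∈ Q n (q - n + 1) := by
      have h1 := hDc n
      rw [← hDe] at h1
      rw [show q - (n : ℤ) + 1 = q + 1 - n by ring]
      cases n with
      | zero => simpa using h1
      | succ n =>
        have h2 := hQ n _ _ (hb' n (Nat.lt_succ_self n))
        rw [totD_succ] at h1
        push_cast at h1 ⊢
        rw [show q - (n : ℤ) = q + 1 - (n + 1) by ring] at h1 h2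
        exact (Submodule.sub_mem_iff_left _ (Submodule.smul_of_tower_mem _ _ h2)).1 h1
    obtain ⟨b₁, hb₁, hb₁'⟩ := hcol n _ _ (heA n) heQ
    rw [show q - (n : ℤ) - 1 = q - 1 - n by ring] at hb₁ hb₁'
    -- A correction concentrated in component n leaves the repaired components of the error
    -- untouched.
    have hlt : ∀ r < n, (b + Pi.single n b₁ : Cochain E F) r = b r := fun r hr => by
      rw [Pi.add_apply, Pi.single_eq_of_ne hr.ne, add_zero]
    refine ⟨⟨b + Pi.single n b₁, fun r => ?_, fun r hr => ?_⟩, hlt⟩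
    · rcases eq_or_ne r n with rfl | h
      · simpa using Submodule.add_mem _ (hb r) hb₁
      · simpa [h] using hb r
    · rcases Nat.lt_succ_iff_lt_or_eq.1 hr with hr | rfl
      · rw [Pi.sub_apply, totD_congr φ _ t (fun i hi => hlt i (by omega))]
        exact hb' r hr
      · have h1 : totD φ (q - 1) t (Pi.single r b₁ : Cochain E F) r = homD (q - 1 - r) r b₁ := by
          cases r with
          | zero => simp
          | succ r => simp
        rw [map_add, ← sub_sub, Pi.sub_apply, h1]
        exact hb₁'
  choose next hnext using step
  let seq : ∀ n, {b // Good n b} := fun n =>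
    Nat.rec ⟨0, fun r => Submodule.zero_mem _, fun r hr => absurd hr (Nat.not_lt_zero r)⟩
      (fun n b => next n b) n
  have hseq : ∀ n, ∀ r < n, (seq (n + 1)).1 r = (seq n).1 r := fun n => hnext n (seq n)
  have hstab : ∀ m r, (seq (r + 1 + m)).1 r = (seq (r + 1)).1 r := fun m => by
    induction m with
    | zero => intro r; rfl
    | succ m ih =>
      intro r
      rw [← ih r]
      exact hseq (r + 1 + m) r (by omega)
  -- The diagonal sequence: component r is final from stage r + 1 on. Infinitely many components may
  -- be nonzero, which the product total complex allows.
  refine ⟨fun r => (seq (r + 1)).1 r, fun r => (seq (r + 1)).2.1 r, fun r => ?_⟩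
  rw [Pi.sub_apply, totD_congr φ _ t (b' := (seq (r + 1)).1) (fun i hi => by
    have h := hstab (r - i) i
    rw [show i + 1 + (r - i) = r + 1 by omega] at h
    exact h.symm)]
  exact (seq (r + 1)).2.2 r (Nat.lt_succ_self r)

end Columns

/-! ### Invariance of Hochschild cohomology -/

section Invariance

variable {k : Type u} [CommRing k] {E F G : BidgaData k}

/-- A surjective map of bidgas with trivial kernel homology. -/
structure IsTrivialFibration (α : F.carrier →ₗ[k] G.carrier) : Prop extends
    IsBidgaMap F G α where
  surj : ∀ st y, y ∈ G.piece st → ∃ x ∈ F.piece st, α x = y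
  exact : ∀ s t x, x ∈ F.piece (s, t) → α x = 0 → F.d x = 0 →
    ∃ y ∈ F.piece (s + 1, t), α y = 0 ∧ F.d y = x

/-- The graded pieces of the kernel of a linear map. -/
def kerPiece (F : BidgaData k) (α : F.carrier →ₗ[k] G.carrier) (st : ℤ × ℤ) :
    Submodule k F.carrier :=
  F.piece st ⊓ LinearMap.ker α

/-- Homogeneous elements span, so by multilinearity a condition on values that defines a submodule
needs to be checked on homogeneous arguments only. -/
theorem apply_mem_of_mem_homInto {E : BigradedModule k} {X : Type u} [AddCommGroup X] [Module k X]
    {N : Submodule k X} {r : ℕ} {c : Mult k E.carrier X r}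
    (hc : ∀ (deg : Fin r → ℤ × ℤ) (x : Fin r → E.carrier), (∀ l, x l ∈ E.piece (deg l)) → c x ∈ N)
    (x : Fin r → E.carrier) : c x ∈ N := by
  induction r with
  | zero => exact hc ![] x (fun l => l.elim0)
  | succ r ih =>
    rw [apply_eq_cur]
    generalize Fin.tail x = y
    induction x 0 using E.induction with
    | h0 => simp
    | hom st x hx =>
      refine ih (fun deg y hy => ?_) y
      rw [cur_apply]
      refine hc (Fin.cons st deg) _ fun l => ?_
      refine Fin.cases ?_ (fun l => ?_) l <;> simp [hx, hy]
    | add x x' hx hx' =>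
      rw [map_add, _root_.add_apply]
      exact Submodule.add_mem _ hx hx'

theorem IsTrivialFibration.kerPiece_exact {α : F.carrier →ₗ[k] G.carrier}
    (hα : IsTrivialFibration α) (s t : ℤ) (x : F.carrier) (hx : x ∈ kerPiece F α (s, t))
    (hdx : F.d x = 0) : ∃ y ∈ kerPiece F α (s + 1, t), F.d y = x := by
  obtain ⟨y, hy, hy', hy''⟩ := hα.exact s t x hx.1 hx.2 hdx
  exact ⟨y, ⟨hy, hy'⟩, hy''⟩

theorem homD_push {ψ : F.carrier →ₗ[k] G.carrier} (hψ : IsBidgaMap F G ψ) (s : ℤ) {r : ℕ}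
    (c : Mult k E.carrier F.carrier r) :
    homD s r (ψ.compMultilinearMap c : Mult k E.carrier G.carrier r) =
      ψ.compMultilinearMap (homD s r c) := by
  rw [homD_apply, homD_apply, ← comp_derivArgs]
  ext x
  simp [hψ.map_d]

theorem hochD_push (φ : E.carrier →ₗ[k] F.carrier) {ψ : F.carrier →ₗ[k] G.carrier}
    (hψ : IsBidgaMap F G ψ) (s t : ℤ) {r : ℕ} (c : Mult k E.carrier F.carrier r) :
    hochD (ψ ∘ₗ φ) s t r (ψ.compMultilinearMap c : Mult k E.carrier G.carrier r) =
      ψ.compMultilinearMap (hochD φ s t r c) := by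
  rw [hochD_apply, hochD_apply, ← comp_contract]
  ext x
  simp [hψ.map_mul, mulLast_apply, apply_eq_cur (mulFirst _ _)]

theorem totD_push (φ : E.carrier →ₗ[k] F.carrier) {ψ : F.carrier →ₗ[k] G.carrier}
    (hψ : IsBidgaMap F G ψ) (q t : ℤ) (c : Cochain E F) :
    totD (ψ ∘ₗ φ) q t (pushCochain ψ c) = pushCochain ψ (totD φ q t c) := by
  funext r
  cases r with
  | zero => exact homD_push hψ _ _
  | succ r =>
    change homD _ _ (ψ.compMultilinearMap (c (r + 1))) - _ • hochD _ _ _ _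
      (ψ.compMultilinearMap (c r)) = ψ.compMultilinearMap _
    rw [homD_push hψ, hochD_push _ hψ, totD_succ]
    ext x
    simp

theorem homD_pull {α : E.carrier →ₗ[k] F.carrier} (hα : IsBidgaMap E F α) (s : ℤ) {r : ℕ}
    (c : Mult k F.carrier G.carrier r) :
    homD s r (c.compLinearMap fun _ => α : Mult k E.carrier G.carrier r) =
      (homD s r c).compLinearMap fun _ => α := by
  ext x
  rw [MultilinearMap.compLinearMap_apply, homD_apply, homD_apply]
  simp only [_root_.sub_apply, _root_.smul_apply, derivArgs_apply,
    LinearMap.compMultilinearMap_apply, MultilinearMap.compLinearMap_apply]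
  congr 3
  funext j
  congr 1
  funext l
  split_ifs
  · exact hα.map_sgn _ _ _
  · exact hα.map_d _
  · rfl

theorem hochD_pull {α : E.carrier →ₗ[k] F.carrier} (hα : IsBidgaMap E F α)
    (φ : F.carrier →ₗ[k] G.carrier) (s t : ℤ) {r : ℕ} (c : Mult k F.carrier G.carrier r) :
    hochD (φ ∘ₗ α) s t r (c.compLinearMap fun _ => α : Mult k E.carrier G.carrier r) =
      (hochD φ s t r c).compLinearMap fun _ => α := by
  ext x
  rw [MultilinearMap.compLinearMap_apply, ← hochDiff_eq, ← hochDiff_eq]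
  simp only [hochDiff, MultilinearMap.compLinearMap_apply, LinearMap.comp_apply, hα.map_sgn]
  congr 1
  refine Finset.sum_congr rfl fun j _ => ?_
  congr 2
  funext l
  simp only [Fin.contractNth]
  split_ifs
  · rfl
  · exact hα.map_mul _ _
  · rfl

theorem totD_pull {α : E.carrier →ₗ[k] F.carrier} (hα : IsBidgaMap E F α)
    (φ : F.carrier →ₗ[k] G.carrier) (q t : ℤ) (c : Cochain F G) :
    totD (φ ∘ₗ α) q t (pullCochain α c) = pullCochain α (totD φ q t c) := by
  funext r
  cases r with
  | zero => exact homD_pull hα _ _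
  | succ r =>
    change homD _ _ ((c (r + 1)).compLinearMap fun _ => α) - _ • hochD _ _ _ _
      ((c r).compLinearMap fun _ => α) = (totD φ q t c (r + 1)).compLinearMap fun _ => α
    rw [homD_pull hα, hochD_pull hα, totD_succ]
    ext x
    simp

/-! ### Change of coefficients along a trivial fibration. -/

section Push

variable (hE : E.IsBidga) (hP : ∀ st, Module.Projective k (E.piece st)) (hF : F.IsBidga)
  {φ : E.carrier →ₗ[k] F.carrier} (hφ : IsBidgaMap E F φ)
  {ψ : F.carrier →ₗ[k] G.carrier} (hψ : IsTrivialFibration ψ)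

include hE hP hF hφ hψ in
/-- Cocycles with values in the kernel of a trivial fibration are coboundaries. -/
theorem exists_totD_eq_of_push_eq_zero {q t : ℤ} {c : Cochain E F} (hc : c ∈ cocycles φ q t)
    (h : pushCochain ψ c = 0) : ∃ b ∈ cochains E F (q - 1) t,
      totD φ (q - 1) t b = c ∧ pushCochain ψ b = 0 := by
  rw [mem_cocycles_iff] at hc
  have hd : ∀ s t x, x ∈ kerPiece F ψ (s, t) → F.d x ∈ kerPiece F ψ (s - 1, t) :=
    fun s t x hx => ⟨hF.d_mem _ _ _ hx.1, by
      change ψ _ = 0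
      rw [hψ.map_d, LinearMap.mem_ker.1 hx.2, map_zero]⟩
  have hl : ∀ st st' x y, x ∈ F.piece st → y ∈ kerPiece F ψ st' →
      F.mul x y ∈ kerPiece F ψ (st + st') := fun st st' x y hx hy =>
    ⟨hF.mul_mem _ _ _ _ hx hy.1, by
      change ψ _ = 0
      rw [hψ.map_mul, LinearMap.mem_ker.1 hy.2, map_zero]⟩
  have hr : ∀ st st' x y, x ∈ kerPiece F ψ st → y ∈ F.piece st' →
      F.mul x y ∈ kerPiece F ψ (st + st') := fun st st' x y hx hy =>
    ⟨hF.mul_mem _ _ _ _ hx.1 hy, by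
      change ψ _ = 0
      rw [hψ.map_mul, LinearMap.mem_ker.1 hx.2, map_zero,
        LinearMap.zero_apply]⟩
  have hsub : ∀ {r : ℕ} {s : ℤ} {c : Mult k E.carrier F.carrier r},
      c ∈ homInto E.toBigradedModule (kerPiece F ψ) r s t →
      c ∈ homInto E.toBigradedModule F.piece r s t := fun h deg x hx => (h deg x hx).1
  -- Cochains with values in the kernel form a subcomplex with exact columns, since the kernel is an
  -- acyclic sub-bimodule; here exactness is not relative, so `Q` is zero.
  obtain ⟨b, hb, hb'⟩ := exists_totD (E := E) (F := F) φ q t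
    (fun r s => homInto E.toBigradedModule (kerPiece F ψ) r s t) (fun _ _ => ⊥)
    (fun r s c hc hc' => by
      obtain ⟨b, hb, hb'⟩ := exists_homD_eq hE hP hψ.kerPiece_exact hc (by simpa using hc')
      exact ⟨b, hb, by simp [hb']⟩)
    (fun b hb r => by
      cases r with
      | zero =>
        have h := homD_mem_homInto hE hd (hb 0)
        rw [totD_zero]
        simp only [Nat.cast_zero, sub_zero, sub_add_cancel] at h ⊢
        exact h
      | succ r =>
        have h := homD_mem_homInto hE hd (hb (r + 1))
        have h' := hochD_mem_homInto hE hφ hl hr (hb r)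
        rw [totD_succ]
        push_cast at h ⊢
        rw [show q - 1 - (r + 1 : ℤ) + 1 = q - (r + 1) by ring] at h
        rw [show q - 1 - (r : ℤ) = q - (r + 1) by ring] at h' ⊢
        exact Submodule.sub_mem _ h (Submodule.smul_of_tower_mem _ _ h'))
    (fun r s c hc => by
      rw [(Submodule.mem_bot k).1 hc, map_zero]
      exact Submodule.zero_mem _)
    (fun b hb => by
      have h := totD_totD hE hF hφ (q := q - 1) (t := t) (c := b) (fun r => hsub (hb r))
      rwa [sub_add_cancel] at h)
    c (fun r deg x hx => ⟨hc.1 r deg x hx, by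
      exact congrArg (fun c' : Cochain E G => c' r x) h⟩)
    (fun r => by rw [hc.2]; exact Submodule.zero_mem _)
  refine ⟨b, fun r => hsub (hb r), ?_, ?_⟩
  · funext r
    have h := hb' r
    simp only [Pi.sub_apply, Submodule.mem_bot, sub_eq_zero] at h
    exact h.symm
  · funext r
    refine MultilinearMap.ext fun x => ?_
    change ψ (b r x) = 0
    exact apply_mem_of_mem_homInto (fun deg x hx => (hb r deg x hx).2) x

-- Surjectivity on cohomology. A lift of the cocycle as a mere cochain has its differential in the
-- kernel; that differential is bounded within the kernel, and the bounding cochain is subtracted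
-- from the lift.
include hE hP hF hφ hψ in
theorem exists_push_eq {q t : ℤ} {c : Cochain E G} (hc : c ∈ cocycles (ψ ∘ₗ φ) q t) :
    ∃ b ∈ cocycles φ q t, pushCochain ψ b = c := by
  rw [mem_cocycles_iff] at hc
  choose b hb hb' using fun r : ℕ => exists_lift_homInto hP hψ.surj (hc.1 r)
  have hbc : pushCochain ψ b = c := funext hb'
  have hbm : b ∈ cochains E F q t := hb
  obtain ⟨e, he, he', he''⟩ := exists_totD_eq_of_push_eq_zero hE hP hF hφ hψ (q := q + 1) (t := t)
    (c := totD φ q t b) (mem_cocycles_iff.2 ⟨totD_mem_cochains hE hF hφ hbm,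
      totD_totD hE hF hφ hbm⟩)
    (by rw [← totD_push φ hψ.toIsBidgaMap, hbc, hc.2])
  rw [add_sub_cancel_right] at he he'
  refine ⟨b - e, mem_cocycles_iff.2 ⟨Submodule.sub_mem _ hbm he, ?_⟩, ?_⟩
  · rw [map_sub, he', sub_self]
  · rw [map_sub, he'', sub_zero, hbc]

-- Injectivity on cohomology. After lifting a primitive of the image, the remaining difference is a
-- cocycle in the kernel, hence a coboundary.
include hE hP hF hφ hψ in
theorem mem_coboundaries_of_push {q t : ℤ} {c : Cochain E F} (hc : c ∈ cocycles φ q t)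
    (h : pushCochain ψ c ∈ coboundaries (ψ ∘ₗ φ) q t) : c ∈ coboundaries φ q t := by
  rw [mem_coboundaries_iff] at h ⊢
  obtain ⟨b', hb', h⟩ := h
  choose b hb hbb using fun r : ℕ => exists_lift_homInto hP hψ.surj (hb' r)
  have hbc : pushCochain ψ b = b' := funext hbb
  have hbm : b ∈ cochains E F (q - 1) t := hb
  have hD := totD_mem_cochains hE hF hφ hbm
  have hDD := totD_totD hE hF hφ hbm
  rw [sub_add_cancel] at hD hDD
  rw [mem_cocycles_iff] at hc
  obtain ⟨e, he, he', -⟩ := exists_totD_eq_of_push_eq_zero hE hP hF hφ hψ (q := q) (t := t)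
    (c := c - totD φ (q - 1) t b) (mem_cocycles_iff.2 ⟨Submodule.sub_mem _ hc.1 hD, by
      rw [map_sub, hc.2, hDD, sub_zero]⟩)
    (by rw [map_sub, ← totD_push φ hψ.toIsBidgaMap, hbc, h, sub_self])
  refine ⟨b + e, Submodule.add_mem _ hbm he, ?_⟩
  rw [map_add, he', add_sub_cancel]

end Push

/-! ### Change of arguments along a trivial fibration. -/

section Pull

variable (hE : E.IsBidga) (hPE : ∀ st, Module.Projective k (E.piece st)) (hF : F.IsBidga)
  (hPF : ∀ st, Module.Projective k (F.piece st)) (hG : G.IsBidga) (hdG : G.d = 0)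
  {α : E.carrier →ₗ[k] F.carrier} (hα : IsTrivialFibration α)
  {φ : F.carrier →ₗ[k] G.carrier} (hφ : IsBidgaMap F G φ)

include hE hPE hF hPF hα in
/-- A trivial fibration between projective bidgas is a deformation retraction of complexes. -/
theorem exists_retraction : ∃ (β : F.carrier →ₗ[k] E.carrier) (h : E.carrier →ₗ[k] E.carrier),
    (∀ st x, x ∈ F.piece st → β x ∈ E.piece st) ∧
    (∀ s t x, x ∈ E.piece (s, t) → h x ∈ E.piece (s + 1, t)) ∧ (∀ x, E.d (β x) = β (F.d x)) ∧
    (∀ x, α (β x) = x) ∧ (∀ x, α (h x) = 0) ∧ ∀ x, E.d (h x) + h (E.d x) = x - β (α x) := by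
  -- The indices are negated because `exists_primitive` expects a differential that raises the
  -- index.
  have hex : ∀ s t x, x ∈ kerPiece E α (-s, -t) → E.d x = 0 →
      ∃ y ∈ kerPiece E α (-(s - 1), -t), E.d y = x := fun s t x hx hx' => by
    have h := hα.kerPiece_exact _ _ x hx hx'
    rwa [show -s + 1 = -(s - 1) by ring] at h
  obtain ⟨β₀, hβ₀⟩ := F.exists_lift hPF (fun _ => True) E.piece (fun _ => α) LinearMap.id
    (fun st x _ hx => hα.surj st x hx)
  have hβ₀' : ∀ x, α (β₀ x) = x := by
    have h : α ∘ₗ β₀ = LinearMap.id :=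
      BigradedModule.linearMap_ext fun st x hx => (hβ₀ st x trivial hx).2
    exact LinearMap.congr_fun h
  -- The linear section `β₀` need not commute with the differentials. Its defect is a cocycle with
  -- values in the acyclic kernel, and subtracting a primitive turns the section into a chain map.
  obtain ⟨e, he, he'⟩ := F.exists_primitive hPF F.d hF.d_mem hF.d_d
    (fun s t => kerPiece E α (-s, -t)) (fun _ => E.d) hex 1 0 (E.d ∘ₗ β₀ - β₀ ∘ₗ F.d)
    (fun a b x hx => by
      rw [neg_sub, neg_sub, sub_zero]
      refine ⟨Submodule.sub_mem _ (hE.d_mem _ _ _ (hβ₀ _ x trivial hx).1)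
        (hβ₀ _ _ trivial (hF.d_mem _ _ _ hx)).1, ?_⟩
      simp [hα.map_d, hβ₀'])
    (fun a b x hx => by simp [hE.d_d, hF.d_d])
  have he₁ : ∀ a b x, x ∈ F.piece (a, b) → e x ∈ kerPiece E α (a, b) := fun a b x hx => by
    have h := he a b x hx
    simpa using h
  have hαe : ∀ x, α (e x) = 0 := by
    have h : α ∘ₗ e = 0 :=
      BigradedModule.linearMap_ext fun st x hx => (he₁ _ _ x hx).2
    exact LinearMap.congr_fun h
  have hde : ∀ x, E.d (e x) - e (F.d x) = E.d (β₀ x) - β₀ (F.d x) := by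
    have h : E.d ∘ₗ e - e ∘ₗ F.d = E.d ∘ₗ β₀ - β₀ ∘ₗ F.d :=
      BigradedModule.linearMap_ext fun st x hx => by
        have h := he' _ _ x hx
        simpa [sub_eq_add_neg] using h
    exact LinearMap.congr_fun h
  set β := β₀ - e with hβ
  have hβmem : ∀ st x, x ∈ F.piece st → β x ∈ E.piece st := fun st x hx =>
    Submodule.sub_mem _ (hβ₀ st x trivial hx).1 (he₁ _ _ x hx).1
  have hαβ : ∀ x, α (β x) = x := fun x => by simp [hβ, hβ₀', hαe]
  have hβd : ∀ x, E.d (β x) = β (F.d x) := fun x => by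
    have h := hde x
    rw [hβ, LinearMap.sub_apply, LinearMap.sub_apply, map_sub, sub_eq_sub_iff_sub_eq_sub]
    exact h.symm
  -- The chain map 1 - βα has values in the kernel of α, so it has a primitive there. That α ∘ h
  -- vanishes is essential later.
  obtain ⟨h, hh, hh'⟩ := E.exists_primitive hPE E.d hE.d_mem hE.d_d
    (fun s t => kerPiece E α (-s, -t)) (fun _ => E.d) hex 0 0 (LinearMap.id - β ∘ₗ α)
    (fun a b x hx => by
      simp only [zero_sub, neg_neg]
      refine ⟨Submodule.sub_mem _ hx (hβmem _ _ (hα.map_mem _ _ hx)), ?_⟩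
      simp [hαβ])
    (fun a b x hx => by simp [hβd, hα.map_d])
  have hh₁ : ∀ a b x, x ∈ E.piece (a, b) → h x ∈ kerPiece E α (a + 1, b) := fun a b x hx => by
    have h' := hh a b x hx
    rwa [show -(0 - 1 - a) = a + 1 by ring, show -(0 - b) = b by ring] at h'
  refine ⟨β, h, hβmem, fun s t x hx => (hh₁ s t x hx).1, hβd, hαβ, ?_, ?_⟩
  · have h' : α ∘ₗ h = 0 :=
      BigradedModule.linearMap_ext fun st x hx => (hh₁ _ _ x hx).2
    exact LinearMap.congr_fun h'
  · have h' : E.d ∘ₗ h + h ∘ₗ E.d = LinearMap.id - β ∘ₗ α :=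
      BigradedModule.linearMap_ext fun st x hx => by
        have h := hh' _ _ x hx
        simpa using h
    exact LinearMap.congr_fun h'

/-- The homotopy on multilinear maps induced by a homotopy `h` between the identity and `p`. -/
theorem derivArgs_homotopy {V W : Type u} [AddCommGroup V] [Module k V] [AddCommGroup W]
    [Module k W] {d σ h p : V →ₗ[k] V} (hσσ : ∀ x, σ (σ x) = x) (hσd : ∀ x, σ (d x) = -d (σ x))
    (hσh : ∀ x, σ (h x) = -h (σ x)) (hσp : ∀ x, σ (p x) = p (σ x)) (hpd : ∀ x, d (p x) = p (d x))
    (hh : ∀ x, d (h x) + h (d x) = x - p x) {r : ℕ} (c : Mult k V W r) :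
    derivArgs d σ r (derivArgs h (p ∘ₗ σ) r c) + derivArgs h (p ∘ₗ σ) r (derivArgs d σ r c) =
      c - c.compLinearMap fun _ => p := by
  induction r with
  | zero =>
    ext x
    simp only [derivArgs_zero, map_zero, add_zero, _root_.zero_apply, _root_.sub_apply,
      MultilinearMap.compLinearMap_apply]
    rw [Subsingleton.elim (fun i => p (x i)) x, sub_self]
  | succ r ih =>
    refine mult_ext fun x => ?_
    have h1 := ih (cur c (p x))
    rw [← eq_sub_iff_add_eq] at h1
    -- The homotopy on several arguments uses `p` before the position of `h` and the identity after
    -- it, so the sum of the boundary terms telescopes from `c` to `c` composed with `p`.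
    have h2 : cur c (d (h x)) = cur c x - cur c (p x) - cur c (h (d x)) := by
      rw [← map_sub, ← map_sub]
      congr 1
      rw [← hh x]
      abel
    simp only [map_add, map_sub, LinearMap.add_apply, LinearMap.sub_apply, cur_derivArgs,
      LinearMap.comp_apply, cur_compLinearMap, hσσ, hσd, hσh, hσp, hpd, map_neg, h1, h2]
    abel

-- The columns are exact modulo pullbacks. As the coefficients have zero differential, the homotopy
-- on the arguments is a homotopy of columns. It kills pullbacks, hence kills `homD b`; so `b` is,
-- up to a differential, its composite with βα, which is a pullback along α.
include hE hPE hF hPF hα hdG in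
theorem exists_homD_pull {r : ℕ} {s t : ℤ} {b : Mult k E.carrier G.carrier r}
    (hb : b ∈ homInto E.toBigradedModule G.piece r s t) {c : Mult k F.carrier G.carrier r}
    (hc : homD s r b = c.compLinearMap fun _ => α) :
    ∃ b' ∈ homInto E.toBigradedModule G.piece r (s - 1) t,
      ∃ c' ∈ homInto F.toBigradedModule G.piece r s t,
        b - homD (s - 1) r b' = c'.compLinearMap fun _ => α := by
  obtain ⟨β, h, hβ, hh, hβd, hαβ, hαh, hdh⟩ := exists_retraction hE hPE hF hPF hα
  have hd0 : ∀ s (b : Mult k E.carrier G.carrier r), homD s r b =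
      -((s.negOnePow : ℤ) • derivArgs E.d (E.sgn 1 0) r b) := fun s b => by
    rw [homD_apply, hdG]
    ext; simp
  have hσβ : ∀ x, E.sgn 1 0 (β x) = β (F.sgn 1 0 x) := fun x => by
    have h := BigradedModule.sgn_map (E := F.toBigradedModule) (F := E.toBigradedModule) β 0 0
      (fun s t x hx => by simpa using hβ _ x hx) 1 0 x
    simpa using h
  have hσh : ∀ x, E.sgn 1 0 (h x) = -h (E.sgn 1 0 x) := fun x => by
    have h := BigradedModule.sgn_map (E := E.toBigradedModule) (F := E.toBigradedModule) h (-1) 0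
      (fun s t x hx => by simpa using hh _ _ x hx) 1 0 x
    simpa using h
  have key := derivArgs_homotopy (d := E.d) (σ := E.sgn 1 0) (h := h) (p := β ∘ₗ α)
    (E.sgn_sgn 1 0) hE.sgn_one_zero_d hσh (fun x => by simp [hσβ, hα.map_sgn])
    (fun x => by simp [hβd, hα.map_d]) hdh b
  -- Every term of the homotopy has one argument in the image of `h`, where α vanishes.
  have hz : ∀ (r : ℕ) (c : Mult k F.carrier G.carrier r),
      derivArgs h ((β ∘ₗ α) ∘ₗ E.sgn 1 0) r (c.compLinearMap fun _ => α) = 0 := by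
    intro r
    induction r with
    | zero => intro c; simp
    | succ r ih =>
      intro c
      refine mult_ext fun x => ?_
      have h0 : (0 : Mult k F.carrier G.carrier r).compLinearMap (fun _ => α) = 0 := by
        ext; simp
      simp [cur_compLinearMap, ih, hαh, h0]
  have hN : derivArgs E.d (E.sgn 1 0) r b = -((s.negOnePow : ℤ) • homD s r b) := by
    rw [hd0, smul_neg, negOnePow_zsmul_self, neg_neg]
  rw [hN, hc, map_neg, map_zsmul, hz, smul_zero, neg_zero, add_zero] at key
  refine ⟨(s.negOnePow : ℤ) • derivArgs h ((β ∘ₗ α) ∘ₗ E.sgn 1 0) r b,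
    Submodule.smul_of_tower_mem _ _ ?_, b.compLinearMap fun _ => β,
    compLinearMap_mem_homInto hβ hb, ?_⟩
  · have h' := derivArgs_mem_homInto (D := h) (σ := (β ∘ₗ α) ∘ₗ E.sgn 1 0) (p := -1) (q := 0)
      (fun s t x hx => by simpa using hh _ _ x hx)
      (fun st x hx => hβ _ _ (hα.map_mem _ _ (E.sgn_mem 1 0 hx))) hb
    rwa [add_zero] at h'
  · rw [hd0, map_zsmul, key, Int.negOnePow_sub]
    ext x
    simp [MultilinearMap.compLinearMap_apply, negOnePow_zsmul_self]

/-- The action of a linear map on the arguments, as a linear map of multilinear maps. -/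
def pullMult (α : E.carrier →ₗ[k] F.carrier) (r : ℕ) :
    Mult k F.carrier G.carrier r →ₗ[k] Mult k E.carrier G.carrier r where
  toFun c := c.compLinearMap fun _ => α
  map_add' c c' := by ext; simp
  map_smul' a c := by ext; simp

include hα in
theorem IsTrivialFibration.surjective : Function.Surjective α := fun y => by
  induction y using F.induction with
  | h0 => exact ⟨0, map_zero α⟩
  | hom st y hy =>
    obtain ⟨x, -, hx⟩ := hα.surj st y hy
    exact ⟨x, hx⟩
  | add y y' hy hy' =>
    obtain ⟨x, rfl⟩ := hy
    obtain ⟨x', rfl⟩ := hy'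
    exact ⟨x + x', map_add α x x'⟩

include hα in
theorem IsTrivialFibration.pullCochain_injective :
    Function.Injective (pullCochain α : Cochain F G →ₗ[k] Cochain E G) := fun c c' h => by
  funext r
  refine MultilinearMap.ext fun y => ?_
  choose x hx using fun i => hα.surjective (y i)
  have h' := congrArg (fun b : Cochain E G => b r x) h
  change c r (fun i => α (x i)) = c' r (fun i => α (x i)) at h'
  simpa only [hx] using h'

include hE hPE hF hPF hα hφ hG hdG in
/-- A cochain whose differential comes from the base of a trivial fibration is, up to the
differential of a cochain, itself induced from the base. -/
theorem exists_totD_pull {q t : ℤ} {b : Cochain E G} (hb : b ∈ cochains E G q t)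
    {c : Cochain F G} (hc : c ∈ cochains F G (q + 1) t)
    (h : totD (φ ∘ₗ α) q t b = pullCochain α c) :
    ∃ b' ∈ cochains E G (q - 1) t, ∃ c' ∈ cochains F G q t,
      b - totD (φ ∘ₗ α) (q - 1) t b' = pullCochain α c' := by
  have hφα : IsBidgaMap E G (φ ∘ₗ α) := ⟨fun st x hx => hφ.map_mem _ _ (hα.map_mem _ _ hx),
    fun x y => by simp [hα.map_mul, hφ.map_mul], by simp [hα.map_one, hφ.map_one],
    fun x => by simp [hα.map_d, hφ.map_d]⟩
  obtain ⟨b', hb', hbb'⟩ := exists_totD (φ ∘ₗ α) q t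
    (fun r s => homInto E.toBigradedModule G.piece r s t)
    -- Exactness is taken relative to the pullbacks, that is, for the quotient of the complex by the
    -- subcomplex coming from `F`.
    (fun r s => (homInto F.toBigradedModule G.piece r s t).map (pullMult α r))
    (fun r s c hc hc' => by
      obtain ⟨c', hc', hcc'⟩ := hc'
      obtain ⟨b', hb', c'', hc'', h⟩ := exists_homD_pull hE hPE hF hPF hdG hα hc hcc'.symm
      exact ⟨b', hb', c'', hc'', h.symm⟩)
    (fun b hb => by
      have h := totD_mem_cochains hE hG hφα (q := q - 1) (t := t) (c := b) hb
      rwa [sub_add_cancel] at h)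
    (by
      rintro r s _ ⟨c, hc, rfl⟩
      exact ⟨hochD φ s t r c, hochD_mem_homInto hF hφ hG.mul_mem hG.mul_mem hc,
        (hochD_pull hα.toIsBidgaMap φ s t c).symm⟩)
    (fun b hb => by
      have h := totD_totD hE hG hφα (q := q - 1) (t := t) (c := b) hb
      rwa [sub_add_cancel] at h)
    b hb (fun r => ⟨c r, hc r, congrFun h.symm r⟩)
  choose c' hc' hcc' using hbb'
  exact ⟨b', hb', c', hc', funext fun r => (hcc' r).symm⟩

-- Surjectivity on cohomology: the cochain on the base is again a cocycle because pullback along the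
-- surjection α is injective on cochains.
include hE hPE hF hPF hα hφ hG hdG in
theorem exists_cocycle_pull {q t : ℤ} {b : Cochain E G} (hb : b ∈ cocycles (φ ∘ₗ α) q t) :
    ∃ c ∈ cocycles φ q t, b - pullCochain α c ∈ coboundaries (φ ∘ₗ α) q t := by
  rw [mem_cocycles_iff] at hb
  have hφα : IsBidgaMap E G (φ ∘ₗ α) := ⟨fun st x hx => hφ.map_mem _ _ (hα.map_mem _ _ hx),
    fun x y => by simp [hα.map_mul, hφ.map_mul], by simp [hα.map_one, hφ.map_one],
    fun x => by simp [hα.map_d, hφ.map_d]⟩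
  obtain ⟨b', hb', c, hc, h⟩ := exists_totD_pull hE hPE hF hPF hG hdG hα hφ hb.1 (c := 0)
    (Submodule.zero_mem _) (by rw [hb.2, map_zero])
  refine ⟨c, mem_cocycles_iff.2 ⟨hc, hα.pullCochain_injective ?_⟩,
    mem_coboundaries_iff.2 ⟨b', hb', by rw [← h, sub_sub_cancel]⟩⟩
  have h' := totD_totD hE hG hφα hb'
  rw [sub_add_cancel] at h'
  rw [← totD_pull hα.toIsBidgaMap, ← h, map_sub, hb.2, h', sub_zero, map_zero]

-- Injectivity on cohomology: a primitive upstairs may be changed by a differential so that it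
-- descends, which does not affect its own differential.
include hE hPE hF hPF hα hφ hG hdG in
theorem mem_coboundaries_of_pull {q t : ℤ} {c : Cochain F G} (hc : c ∈ cochains F G q t)
    (h : pullCochain α c ∈ coboundaries (φ ∘ₗ α) q t) : c ∈ coboundaries φ q t := by
  rw [mem_coboundaries_iff] at h ⊢
  obtain ⟨b, hb, h⟩ := h
  have hφα : IsBidgaMap E G (φ ∘ₗ α) := ⟨fun st x hx => hφ.map_mem _ _ (hα.map_mem _ _ hx),
    fun x y => by simp [hα.map_mul, hφ.map_mul], by simp [hα.map_one, hφ.map_one],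
    fun x => by simp [hα.map_d, hφ.map_d]⟩
  obtain ⟨b', hb', c', hc', h'⟩ := exists_totD_pull hE hPE hF hPF hG hdG hα hφ hb
    (by rwa [sub_add_cancel]) h
  refine ⟨c', hc', hα.pullCochain_injective ?_⟩
  have h'' := totD_totD hE hG hφα hb'
  rw [sub_add_cancel] at h''
  rw [← totD_pull hα.toIsBidgaMap, ← h', map_sub, h'', sub_zero, h]

end Pull

end Invariance

/-! ### Iterated homology -/

section Iterated

variable {k : Type u} [CommRing k] {V W : Type u} [AddCommGroup V] [Module k V] [AddCommGroup W]
  [Module k W]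

/-- Unpacks the isomorphism of quotients into conditions on representatives: cycles go to cycles,
the map is injective, and it is surjective. -/
theorem inducesIterIso_iff {d₀ d₁ : V →ₗ[k] V} {e₀ e₁ : W →ₗ[k] W} {f : V →ₗ[k] W} :
    InducesIterIso d₀ d₁ e₀ e₁ f ↔
      (∀ x ∈ iterCycles d₀ d₁, f x ∈ iterCycles e₀ e₁) ∧
      (∀ x ∈ iterCycles d₀ d₁, f x ∈ iterBoundaries e₀ e₁ ↔ x ∈ iterBoundaries d₀ d₁) ∧
      ∀ y ∈ iterCycles e₀ e₁, ∃ x ∈ iterCycles d₀ d₁, f x - y ∈ iterBoundaries e₀ e₁ := by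
  constructor
  · rintro ⟨φ, hφ⟩
    refine ⟨fun x hx => (hφ ⟨x, hx⟩).1, fun x hx => ?_, fun y hy => ?_⟩
    · obtain ⟨h, h'⟩ := hφ ⟨x, hx⟩
      have h1 := Submodule.Quotient.mk_eq_zero
        ((iterBoundaries d₀ d₁).submoduleOf (iterCycles d₀ d₁)) (x := ⟨x, hx⟩)
      have h2 := Submodule.Quotient.mk_eq_zero
        ((iterBoundaries e₀ e₁).submoduleOf (iterCycles e₀ e₁)) (x := ⟨f x, h⟩)
      rw [← h', LinearEquiv.map_eq_zero_iff, h1] at h2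
      exact h2.symm
    · obtain ⟨z, hz⟩ := φ.surjective (Submodule.Quotient.mk ⟨y, hy⟩)
      obtain ⟨x, rfl⟩ := Submodule.Quotient.mk_surjective _ z
      obtain ⟨h, h'⟩ := hφ x
      rw [h', Submodule.Quotient.eq] at hz
      exact ⟨x, x.2, hz⟩
  · rintro ⟨h1, h2, h3⟩
    let g := f.restrict h1
    let φ : IterHomology d₀ d₁ →ₗ[k] IterHomology e₀ e₁ :=
      Submodule.mapQ _ _ g fun x hx => (h2 x x.2).2 hx
    have hφ : Function.Bijective φ := by
      constructor
      · rw [injective_iff_map_eq_zero]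
        intro z hz
        obtain ⟨x, rfl⟩ := Submodule.Quotient.mk_surjective _ z
        change (Submodule.Quotient.mk (g x) : IterHomology e₀ e₁) = 0 at hz
        rw [Submodule.Quotient.mk_eq_zero] at hz
        rw [Submodule.Quotient.mk_eq_zero]
        exact (h2 x x.2).1 hz
      · intro z
        obtain ⟨y, rfl⟩ := Submodule.Quotient.mk_surjective _ z
        obtain ⟨x, hx, hxy⟩ := h3 y y.2
        refine ⟨Submodule.Quotient.mk ⟨x, hx⟩, ?_⟩
        exact (Submodule.Quotient.eq _).2 hxy
    exact ⟨LinearEquiv.ofBijective φ hφ, fun x => ⟨h1 x x.2, rfl⟩⟩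

theorem mem_iterCycles_zero_left {d : V →ₗ[k] V} {x : V} : x ∈ iterCycles 0 d ↔ d x = 0 := by
  simp [iterCycles]

theorem mem_iterCycles_zero_right {d : V →ₗ[k] V} {x : V} : x ∈ iterCycles d 0 ↔ d x = 0 := by
  simp [iterCycles]

theorem mem_iterBoundaries_zero_left {d : V →ₗ[k] V} {x : V} :
    x ∈ iterBoundaries 0 d ↔ ∃ y, d y = x := by
  simp [iterBoundaries]

theorem mem_iterBoundaries_zero_right {d : V →ₗ[k] V} {x : V} :
    x ∈ iterBoundaries d 0 ↔ ∃ y, d y = x := by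
  simp [iterBoundaries]

/-- Characterization of the equivalences onto complexes with trivial differentials. -/
theorem inducesIterIso_zero_iff {d : V →ₗ[k] V} {f : V →ₗ[k] W} :
    InducesIterIso 0 d 0 0 f ↔
      (∀ x, f (d x) = 0 ∨ d (d x) ≠ 0) ∧ (∀ x, d x = 0 → f x = 0 → ∃ y, d y = x) ∧
      ∀ y, ∃ x, d x = 0 ∧ f x = y := by
  -- Nothing here says that `d` squares to zero, hence the alternative `d (d x) ≠ 0`: the map is
  -- constrained only on those elements `d x` that are cycles.
  rw [inducesIterIso_iff]
  simp only [mem_iterCycles_zero_left, mem_iterBoundaries_zero_left, LinearMap.zero_apply,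
    exists_const, forall_const, implies_true, true_and]
  constructor
  · rintro ⟨h, h'⟩
    refine ⟨fun x => ?_, fun x hx hx' => (h x hx).1 hx'.symm, fun y => ?_⟩
    · by_cases hx : d (d x) = 0
      · exact Or.inl ((h _ hx).2 ⟨x, rfl⟩).symm
      · exact Or.inr hx
    · obtain ⟨x, hx, hxy⟩ := h' y
      exact ⟨x, hx, sub_eq_zero.1 hxy.symm⟩
  · rintro ⟨h1, h2, h3⟩
    refine ⟨fun x hx => ⟨fun h => h2 x hx h.symm, ?_⟩, fun y => ?_⟩
    · rintro ⟨y, rfl⟩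
      rcases h1 y with h | h
      · exact h.symm
      · exact absurd hx h
    · obtain ⟨x, hx, hxy⟩ := h3 y
      exact ⟨x, hx, (sub_eq_zero.2 hxy).symm⟩

end Iterated

/-! ### Graded algebras as bidgas, and augmentations -/

section Augmentation

variable {k : Type u} [CommRing k]

/-- A graded algebra as a dga with trivial differential. -/
def GradedAlg.toDGA (Λ : GradedAlg k) : DGA k where
  toGradedAlg := Λ
  d := 0
  d_mem _ _ _ := Submodule.zero_mem _
  d_d _ := rfl
  leibniz _ _ _ _ := by simp

/-- A graded algebra as a bidga concentrated in horizontal degree `0`. -/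
def GradedAlg.toBidga (Λ : GradedAlg k) : BidgaData k where
  toBigradedModule := Λ.toDGA.toBigradedModule
  mul := LinearMap.mul k Λ.carrier
  one := (1 : Λ.carrier)
  d := 0

theorem GradedAlg.mem_piece {Λ : GradedAlg k} {t : ℤ} {x : Λ.carrier} :
    (x ∈ Λ.toBidga.piece (0, t)) ↔ x ∈ Λ.grading t := by
  change (x ∈ (if (0 : ℤ) = 0 then Λ.grading t else ⊥)) ↔ _
  simp

theorem GradedAlg.eq_zero_of_mem_piece {Λ : GradedAlg k} {s t : ℤ} (hs : s ≠ 0)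
    {x : Λ.toBidga.carrier} (hx : x ∈ Λ.toBidga.piece (s, t)) : x = 0 := by
  change x ∈ (if s = 0 then Λ.grading t else ⊥) at hx
  rw [if_neg hs] at hx
  exact hx

theorem GradedAlg.isBidga (Λ : GradedAlg k) : Λ.toBidga.IsBidga where
  mul_mem := by
    rintro ⟨s, t⟩ ⟨s', t'⟩ x y hx hy
    by_cases hs : s = 0
    · by_cases hs' : s' = 0
      · subst hs hs'
        have h := SetLike.GradedMul.mul_mem (A := Λ.grading) (GradedAlg.mem_piece.1 hx)
          (GradedAlg.mem_piece.1 hy)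
        rw [Prod.mk_add_mk, add_zero]
        exact GradedAlg.mem_piece.2 h
      · rw [GradedAlg.eq_zero_of_mem_piece hs' hy, map_zero]
        exact Submodule.zero_mem _
    · rw [GradedAlg.eq_zero_of_mem_piece hs hx, map_zero, LinearMap.zero_apply]
      exact Submodule.zero_mem _
  one_mem := GradedAlg.mem_piece.2 (SetLike.GradedOne.one_mem (A := Λ.grading))
  d_mem _ _ _ _ := Submodule.zero_mem _
  mul_assoc x y z := _root_.mul_assoc (G := Λ.carrier) x y z
  one_mul x := _root_.one_mul (M := Λ.carrier) x
  mul_one x := _root_.mul_one (M := Λ.carrier) x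
  d_d _ := rfl
  leibniz s t x y _ := by
    change (0 : Λ.carrier) = LinearMap.mul k Λ.carrier (0 : Λ.carrier) y +
      (s.negOnePow : ℤ) • LinearMap.mul k Λ.carrier x (0 : Λ.carrier)
    simp
    rfl

variable {Λ : GradedAlg k}

/-- The augmentation of a resolution as a map to a bidga. -/
def ResolutionData.augB (R : ResolutionData Λ) : R.carrier →ₗ[k] Λ.toBidga.carrier := R.aug

theorem ResolutionData.IsResolution.isBidgaMap {R : ResolutionData Λ} (hR : R.IsResolution) :
    IsBidgaMap R.toBidgaData Λ.toBidga R.augB where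
  map_mem := by
    rintro ⟨s, t⟩ x hx
    by_cases hs : s = 0
    · subst hs
      exact GradedAlg.mem_piece.2 (hR.aug_mem t x hx)
    · change R.aug x ∈ Λ.toBidga.piece (s, t)
      rw [hR.aug_zero s t x hs hx]
      exact Submodule.zero_mem _
  map_mul := hR.aug_mul
  map_one := hR.aug_one
  map_d := hR.aug_d

/-- Since Λ has zero differential, an equivalence onto it is already surjective on cycles and has
acyclic kernel; `BigradedModule.proj` extracts homogeneous witnesses from the statements on total
modules. -/
theorem ResolutionData.IsResolution.isTrivialFibration {R : ResolutionData Λ}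
    (hR : R.IsResolution) : IsTrivialFibration (F := R.toBidgaData) (G := Λ.toBidga) R.augB where
  toIsBidgaMap := hR.isBidgaMap
  surj := by
    rintro ⟨s, t⟩ y hy
    by_cases hs : s = 0
    · subst hs
      obtain ⟨-, -, h⟩ := inducesIterIso_zero_iff.1 hR.isE2
      obtain ⟨x, -, hx⟩ := h y
      -- The augmentation commutes with projection to a bidegree and `y` is homogeneous, so the
      -- component of a preimage is still a preimage.
      refine ⟨R.proj (0, t) x, (R.proj (0, t) x).2, ?_⟩
      have h1 := BigradedModule.map_proj (E := R.toBigradedModule)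
        (F := Λ.toBidga.toBigradedModule) R.augB 0
        (fun st x hx => by rw [sub_zero]; exact hR.isBidgaMap.map_mem st x hx) (0, t) x
      have h2 : R.augB x = y := hx
      rw [h1, sub_zero, h2, BigradedModule.proj_of_mem _ hy]
    · exact ⟨0, Submodule.zero_mem _, by
        rw [GradedAlg.eq_zero_of_mem_piece hs hy, map_zero]⟩
  exact s t x hx hx' hdx := by
    rcases lt_or_ge s 0 with hs | hs
    · rw [R.piece_neg _ _ hs, Submodule.mem_bot] at hx
      exact ⟨0, Submodule.zero_mem _, map_zero _, by rw [map_zero, hx]⟩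
    · obtain ⟨-, h, -⟩ := inducesIterIso_zero_iff.1 hR.isE2
      obtain ⟨y, hy⟩ := h x hdx hx'
      refine ⟨R.proj (s + 1, t) y, (R.proj (s + 1, t) y).2, ?_, ?_⟩
      · exact hR.aug_zero (s + 1) t _ (by omega) (R.proj (s + 1, t) y).2
      · have h1 := BigradedModule.map_proj (E := R.toBigradedModule) (F := R.toBigradedModule)
          R.d (1, 0) (fun st x hx => by
            have h := hR.isBidga.d_mem st.1 st.2 x hx
            rwa [show (st.1 - 1, st.2) = st - (1, 0) by ext <;> simp] at h) (s + 1, t) y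
        rw [h1, hy, show ((s + 1, t) - (1, 0) : ℤ × ℤ) = (s, t) by ext <;> simp,
          BigradedModule.proj_of_mem _ hx]

end Augmentation

/-! ### Hochschild cohomology with values in the resolved algebra -/

section Comparison

variable {k : Type u} [CommRing k]

/-- Restriction of the arguments along a map of bidgas. -/
def HH.restrict {E F G : BidgaData k} {α : E.carrier →ₗ[k] F.carrier} (hα : IsBidgaMap E F α)
    {φ : F.carrier →ₗ[k] G.carrier} {φ' : E.carrier →ₗ[k] G.carrier} (h : φ ∘ₗ α = φ')
    (q t : ℤ) : HH φ q t →ₗ[k] HH φ' q t :=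
  Submodule.mapQ _ _
    ((pullCochain α).restrict (p := cocycles φ q t) (q := cocycles φ' q t)
      fun c hc => by
        rw [mem_cocycles_iff] at hc ⊢
        exact ⟨pull_mem hα hc.1, by rw [← h, totD_pull hα, hc.2, map_zero]⟩)
    (by
      rintro ⟨c, hc⟩ hb
      obtain ⟨b, hb, h'⟩ := mem_coboundaries_iff.1 hb
      refine mem_coboundaries_iff.2 ⟨pullCochain α b, pull_mem hα hb, ?_⟩
      subst h
      rw [totD_pull hα, h']
      rfl)

theorem HH.exists_mk {E F : BidgaData k} {φ : E.carrier →ₗ[k] F.carrier} {q t : ℤ}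
    (z : HH φ q t) : ∃ c hc, z = HH.mk φ q t c hc := by
  obtain ⟨⟨c, hc⟩, rfl⟩ := Submodule.Quotient.mk_surjective _ z
  exact ⟨c, hc, rfl⟩

theorem HH.mk_eq_mk {E F : BidgaData k} {φ : E.carrier →ₗ[k] F.carrier} {q t : ℤ}
    {c c' : Cochain E F} {hc : c ∈ cocycles φ q t} {hc' : c' ∈ cocycles φ q t} :
    HH.mk φ q t c hc = HH.mk φ q t c' hc' ↔ c - c' ∈ coboundaries φ q t :=
  Submodule.Quotient.eq _

theorem HH.mk_eq_zero {E F : BidgaData k} {φ : E.carrier →ₗ[k] F.carrier} {q t : ℤ}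
    {c : Cochain E F} {hc : c ∈ cocycles φ q t} :
    HH.mk φ q t c hc = 0 ↔ c ∈ coboundaries φ q t :=
  Submodule.Quotient.mk_eq_zero _

variable {Λ : GradedAlg k}

theorem ResolutionMap.comp_augB {R S : Resolution Λ} (α : ResolutionMap R S) :
    S.augB ∘ₗ α.map = R.augB := LinearMap.ext α.aug_map

/-- Composition with the augmentation `HH(R, R) → HH(R, Λ)`. -/
def augHH (R : Resolution Λ) (q t : ℤ) :
    SelfHH R.toBidgaData q t →ₗ[k] HH (E := R.toBidgaData) (F := Λ.toBidga) R.augB q t :=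
  HH.push R.isResolution.isBidgaMap q t

/-- This is the change of coefficients for the trivial fibration R → Λ, with the identity of R as
structure map. -/
theorem augHH_bijective (R : Resolution Λ) (q t : ℤ) : Function.Bijective (augHH R q t) := by
  have hR := R.isResolution
  constructor
  · rw [injective_iff_map_eq_zero]
    intro z hz
    obtain ⟨c, hc, rfl⟩ := HH.exists_mk z
    exact HH.mk_eq_zero.2 (mem_coboundaries_of_push hR.isBidga hR.projective hR.isBidga
      (IsBidgaMap.id _) hR.isTrivialFibration hc (HH.mk_eq_zero.1 hz))
  · intro z
    obtain ⟨c, hc, rfl⟩ := HH.exists_mk z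
    obtain ⟨b, hb, rfl⟩ := exists_push_eq hR.isBidga hR.projective hR.isBidga
      (IsBidgaMap.id _) hR.isTrivialFibration (c := c) hc
    exact ⟨HH.mk _ q t b hb, rfl⟩

/-- The map `HH(S, Λ) → HH(R, Λ)` induced by a map of resolutions. -/
def ResolutionMap.restrict {R S : Resolution Λ} (α : ResolutionMap R S) (q t : ℤ) :
    HH (E := S.toBidgaData) (F := Λ.toBidga) S.augB q t →ₗ[k]
      HH (E := R.toBidgaData) (F := Λ.toBidga) R.augB q t :=
  HH.restrict α.isBidgaMap α.comp_augB q t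

/-- Only trivial fibrations are needed, because the comparison of resolutions goes through spans of
them. -/
theorem ResolutionMap.restrict_bijective {R S : Resolution Λ} (α : ResolutionMap R S)
    (hα : IsTrivialFibration (F := R.toBidgaData) (G := S.toBidgaData) α.map) (q t : ℤ) :
    Function.Bijective (α.restrict q t) := by
  have hR := R.isResolution
  have hS := S.isResolution
  have key := α.comp_augB
  constructor
  · rw [injective_iff_map_eq_zero]
    intro z hz
    obtain ⟨c, hc, rfl⟩ := HH.exists_mk z
    have hz' := HH.mk_eq_zero.1 hz
    rw [← key] at hz'
    exact HH.mk_eq_zero.2 (mem_coboundaries_of_pull hR.isBidga hR.projective hS.isBidga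
      hS.projective Λ.isBidga rfl hα hS.isBidgaMap (mem_cocycles_iff.1 hc).1 hz')
  · intro z
    obtain ⟨c, hc, rfl⟩ := HH.exists_mk z
    have hc' := hc
    rw [← key] at hc'
    obtain ⟨b, hb, hbc⟩ := exists_cocycle_pull hR.isBidga hR.projective hS.isBidga
      hS.projective Λ.isBidga rfl hα hS.isBidgaMap hc'
    rw [key] at hbc
    refine ⟨HH.mk _ q t b hb, Eq.symm ?_⟩
    exact HH.mk_eq_mk.2 hbc

theorem ResolutionMap.restrict_restrict {R S T : Resolution Λ} (α : ResolutionMap R S)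
    (β : ResolutionMap S T) {α' : ResolutionMap R T} (h : ∀ x, β.map (α.map x) = α'.map x)
    (q t : ℤ) (z) : α.restrict q t (β.restrict q t z) = α'.restrict q t z := by
  obtain ⟨c, hc, rfl⟩ := HH.exists_mk z
  have h' : pullCochain α.map (pullCochain β.map c) = pullCochain α'.map c := by
    funext r
    refine MultilinearMap.ext fun x => ?_
    exact congrArg (c r) (funext fun l => h (x l))
  refine congrArg (Submodule.Quotient.mk) (Subtype.ext h')

/-- Compatibility along a map of resolutions may be tested after composition with the
augmentations. -/
theorem push_eq_pull_iff {R S : Resolution Λ} (α : ResolutionMap R S) (q t : ℤ)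
    (z : SelfHH R.toBidgaData q t) (w : SelfHH S.toBidgaData q t) :
    HH.push α.isBidgaMap q t z = HH.pull α.isBidgaMap q t w ↔
      augHH R q t z = α.restrict q t (augHH S q t w) := by
  obtain ⟨c, hc, rfl⟩ := HH.exists_mk z
  obtain ⟨b, hb, rfl⟩ := HH.exists_mk w
  have hR := R.isResolution
  have hS := S.isResolution
  have hc' : pushCochain α.map c ∈ cocycles α.map q t := by
    rw [mem_cocycles_iff] at hc ⊢
    refine ⟨push_mem α.isBidgaMap hc.1, ?_⟩
    have h := totD_push LinearMap.id α.isBidgaMap q t c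
    rwa [hc.2, map_zero] at h
  have hb' : pullCochain α.map b ∈ cocycles α.map q t := by
    rw [mem_cocycles_iff] at hb ⊢
    refine ⟨pull_mem α.isBidgaMap hb.1, ?_⟩
    have h := totD_pull α.isBidgaMap LinearMap.id q t b
    rwa [hb.2, map_zero] at h
  have h1 : HH.push α.isBidgaMap q t (HH.mk _ q t c hc) = HH.pull α.isBidgaMap q t
      (HH.mk _ q t b hb) ↔ pushCochain α.map c - pullCochain α.map b ∈ coboundaries α.map q t :=
    HH.mk_eq_mk (hc := hc') (hc' := hb')
  have h2 : augHH R q t (HH.mk _ q t c hc) = α.restrict q t (augHH S q t (HH.mk _ q t b hb)) ↔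
      pushCochain (G := Λ.toBidga) R.augB c - pullCochain α.map (pushCochain S.augB b) ∈
        coboundaries R.augB q t :=
    Submodule.Quotient.eq _
  -- The difference to be tested in HH(R, Λ) is the image of the difference in HH(R, S), and
  -- composition with the augmentation of S is injective on cohomology.
  have h3 : pushCochain (G := Λ.toBidga) R.augB c - pullCochain α.map (pushCochain S.augB b) =
      pushCochain S.augB (pushCochain α.map c - pullCochain α.map b) := by
    rw [map_sub]
    congr 1
    rw [← α.comp_augB]
    rfl
  rw [h1, h2, h3, ← α.comp_augB]
  refine ⟨fun h => ?_, fun h => mem_coboundaries_of_push hR.isBidga hR.projective hS.isBidga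
    α.isBidgaMap hS.isTrivialFibration (Submodule.sub_mem _ hc' hb') h⟩
  obtain ⟨e, he, h⟩ := mem_coboundaries_iff.1 h
  exact mem_coboundaries_iff.2 ⟨pushCochain S.augB e, push_mem hS.isBidgaMap he, by
    rw [totD_push α.map hS.isBidgaMap, h]⟩

end Comparison

/-! ### Free algebras with a differential -/

section FreeAlgebra

variable {k : Type u} [CommRing k]

theorem BigradedModule.projective_piece (E : BigradedModule k) [Module.Projective k E.carrier]
    (st : ℤ × ℤ) : Module.Projective k (E.piece st) :=
  Module.Projective.of_split (E.piece st).subtype (E.proj st)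
    (LinearMap.ext fun x => E.proj_of_mem x.2)

/-- A bigraded algebra with a horizontal differential, where the submodules of homogeneous elements
need not be linearly independent and need not span. -/
structure Labels (k : Type u) [CommRing k] where
  carrier : Type u
  [addCommGroup : AddCommGroup carrier]
  [module : Module k carrier]
  piece : ℤ × ℤ → Submodule k carrier
  mul : carrier →ₗ[k] carrier →ₗ[k] carrier
  one : carrier
  d : carrier →ₗ[k] carrier
  one_mem : one ∈ piece 0
  mul_mem : ∀ st st' x y, x ∈ piece st → y ∈ piece st' → mul x y ∈ piece (st + st')
  d_mem : ∀ s t x, x ∈ piece (s, t) → d x ∈ piece (s - 1, t)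
  mul_assoc : ∀ x y z, mul (mul x y) z = mul x (mul y z)
  one_mul : ∀ x, mul one x = x
  mul_one : ∀ x, mul x one = x
  d_d : ∀ x, d (d x) = 0
  leibniz : ∀ s t x y, x ∈ piece (s, t) →
    d (mul x y) = mul (d x) y + (s.negOnePow : ℤ) • mul x (d y)

attribute [instance] Labels.addCommGroup Labels.module

theorem Labels.d_one (T : Labels k) : T.d T.one = 0 := by
  have h := T.leibniz 0 0 T.one T.one T.one_mem
  rw [T.one_mul, T.one_mul, T.mul_one] at h
  simpa using h

/-- The free algebra on a set. -/
abbrev FA (k : Type u) [CommRing k] (X : Type u) : Type u := AddMonoidAlgebra k (FreeAddMonoid X)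

/-! ### Words and the grading of the free algebra. -/

section Words

variable {X Y : Type u} {N : Type u} [AddCommGroup N] [Module k N]

/-- A word, as an element of the free algebra. -/
def wd (l : List X) : FA k X := AddMonoidAlgebra.single (FreeAddMonoid.ofList l) 1

theorem wd_nil : (wd [] : FA k X) = 1 := rfl

theorem wd_append (l l' : List X) : (wd (l ++ l') : FA k X) = wd l * wd l' := by
  rw [wd, wd, wd, AddMonoidAlgebra.single_mul_single, _root_.one_mul, FreeAddMonoid.ofList_append]

theorem wd_cons (x : X) (l : List X) : (wd (x :: l) : FA k X) = wd [x] * wd l :=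
  wd_append [x] l

/-- The linear map with given values on words. -/
def wordLift (f : List X → N) : FA k X →ₗ[k] N :=
  (AddMonoidAlgebra.basis (FreeAddMonoid X) k).constr k fun w => f w.toList

@[simp] theorem wordLift_wd (f : List X → N) (l : List X) : wordLift f (wd l : FA k X) = f l :=
  (AddMonoidAlgebra.basis (FreeAddMonoid X) k).constr_basis k _ _

theorem word_ext {f g : FA k X →ₗ[k] N} (h : ∀ l, f (wd l) = g (wd l)) : f = g :=
  (AddMonoidAlgebra.basis (FreeAddMonoid X) k).ext fun w => h w.toList

theorem word_ext₂ {f g : FA k X →ₗ[k] FA k X →ₗ[k] N}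
    (h : ∀ l l', f (wd l) (wd l') = g (wd l) (wd l')) : f = g :=
  word_ext fun l => word_ext fun l' => h l l'

theorem eq_sum_wd (a : FA k X) :
    a = ∑ w ∈ a.coeff.support, a.coeff w • wd w.toList := by
  have h := (AddMonoidAlgebra.basis (FreeAddMonoid X) k).linearCombination_repr a
  rw [Finsupp.linearCombination_apply, Finsupp.sum] at h
  exact h.symm

/-- The bidegree of a word. -/
def wdeg (deg : X → ℤ × ℤ) : FreeAddMonoid X →+ ℤ × ℤ := FreeAddMonoid.lift deg

theorem wdeg_nil (deg : X → ℤ × ℤ) : wdeg deg (FreeAddMonoid.ofList []) = 0 := map_zero _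

theorem wdeg_cons (deg : X → ℤ × ℤ) (x : X) (l : List X) :
    wdeg deg (FreeAddMonoid.ofList (x :: l)) = deg x + wdeg deg (FreeAddMonoid.ofList l) := by
  rw [FreeAddMonoid.ofList_cons, map_add]
  rfl

/-- The elements of a given bidegree. -/
def grade (deg : X → ℤ × ℤ) (st : ℤ × ℤ) : Submodule k (FA k X) :=
  AddMonoidAlgebra.gradeBy k (wdeg deg) st

theorem wd_mem_grade (deg : X → ℤ × ℤ) (l : List X) :
    (wd l : FA k X) ∈ grade deg (wdeg deg (FreeAddMonoid.ofList l)) :=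
  AddMonoidAlgebra.single_mem_gradeBy _ _ _

/-- A homogeneous part is spanned by the words of that degree, so inclusions and linear identities
on it can be verified on words. -/
theorem grade_le {deg : X → ℤ × ℤ} {st : ℤ × ℤ} {M : Submodule k (FA k X)}
    (h : ∀ l, wdeg deg (FreeAddMonoid.ofList l) = st → wd l ∈ M) : grade deg st ≤ M := by
  intro a ha
  rw [eq_sum_wd a]
  refine Submodule.sum_mem _ fun w hw => Submodule.smul_mem _ _ (h _ ?_)
  exact (AddMonoidAlgebra.mem_gradeBy_iff _ _ _ a).1 ha (Finset.mem_coe.2 hw)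

theorem mul_mem_grade {deg : X → ℤ × ℤ} {st st' : ℤ × ℤ} {a b : FA k X} (ha : a ∈ grade deg st)
    (hb : b ∈ grade deg st') : a * b ∈ grade deg (st + st') :=
  SetLike.GradedMul.mul_mem (A := AddMonoidAlgebra.gradeBy k (wdeg deg)) ha hb

/-- The algebra map induced by a map of the generators, as a linear map. -/
def faMap (j : X → Y) : FA k X →ₗ[k] FA k Y :=
  AddMonoidAlgebra.mapDomainLinearMap k k (FreeAddMonoid.map j)

@[simp] theorem faMap_wd (j : X → Y) (l : List X) : faMap j (wd l : FA k X) = wd (l.map j) :=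
  AddMonoidAlgebra.mapDomainLinearMap_single _ _ _

theorem faMap_mul (j : X → Y) (a b : FA k X) : faMap j (a * b) = faMap j a * faMap j b := by
  have h : (LinearMap.mul k (FA k X)).compr₂ (faMap j) =
      (LinearMap.mul k (FA k Y)).compl₁₂ (faMap j) (faMap j) :=
    word_ext₂ fun l l' => by
      simp only [LinearMap.compr₂_apply, LinearMap.mul_apply', LinearMap.compl₁₂_apply,
        ← wd_append, faMap_wd, List.map_append]
  exact LinearMap.congr_fun₂ h a b

theorem faMap_injective {j : X → Y} (hj : Function.Injective j) :
    Function.Injective (faMap j : FA k X →ₗ[k] FA k Y) :=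
  AddMonoidAlgebra.mapDomain_injective (List.map_injective_iff.2 hj)

theorem faMap_mem_grade {j : X → Y} {deg : X → ℤ × ℤ} {deg' : Y → ℤ × ℤ}
    (h : ∀ x, deg' (j x) = deg x) {st : ℤ × ℤ} {a : FA k X} (ha : a ∈ grade deg st) :
    faMap j a ∈ grade deg' st := by
  refine (grade_le (M := (grade deg' st).comap (faMap j)) fun l hl => ?_) ha
  rw [Submodule.mem_comap, faMap_wd]
  have h1 : wdeg deg' (FreeAddMonoid.ofList (l.map j)) = wdeg deg (FreeAddMonoid.ofList l) := by
    clear hl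
    induction l with
    | nil => rfl
    | cons x l ih => rw [List.map_cons, wdeg_cons, wdeg_cons, ih, h]
  rw [← hl, ← h1]
  exact wd_mem_grade _ _

end Words

variable {T T' : Labels k}

/-- Generators of a free algebra with bidegrees, differentials and labels. -/
structure FreeData (T : Labels k) where
  X : Type u
  deg : X → ℤ × ℤ
  bd : X → FA k X
  lab : X → T.carrier

namespace FreeData

variable (D : FreeData T) (D' : FreeData T')

/-- The differential of a word. -/
def dWord : List D.X → FA k D.X
  | [] => 0
  | x :: l => D.bd x * wd l + ((D.deg x).1.negOnePow : ℤ) • (wd [x] * dWord l)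

/-- The differential. -/
def d : FA k D.X →ₗ[k] FA k D.X := wordLift D.dWord

/-- The label of a word. -/
def labWord : List D.X → T.carrier
  | [] => T.one
  | x :: l => T.mul (D.lab x) (labWord l)

/-- The multiplicative extension of the labels. -/
def eps : FA k D.X →ₗ[k] T.carrier := wordLift D.labWord

@[simp] theorem eps_one : D.eps 1 = T.one := wordLift_wd _ []

theorem eps_wd_cons (x : D.X) (l : List D.X) :
    D.eps (wd (x :: l)) = T.mul (D.lab x) (D.eps (wd l)) := by
  simp [eps, labWord]

theorem d_wd_cons (x : D.X) (l : List D.X) : D.d (wd (x :: l)) =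
    D.bd x * wd l + ((D.deg x).1.negOnePow : ℤ) • (wd [x] * D.d (wd l)) := by
  simp [d, dWord]

@[simp] theorem d_one : D.d 1 = 0 := wordLift_wd _ []

theorem d_wd_singleton (x : D.X) : D.d (wd [x]) = D.bd x := by
  rw [d_wd_cons, wd_nil, d_one, mul_zero, smul_zero, add_zero, _root_.mul_one]

theorem eps_wd_singleton (x : D.X) : D.eps (wd [x]) = D.lab x := by
  rw [eps_wd_cons, wd_nil, eps_one, T.mul_one]

theorem eps_mul (a b : FA k D.X) : D.eps (a * b) = T.mul (D.eps a) (D.eps b) := by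
  have h : (LinearMap.mul k (FA k D.X)).compr₂ D.eps = T.mul.compl₁₂ D.eps D.eps :=
    word_ext₂ fun l l' => by
      simp only [LinearMap.compr₂_apply, LinearMap.mul_apply', LinearMap.compl₁₂_apply,
        ← wd_append]
      induction l with
      | nil => rw [wd_nil, eps_one, T.one_mul, List.nil_append]
      | cons x l ih => rw [List.cons_append, eps_wd_cons, ih, eps_wd_cons, T.mul_assoc]
  exact LinearMap.congr_fun₂ h a b

theorem d_wd_mul (l : List D.X) (b : FA k D.X) : D.d (wd l * b) = D.d (wd l) * b +
    ((wdeg D.deg (FreeAddMonoid.ofList l)).1.negOnePow : ℤ) • (wd l * D.d b) := by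
  have h : D.d ∘ₗ LinearMap.mulLeft k (wd l) = LinearMap.mulLeft k (D.d (wd l)) +
      ((wdeg D.deg (FreeAddMonoid.ofList l)).1.negOnePow : ℤ) •
        (LinearMap.mulLeft k (wd l) ∘ₗ D.d) :=
    word_ext fun l' => by
      simp only [LinearMap.comp_apply, LinearMap.mulLeft_apply, LinearMap.add_apply,
        LinearMap.smul_apply]
      induction l with
      | nil => simp [wd_nil]
      | cons x l ih =>
        rw [← wd_append, List.cons_append, d_wd_cons, wd_append, ih, d_wd_cons, wdeg_cons,
          Prod.fst_add, negOnePow_add_zsmul, wd_cons x l]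
        simp only [mul_add, add_mul, smul_add, mul_smul_comm, smul_mul_assoc, _root_.mul_assoc,
          add_assoc]
  exact LinearMap.congr_fun h b

theorem leibniz {s t : ℤ} {a : FA k D.X} (ha : a ∈ grade D.deg (s, t)) (b : FA k D.X) :
    D.d (a * b) = D.d a * b + (s.negOnePow : ℤ) • (a * D.d b) := by
  let f : FA k D.X →ₗ[k] FA k D.X := D.d ∘ₗ LinearMap.mulRight k b -
    (LinearMap.mulRight k b ∘ₗ D.d + (s.negOnePow : ℤ) • LinearMap.mulRight k (D.d b))
  have h : a ∈ LinearMap.ker f := by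
    refine (grade_le fun l hl => ?_) ha
    rw [LinearMap.mem_ker]
    simp only [f, LinearMap.sub_apply, LinearMap.comp_apply, LinearMap.mulRight_apply,
      LinearMap.add_apply, LinearMap.smul_apply, d_wd_mul, hl, sub_self]
  rw [LinearMap.mem_ker] at h
  exact sub_eq_zero.1 h

/-- The conditions under which the free algebra is a bidga over the labels. -/
structure Good : Prop where
  deg_nonneg : ∀ x, 0 ≤ (D.deg x).1
  bd_mem : ∀ x, D.bd x ∈ grade D.deg (D.deg x - (1, 0))
  d_bd : ∀ x, D.d (D.bd x) = 0
  eps_bd : ∀ x, D.eps (D.bd x) = T.d (D.lab x)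
  lab_mem : ∀ x, D.lab x ∈ T.piece (D.deg x)

variable {D}

theorem Good.wdeg_nonneg (h : D.Good) (l : List D.X) :
    0 ≤ (wdeg D.deg (FreeAddMonoid.ofList l)).1 := by
  induction l with
  | nil => simp
  | cons x l ih =>
    rw [wdeg_cons, Prod.fst_add]
    exact add_nonneg (h.deg_nonneg x) ih

theorem Good.d_mem (h : D.Good) {s t : ℤ} {a : FA k D.X} (ha : a ∈ grade D.deg (s, t)) :
    D.d a ∈ grade D.deg (s - 1, t) := by
  refine (grade_le (M := (grade D.deg (s - 1, t)).comap D.d) fun l hl => ?_) ha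
  have key : D.d (wd l) ∈ grade D.deg (wdeg D.deg (FreeAddMonoid.ofList l) - (1, 0)) := by
    clear hl
    induction l with
    | nil => rw [wd_nil, d_one]; exact Submodule.zero_mem _
    | cons x l ih =>
      rw [d_wd_cons, wdeg_cons]
      refine Submodule.add_mem _ ?_ (Submodule.smul_of_tower_mem _ _ ?_)
      · have h1 := mul_mem_grade (h.bd_mem x) (wd_mem_grade D.deg l)
        rwa [sub_add_eq_add_sub] at h1
      · have h1 := mul_mem_grade (wd_mem_grade D.deg [x]) ih
        rw [wdeg_cons, wdeg_nil, add_zero] at h1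
        rwa [add_sub_assoc]
  rw [hl] at key
  simpa using key

theorem Good.eps_mem (h : D.Good) {st : ℤ × ℤ} {a : FA k D.X} (ha : a ∈ grade D.deg st) :
    D.eps a ∈ T.piece st := by
  refine (grade_le (M := (T.piece st).comap D.eps) fun l hl => ?_) ha
  rw [Submodule.mem_comap, ← hl]
  clear hl
  induction l with
  | nil => rw [wd_nil, eps_one, wdeg_nil]; exact T.one_mem
  | cons x l ih =>
    rw [eps_wd_cons, wdeg_cons]
    exact T.mul_mem _ _ _ _ (h.lab_mem x) ih

/-- By the Leibniz rule this reduces to generators. The mixed terms cancel because a generator and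
its boundary differ by one in horizontal degree. -/
theorem Good.d_d (h : D.Good) (a : FA k D.X) : D.d (D.d a) = 0 := by
  have key : D.d ∘ₗ D.d = 0 := word_ext fun l => by
    rw [LinearMap.comp_apply, LinearMap.zero_apply]
    induction l with
    | nil => simp [wd_nil]
    | cons x l ih =>
      have hx : (wd [x] : FA k D.X) ∈ grade D.deg ((D.deg x).1, (D.deg x).2) := by
        have h1 := wd_mem_grade (k := k) D.deg [x]
        rwa [wdeg_cons, wdeg_nil, add_zero] at h1
      have hb : D.bd x ∈ grade D.deg ((D.deg x).1 - 1, (D.deg x).2) := by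
        have h1 := h.bd_mem x
        rwa [show D.deg x - (1, 0) = ((D.deg x).1 - 1, (D.deg x).2) by ext <;> simp] at h1
      rw [d_wd_cons, map_add, map_zsmul, D.leibniz hb, D.leibniz hx, ih, h.d_bd, d_wd_singleton,
        Int.negOnePow_sub]
      simp
  exact LinearMap.congr_fun key a

theorem Good.eps_d (h : D.Good) (a : FA k D.X) : D.eps (D.d a) = T.d (D.eps a) := by
  have key : D.eps ∘ₗ D.d = T.d ∘ₗ D.eps := word_ext fun l => by
    rw [LinearMap.comp_apply, LinearMap.comp_apply]
    induction l with
    | nil => simp [wd_nil, T.d_one]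
    | cons x l ih =>
      rw [d_wd_cons, eps_wd_cons, T.leibniz (D.deg x).1 (D.deg x).2 _ _ (h.lab_mem x), map_add,
        map_zsmul, eps_mul, eps_mul, ih, h.eps_bd, eps_wd_singleton]
  exact LinearMap.congr_fun key a

/-- The free bidga. -/
def Good.toBidga (h : D.Good) : BidgaData k where
  carrier := FA k D.X
  piece := grade D.deg
  isInternal := AddMonoidAlgebra.gradeBy.isInternal (wdeg D.deg)
  piece_neg s t hs := by
    rw [eq_bot_iff]
    refine grade_le fun l hl => ?_
    have h1 := h.wdeg_nonneg l
    rw [hl] at h1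
    exact absurd h1 (not_le.2 hs)
  mul := LinearMap.mul k (FA k D.X)
  one := (1 : FA k D.X)
  d := D.d

theorem Good.isBidga (h : D.Good) : h.toBidga.IsBidga where
  mul_mem _ _ _ _ hx hy := mul_mem_grade hx hy
  one_mem := by
    have h1 := wd_mem_grade (k := k) D.deg []
    rwa [wdeg_nil] at h1
  d_mem _ _ _ hx := h.d_mem hx
  mul_assoc x y z := _root_.mul_assoc (G := FA k D.X) x y z
  one_mul x := _root_.one_mul (M := FA k D.X) x
  mul_one x := _root_.mul_one (M := FA k D.X) x
  d_d := h.d_d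
  leibniz _ _ _ y hx := D.leibniz hx y

theorem Good.projective (h : D.Good) (st : ℤ × ℤ) : Module.Projective k (h.toBidga.piece st) := by
  have : Module.Projective k h.toBidga.carrier :=
    inferInstanceAs (Module.Projective k (FA k D.X))
  exact BigradedModule.projective_piece _ st

variable {D'}

theorem faMap_d {j : D.X → D'.X} (hdeg : ∀ x, D'.deg (j x) = D.deg x)
    (hbd : ∀ x, faMap j (D.bd x) = D'.bd (j x)) (a : FA k D.X) :
    faMap j (D.d a) = D'.d (faMap j a) := by
  have key : (faMap j) ∘ₗ D.d = D'.d ∘ₗ (faMap j) := word_ext fun l => by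
    rw [LinearMap.comp_apply, LinearMap.comp_apply]
    induction l with
    | nil => rw [wd_nil, d_one, map_zero, ← wd_nil, faMap_wd, List.map_nil, wd_nil, d_one]
    | cons x l ih =>
      rw [faMap_wd] at ih
      rw [d_wd_cons, map_add, map_zsmul, faMap_mul, faMap_mul, ih, faMap_wd, faMap_wd, faMap_wd,
        hbd, List.map_cons (l := l), d_wd_cons, hdeg]
      rfl
  exact LinearMap.congr_fun key a

theorem faMap_eps {j : D.X → D'.X} (η : T.carrier →ₗ[k] T'.carrier)
    (hone : η T.one = T'.one) (hmul : ∀ x y, η (T.mul x y) = T'.mul (η x) (η y))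
    (hlab : ∀ x, D'.lab (j x) = η (D.lab x)) (a : FA k D.X) :
    D'.eps (faMap j a) = η (D.eps a) := by
  have key : D'.eps ∘ₗ (faMap j) = η ∘ₗ D.eps := word_ext fun l => by
    rw [LinearMap.comp_apply, LinearMap.comp_apply, faMap_wd]
    induction l with
    | nil => rw [List.map_nil, wd_nil, wd_nil, eps_one, eps_one, hone]
    | cons x l ih => rw [List.map_cons, eps_wd_cons, eps_wd_cons, ih, hmul, hlab]
  exact LinearMap.congr_fun key a

end FreeData

end FreeAlgebra

/-! ### The universal free resolution over a bigraded algebra with differential -/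

section Universal

variable {k : Type u} [CommRing k]

/-- Generators: a bidegree, a boundary (a linear combination of words in generators) and a
label. -/
inductive Gen (k Y : Type u) : Type u
  -- The boundary is stored as n coefficients and n words in earlier generators. The inductive type
  -- thus contains all stages of the process of attaching generators along cycles at once.
  | mk (s : ℕ) (t : ℤ) (n : ℕ) (coef : Fin n → k) (len : Fin n → ℕ)
      (word : (i : Fin n) → Fin (len i) → Gen k Y) (y : Y) : Gen k Y

namespace Gen

variable {Y Y' : Type u}

/-- The bidegree of a generator. -/
def deg : Gen k Y → ℤ × ℤ
  | mk s t _ _ _ _ _ => (s, t)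

/-- The label of a generator. -/
def lab : Gen k Y → Y
  | mk _ _ _ _ _ _ y => y

/-- The boundary of a generator. -/
def bd : Gen k Y → FA k (Gen k Y)
  | mk _ _ _ coef _ word _ => ∑ i, coef i • wd (List.ofFn (word i))

/-- Change of labels. -/
def relabel (h : Y → Y') : Gen k Y → Gen k Y'
  | mk s t n coef len word y => mk s t n coef len (fun i c => relabel h (word i c)) (h y)

theorem deg_relabel (h : Y → Y') (g : Gen k Y) : (g.relabel h).deg = g.deg := by
  cases g; rfl

theorem lab_relabel (h : Y → Y') (g : Gen k Y) : (g.relabel h).lab = h g.lab := by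
  cases g; rfl

theorem bd_relabel (h : Y → Y') (g : Gen k Y) : (g.relabel h).bd = faMap (relabel h) g.bd := by
  cases g with
  | mk s t n coef len word y =>
    simp only [relabel, bd, map_sum, map_smul, faMap_wd, List.map_ofFn]
    rfl

end Gen

variable (T : Labels k)

/-- The free algebra on all generators. -/
abbrev allGen : FreeData T where
  X := Gen k T.carrier
  deg := Gen.deg
  bd := Gen.bd
  lab := Gen.lab

/-- The generators whose boundary is a homogeneous cycle compatible with the label. -/
inductive Gen.Valid : Gen k T.carrier → Prop
  | mk (s : ℕ) (t : ℤ) (n : ℕ) (coef : Fin n → k) (len : Fin n → ℕ)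
      (word : (i : Fin n) → Fin (len i) → Gen k T.carrier) (y : T.carrier)
      (hword : ∀ i c, Valid (word i c))
      (hdeg : ∀ i, wdeg Gen.deg (FreeAddMonoid.ofList (List.ofFn (word i))) = ((s : ℤ) - 1, t))
      (hd : (allGen T).d (Gen.bd (.mk s t n coef len word y)) = 0)
      (heps : (allGen T).eps (Gen.bd (.mk s t n coef len word y)) = T.d y)
      (hy : y ∈ T.piece (s, t)) : Valid (.mk s t n coef len word y)

variable {T}

theorem Gen.Valid.word {s : ℕ} {t : ℤ} {n : ℕ} {coef : Fin n → k} {len : Fin n → ℕ}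
    {word : (i : Fin n) → Fin (len i) → Gen k T.carrier} {y : T.carrier}
    (h : Valid T (.mk s t n coef len word y)) (i : Fin n) (c : Fin (len i)) :
    Valid T (word i c) := by
  cases h; solve_by_elim

theorem Gen.Valid.wdeg {s : ℕ} {t : ℤ} {n : ℕ} {coef : Fin n → k} {len : Fin n → ℕ}
    {word : (i : Fin n) → Fin (len i) → Gen k T.carrier} {y : T.carrier}
    (h : Valid T (.mk s t n coef len word y)) (i : Fin n) :
    wdeg Gen.deg (FreeAddMonoid.ofList (List.ofFn (word i))) = ((s : ℤ) - 1, t) := by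
  cases h; solve_by_elim

theorem Gen.Valid.d_bd {g : Gen k T.carrier} (h : Valid T g) : (allGen T).d g.bd = 0 := by
  cases h; assumption

theorem Gen.Valid.eps_bd {g : Gen k T.carrier} (h : Valid T g) :
    (allGen T).eps g.bd = T.d g.lab := by
  cases h; assumption

theorem Gen.Valid.lab_mem {g : Gen k T.carrier} (h : Valid T g) : g.lab ∈ T.piece g.deg := by
  cases h; assumption

variable (T)

/-- The valid generators. -/
abbrev VGen : Type u := {g : Gen k T.carrier // g.Valid T}

/-- The boundary of a valid generator. -/
def VGen.bd : VGen T → FA k (VGen T)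
  | ⟨.mk _ _ _ coef _ word _, h⟩ => ∑ i, coef i • wd (List.ofFn fun c => ⟨word i c, h.word i c⟩)

/-- The free algebra on the valid generators. -/
abbrev validGen : FreeData T where
  X := VGen T
  deg g := g.1.deg
  bd := VGen.bd T
  lab g := g.1.lab

variable {T}

/-- Validity refers to the algebra on all generators, as it must be stated before the valid ones
form a type. The inclusion of valid words is injective and respects boundaries and labels, which
carries the conditions over. -/
theorem faMap_bd (g : VGen T) : faMap Subtype.val (VGen.bd T g) = g.1.bd := by
  obtain ⟨⟨s, t, n, coef, len, word, y⟩, h⟩ := g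
  simp only [VGen.bd, Gen.bd, map_sum, map_smul, faMap_wd, List.map_ofFn]
  rfl

theorem faMap_val_d (a : FA k (VGen T)) : faMap Subtype.val ((validGen T).d a) =
    (allGen T).d (faMap Subtype.val a) :=
  FreeData.faMap_d (D := validGen T) (D' := allGen T) (fun _ => rfl) faMap_bd a

theorem faMap_val_eps (a : FA k (VGen T)) : (allGen T).eps (faMap Subtype.val a) =
    (validGen T).eps a :=
  FreeData.faMap_eps (D := validGen T) (D' := allGen T) LinearMap.id rfl (fun _ _ => rfl)
    (fun _ => rfl) a

theorem wdeg_map {X Y : Type u} {j : X → Y} {deg : X → ℤ × ℤ} {deg' : Y → ℤ × ℤ}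
    (h : ∀ x, deg' (j x) = deg x) (l : List X) :
    wdeg deg' (FreeAddMonoid.ofList (l.map j)) = wdeg deg (FreeAddMonoid.ofList l) := by
  induction l with
  | nil => rfl
  | cons x l ih => rw [List.map_cons, wdeg_cons, wdeg_cons, ih, h]

theorem validGen_good (T : Labels k) : (validGen T).Good where
  deg_nonneg := by
    rintro ⟨⟨s, t, n, coef, len, word, y⟩, h⟩
    exact Int.natCast_nonneg s
  bd_mem := by
    rintro ⟨⟨s, t, n, coef, len, word, y⟩, h⟩
    refine Submodule.sum_mem (grade (validGen T).deg _) fun i _ => Submodule.smul_mem _ _ ?_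
    have h1 := h.wdeg i
    have h2 := wdeg_map (j := Subtype.val) (deg := (validGen T).deg) (deg' := Gen.deg)
      (fun _ => rfl) (List.ofFn fun c => (⟨word i c, h.word i c⟩ : VGen T))
    rw [List.map_ofFn] at h2
    have h3 := wd_mem_grade (k := k) (validGen T).deg
      (List.ofFn fun c => (⟨word i c, h.word i c⟩ : VGen T))
    rw [← h2] at h3
    have h4 : ((s : ℤ) - 1, t) = Gen.deg (.mk s t n coef len word y) - (1, 0) := by
      simp [Gen.deg]
    rw [h4] at h1
    rw [← h1]
    exact h3
  d_bd g := by
    refine faMap_injective (j := Subtype.val) Subtype.val_injective ?_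
    rw [faMap_val_d, map_zero]
    exact (congrArg (allGen T).d (faMap_bd g)).trans g.2.d_bd
  eps_bd g := by
    rw [← faMap_val_eps]
    exact (congrArg (allGen T).eps (faMap_bd g)).trans g.2.eps_bd
  lab_mem g := g.2.lab_mem

/-- Every cycle bounds a generator, with any compatible label. -/
theorem exists_generator {s : ℕ} {t : ℤ} {w : FA k (VGen T)}
    (hw : w ∈ grade (validGen T).deg ((s : ℤ) - 1, t)) (hdw : (validGen T).d w = 0)
    {y : T.carrier} (hy : y ∈ T.piece (s, t)) (hwy : (validGen T).eps w = T.d y) :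
    ∃ x ∈ grade (validGen T).deg ((s : ℤ), t), (validGen T).d x = w ∧ (validGen T).eps x = y := by
  have hw' := (AddMonoidAlgebra.mem_gradeBy_iff _ _ _ w).1 hw
  -- The new generator records `w` itself as its boundary: an enumeration of the support gives
  -- coefficients and words.
  let e := w.coeff.support.equivFin.symm
  let coef : Fin w.coeff.support.card → k := fun i => w.coeff (e i).1
  let word : (i : Fin w.coeff.support.card) → Fin ((e i).1.toList.length) → Gen k T.carrier :=
    fun i c => ((e i).1.toList.get c).1
  let g : Gen k T.carrier := .mk s t _ coef (fun i => (e i).1.toList.length) word y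
  have hofFn : ∀ i, List.ofFn (word i) = (e i).1.toList.map Subtype.val := fun i => by
    conv_rhs => rw [← List.ofFn_get (e i).1.toList, List.map_ofFn]
    rfl
  have hsum : w = ∑ i, coef i • wd (e i).1.toList := by
    conv_lhs => rw [eq_sum_wd w, ← Finset.sum_coe_sort]
    exact (Equiv.sum_comp e fun m => w.coeff m.1 • (wd m.1.toList : FA k (VGen T))).symm
  have hbd : g.bd = faMap Subtype.val w := by
    conv_rhs => rw [hsum]
    simp only [map_sum, map_smul, faMap_wd, ← hofFn]
    rfl
  have hg : g.Valid T := by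
    refine Gen.Valid.mk s t _ coef _ word y (fun i c => ((e i).1.toList.get c).2) (fun i => ?_)
      ?_ ?_ hy
    · rw [hofFn, wdeg_map (j := Subtype.val) (deg := (validGen T).deg) (fun _ => rfl)]
      exact hw' (e i).2
    · exact (congrArg (allGen T).d hbd).trans (by rw [← faMap_val_d, hdw, map_zero])
    · exact (congrArg (allGen T).eps hbd).trans (by rw [faMap_val_eps, hwy])
  refine ⟨wd [⟨g, hg⟩], ?_, ?_, ?_⟩
  · have h1 := wd_mem_grade (k := k) (validGen T).deg [⟨g, hg⟩]
    rw [wdeg_cons, wdeg_nil, add_zero] at h1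
    exact h1
  · refine faMap_injective (j := Subtype.val) Subtype.val_injective ?_
    rw [FreeData.d_wd_singleton]
    exact (faMap_bd _).trans hbd
  · exact FreeData.eps_wd_singleton _ _

/-- The universal free bidga over `T`. -/
def freeBidga (T : Labels k) : BidgaData k := (validGen_good T).toBidga

/-- The multiplicative extension of the labels. -/
def freeEps (T : Labels k) : (freeBidga T).carrier →ₗ[k] T.carrier := (validGen T).eps

theorem freeEps_mem {st : ℤ × ℤ} {x} (hx : x ∈ (freeBidga T).piece st) :
    freeEps T x ∈ T.piece st := (validGen_good T).eps_mem hx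

theorem freeEps_d (x) : freeEps T ((freeBidga T).d x) = T.d (freeEps T x) :=
  (validGen_good T).eps_d x

theorem freeEps_mul (x y) : freeEps T ((freeBidga T).mul x y) =
    T.mul (freeEps T x) (freeEps T y) := (validGen T).eps_mul x y

theorem freeEps_one : freeEps T (freeBidga T).one = T.one := (validGen T).eps_one

/-- In degree 0 a generator with boundary 0 and label `y` suffices. In higher degrees a cycle with
label `T.d y` is created first, and `y` is then the label of a generator bounding it. -/
theorem freeEps_surj (hT : ∀ s t, s < 0 → T.piece (s, t) = ⊥) {st : ℤ × ℤ} {y : T.carrier}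
    (hy : y ∈ T.piece st) : ∃ x ∈ (freeBidga T).piece st, freeEps T x = y := by
  obtain ⟨s, t⟩ := st
  rcases lt_or_ge s 0 with hs | hs
  · rw [hT s t hs, Submodule.mem_bot] at hy
    exact ⟨0, Submodule.zero_mem _, by rw [map_zero, hy]⟩
  obtain ⟨s, rfl⟩ := Int.eq_ofNat_of_zero_le hs
  cases s with
  | zero =>
    have hdy : T.d y = 0 := by
      have h := T.d_mem _ _ _ hy
      rw [hT _ _ (by simp)] at h
      exact h
    obtain ⟨x, hx, -, hxy⟩ := exists_generator (s := 0) (w := 0) (Submodule.zero_mem _)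
      (map_zero _) hy (by rw [map_zero, hdy])
    exact ⟨x, hx, hxy⟩
  | succ s =>
    have hdy := T.d_mem _ _ _ hy
    have h1 : (((s + 1 : ℕ) : ℤ) - 1, t) = ((s : ℤ), t) := by simp
    obtain ⟨z, hz, hdz, hzy⟩ := exists_generator (s := s) (w := 0) (y := T.d y)
      (Submodule.zero_mem _) (map_zero _) (by rwa [h1] at hdy) (by rw [map_zero, T.d_d])
    obtain ⟨x, hx, -, hxy⟩ := exists_generator (s := s + 1) (by rwa [h1]) hdz hy hzy
    exact ⟨x, hx, hxy⟩

/-- A generator is attached along the cycle, with a label that can be prescribed; this freedom is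
what makes both projections of the fibre product exact. For s < 0 the chosen element is 0, so `y`
must vanish; this excludes nonzero labels in degree 0. -/
theorem freeEps_exact {s t : ℤ} {x} (hx : x ∈ (freeBidga T).piece (s, t))
    (hdx : (freeBidga T).d x = 0) {y : T.carrier} (hy : y ∈ T.piece (s + 1, t))
    (hxy : freeEps T x = T.d y) (h0 : s < 0 → y = 0) :
    ∃ x' ∈ (freeBidga T).piece (s + 1, t), freeEps T x' = y ∧ (freeBidga T).d x' = x := by
  rcases lt_or_ge s 0 with hs | hs
  · rw [(freeBidga T).piece_neg s t hs, Submodule.mem_bot] at hx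
    exact ⟨0, Submodule.zero_mem _, by rw [map_zero, h0 hs], by rw [map_zero, hx]⟩
  obtain ⟨s, rfl⟩ := Int.eq_ofNat_of_zero_le hs
  obtain ⟨x', h1, h2, h3⟩ := exists_generator (s := s + 1) (t := t) (w := x) (y := y)
    (by rw [Nat.cast_succ, add_sub_cancel_right]; exact hx) hdx (by rwa [Nat.cast_succ]) hxy
  rw [Nat.cast_succ] at h1
  exact ⟨x', h1, h3, h2⟩

/-! ### Functoriality -/

/-- Maps of labels. -/
structure Labels.IsHom {T T' : Labels k} (η : T.carrier →ₗ[k] T'.carrier) : Prop where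
  map_mem : ∀ st x, x ∈ T.piece st → η x ∈ T'.piece st
  map_one : η T.one = T'.one
  map_mul : ∀ x y, η (T.mul x y) = T'.mul (η x) (η y)
  map_d : ∀ x, η (T.d x) = T'.d (η x)

variable {T' : Labels k} {η : T.carrier →ₗ[k] T'.carrier}

/-- The boundary words stay the same up to labels, so the conditions are transported by naturality
of the differential and of the labelling. Functoriality is strict because no choices were made. -/
theorem Gen.Valid.relabel (hη : Labels.IsHom η) {g : Gen k T.carrier} (hg : g.Valid T) :
    (g.relabel η).Valid T' := by
  induction hg with
  | mk s t n coef len word y hword hdeg hd heps hy ih =>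
    have hbd := Gen.bd_relabel η (.mk s t n coef len word y : Gen k T.carrier)
    have hofFn : ∀ i, List.ofFn (fun c => (word i c).relabel η) =
        (List.ofFn (word i)).map (Gen.relabel η) := fun i => by
      rw [List.map_ofFn]; rfl
    refine Gen.Valid.mk s t n coef len _ _ ih (fun i => ?_) ?_ ?_ (hη.map_mem _ _ hy)
    · rw [hofFn, wdeg_map (Gen.deg_relabel η), hdeg]
    · refine (congrArg (allGen T').d hbd).trans ?_
      have h := FreeData.faMap_d (D := allGen T) (D' := allGen T') (j := Gen.relabel η)
        (Gen.deg_relabel η) (fun g => (Gen.bd_relabel η g).symm)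
        (Gen.bd (.mk s t n coef len word y))
      rw [hd, map_zero] at h
      exact h.symm
    · refine (congrArg (allGen T').eps hbd).trans ?_
      have h := FreeData.faMap_eps (D := allGen T) (D' := allGen T') (j := Gen.relabel η) η
        hη.map_one hη.map_mul (Gen.lab_relabel η) (Gen.bd (.mk s t n coef len word y))
      rw [heps, hη.map_d] at h
      exact h

/-- The map of generators induced by a map of labels. -/
def VGen.map (hη : Labels.IsHom η) (g : VGen T) : VGen T' := ⟨g.1.relabel η, g.2.relabel hη⟩

/-- The map of universal free bidgas induced by a map of labels. -/
def freeMap (hη : Labels.IsHom η) : (freeBidga T).carrier →ₗ[k] (freeBidga T').carrier :=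
  faMap (VGen.map hη)

theorem bd_map (hη : Labels.IsHom η) (g : VGen T) :
    faMap (VGen.map hη) (VGen.bd T g) = VGen.bd T' (VGen.map hη g) := by
  obtain ⟨⟨s, t, n, coef, len, word, y⟩, h⟩ := g
  have h1 : VGen.bd T' (VGen.map hη ⟨.mk s t n coef len word y, h⟩) =
    ∑ i, coef i • wd (List.ofFn fun c => VGen.map hη ⟨word i c, h.word i c⟩) := rfl
  rw [h1]
  simp only [VGen.bd, map_sum, map_smul, faMap_wd, List.map_ofFn]
  rfl

theorem freeMap_isBidgaMap (hη : Labels.IsHom η) :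
    IsBidgaMap (freeBidga T) (freeBidga T') (freeMap hη) where
  map_mem _ _ hx := faMap_mem_grade (deg := (validGen T).deg) (deg' := (validGen T').deg)
    (fun g => Gen.deg_relabel η g.1) hx
  map_mul x y := faMap_mul _ x y
  map_one := faMap_wd _ []
  map_d x := FreeData.faMap_d (D := validGen T) (D' := validGen T')
    (fun g => Gen.deg_relabel η g.1) (bd_map hη) x

theorem freeEps_freeMap (hη : Labels.IsHom η) (x) : freeEps T' (freeMap hη x) =
    η (freeEps T x) :=
  FreeData.faMap_eps (D := validGen T) (D' := validGen T') η hη.map_one hη.map_mul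
    (fun g => Gen.lab_relabel η g.1) x

end Universal

/-! ### The resolution over two resolutions -/

section Span

variable {k : Type u} [CommRing k]

theorem BigradedModule.mem_of_proj_mem {E : BigradedModule k} {M : Submodule k E.carrier}
    {x : E.carrier} (h : ∀ st, (E.proj st x : E.carrier) ∈ M) : x ∈ M := by
  classical
  let e := LinearEquiv.ofBijective (DirectSum.coeLinearMap E.piece) E.isInternal
  have h1 : x = DirectSum.coeLinearMap E.piece (e.symm x) := (e.apply_symm_apply x).symm
  rw [h1, DirectSum.coeLinearMap_eq_dfinsuppSum]
  exact Submodule.dfinsuppSum_mem _ _ _ fun st _ => h st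

/-- Trivial fibrations are acyclic on total modules. -/
theorem IsTrivialFibration.exists_d_eq {F G : BidgaData k} {α : F.carrier →ₗ[k] G.carrier}
    (hα : IsTrivialFibration α) (hF : F.IsBidga) {x : F.carrier} (hx : α x = 0)
    (hdx : F.d x = 0) : ∃ y, α y = 0 ∧ F.d y = x := by
  suffices h : x ∈ (LinearMap.ker α).map F.d by
    obtain ⟨y, hy, hyx⟩ := h
    exact ⟨y, hy, hyx⟩
  refine F.mem_of_proj_mem fun st => ?_
  have h1 : α (F.proj st x) = 0 := by
    have h := BigradedModule.map_proj (E := F.toBigradedModule) (F := G.toBigradedModule) α 0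
      (fun st x hx => by rw [sub_zero]; exact hα.map_mem st x hx) st x
    rw [h, hx, map_zero, ZeroMemClass.coe_zero]
  have h2 : F.d (F.proj st x) = 0 := by
    have h := BigradedModule.map_proj (E := F.toBigradedModule) (F := F.toBigradedModule) F.d
      (1, 0) (fun st x hx => by
        have h := hF.d_mem st.1 st.2 x hx
        rwa [show (st.1 - 1, st.2) = st - (1, 0) by ext <;> simp] at h) st x
    rw [h, hdx, map_zero, ZeroMemClass.coe_zero]
  obtain ⟨y, -, hy, hyx⟩ := hα.exact st.1 st.2 _ (F.proj st x).2 h1 h2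
  exact ⟨y, hy, hyx⟩

variable {Λ : GradedAlg k}

/-- The fibre product of two resolutions. -/
def fibreProduct (S R : Resolution Λ) : Labels k where
  carrier := S.carrier × R.carrier
  -- The carrier is the full product; only the pieces impose equality in Λ. This is why `Labels`
  -- does not ask its pieces to decompose the carrier.
  piece st := ((S.piece st).prod (R.piece st)) ⊓
    LinearMap.ker (S.aug ∘ₗ LinearMap.fst k _ _ - R.aug ∘ₗ LinearMap.snd k _ _)
  mul := LinearMap.mk₂ k (fun x y => (S.mul x.1 y.1, R.mul x.2 y.2)) (by simp) (by simp) (by simp)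
    (by simp)
  one := (S.one, R.one)
  d := S.d.prodMap R.d
  one_mem := ⟨⟨S.isResolution.isBidga.one_mem, R.isResolution.isBidga.one_mem⟩, by
    simp [S.isResolution.aug_one, R.isResolution.aug_one]⟩
  mul_mem := by
    rintro st st' x y ⟨⟨h1, h2⟩, h3⟩ ⟨⟨h1', h2'⟩, h3'⟩
    refine ⟨⟨?_, ?_⟩, ?_⟩
    · simpa using S.isResolution.isBidga.mul_mem _ _ _ _ h1 h1'
    · simpa using R.isResolution.isBidga.mul_mem _ _ _ _ h2 h2'
    · simp [sub_eq_zero] at h3 h3'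
      simp [S.isResolution.aug_mul, R.isResolution.aug_mul, h3, h3']
  d_mem := by
    rintro s t x ⟨⟨h1, h2⟩, h3⟩
    exact ⟨⟨S.isResolution.isBidga.d_mem _ _ _ h1, R.isResolution.isBidga.d_mem _ _ _ h2⟩, by
      simp [S.isResolution.aug_d, R.isResolution.aug_d]⟩
  mul_assoc x y z := by
    simp [S.isResolution.isBidga.mul_assoc, R.isResolution.isBidga.mul_assoc]
  one_mul x := by simp [S.isResolution.isBidga.one_mul, R.isResolution.isBidga.one_mul]
  mul_one x := by simp [S.isResolution.isBidga.mul_one, R.isResolution.isBidga.mul_one]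
  d_d x := by simp [S.isResolution.isBidga.d_d, R.isResolution.isBidga.d_d]
  leibniz := by
    rintro s t x y ⟨⟨h1, h2⟩, h3⟩
    have h4 := S.isResolution.isBidga.leibniz s t x.1 y.1 h1
    have h5 := R.isResolution.isBidga.leibniz s t x.2 y.2 h2
    refine Prod.ext ?_ ?_
    · simpa using h4
    · simpa using h5

theorem mem_fibreProduct {S R : Resolution Λ} {st : ℤ × ℤ} {x : S.carrier × R.carrier} :
    x ∈ (fibreProduct S R).piece st ↔
      x.1 ∈ S.piece st ∧ x.2 ∈ R.piece st ∧ S.aug x.1 = R.aug x.2 := by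
  change ((x.1 ∈ S.piece st ∧ x.2 ∈ R.piece st) ∧ S.aug x.1 - R.aug x.2 = 0) ↔ _
  rw [sub_eq_zero, and_assoc]

theorem fibreProduct_neg (S R : Resolution Λ) (s t : ℤ) (hs : s < 0) :
    (fibreProduct S R).piece (s, t) = ⊥ := by
  refine (Submodule.eq_bot_iff _).2 fun x hx => ?_
  obtain ⟨h1, h2, -⟩ := mem_fibreProduct.1 hx
  rw [S.piece_neg s t hs, Submodule.mem_bot] at h1
  rw [R.piece_neg s t hs, Submodule.mem_bot] at h2
  exact Prod.ext h1 h2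

variable (S R : Resolution Λ)

/-- The first projection. -/
def spanFst : (freeBidga (fibreProduct S R)).carrier →ₗ[k] S.carrier :=
  LinearMap.fst k S.carrier R.carrier ∘ₗ freeEps (fibreProduct S R)

/-- The second projection. -/
def spanSnd : (freeBidga (fibreProduct S R)).carrier →ₗ[k] R.carrier :=
  LinearMap.snd k S.carrier R.carrier ∘ₗ freeEps (fibreProduct S R)

theorem aug_spanFst (x) : S.aug (spanFst S R x) = R.aug (spanSnd S R x) := by
  induction x using BigradedModule.induction with
  | h0 => simp
  | hom st x hx => exact (mem_fibreProduct.1 (freeEps_mem hx)).2.2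
  | add x y hx hy => rw [map_add, map_add, map_add, map_add, hx, hy]

/-- Surjectivity: an element of S is completed to the fibre product by a lift of its augmentation to
R. Exactness: if the first label of a cycle is 0, its second label is a cycle in the kernel of R →
Λ, hence bounds some `y` there, and (0, y) is an admissible label for a generator bounding the
cycle. -/
theorem spanFst_isTrivialFibration : IsTrivialFibration (F := freeBidga (fibreProduct S R))
    (G := S.toBidgaData) (spanFst S R) where
  map_mem st x hx := (mem_fibreProduct.1 (freeEps_mem hx)).1
  map_mul x y := congrArg Prod.fst (freeEps_mul x y)
  map_one := congrArg Prod.fst (freeEps_one (T := fibreProduct S R))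
  map_d x := congrArg Prod.fst (freeEps_d x)
  surj st y hy := by
    obtain ⟨z, hz, hyz⟩ := R.isResolution.isTrivialFibration.surj st (S.aug y)
      (S.isResolution.isBidgaMap.map_mem _ _ hy)
    obtain ⟨x, hx, hxy⟩ := freeEps_surj (fibreProduct_neg S R)
      (y := ((y, z) : S.carrier × R.carrier)) (mem_fibreProduct.2 ⟨hy, hz, hyz.symm⟩)
    exact ⟨x, hx, congrArg Prod.fst hxy⟩
  exact s t x hx hx0 hdx := by
    obtain ⟨-, h2, h3⟩ := mem_fibreProduct.1 (freeEps_mem hx)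
    have h4 := freeEps_d (T := fibreProduct S R) x
    rw [hdx, map_zero] at h4
    have hx0' : (freeEps (fibreProduct S R) x).1 = 0 := hx0
    rw [hx0', map_zero] at h3
    obtain ⟨y, hy, hy0, hyx⟩ := R.isResolution.isTrivialFibration.exact s t _ h2 h3.symm
      (congrArg Prod.snd h4).symm
    rcases lt_or_ge s 0 with hs | hs
    · rw [BigradedModule.piece_neg _ s t hs, Submodule.mem_bot] at hx
      exact ⟨0, Submodule.zero_mem _, map_zero _, by rw [map_zero, hx]⟩
    obtain ⟨x', h5, h6, h7⟩ := freeEps_exact hx hdx (y := ((0, y) : S.carrier × R.carrier))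
      (mem_fibreProduct.2 ⟨Submodule.zero_mem _, hy, by rw [map_zero]; exact hy0.symm⟩)
      (Prod.ext (hx0'.trans (map_zero S.d).symm) hyx.symm) (fun h => absurd hs (not_le.2 h))
    exact ⟨x', h5, congrArg Prod.fst h6, h7⟩

theorem spanSnd_isTrivialFibration : IsTrivialFibration (F := freeBidga (fibreProduct S R))
    (G := R.toBidgaData) (spanSnd S R) where
  map_mem st x hx := (mem_fibreProduct.1 (freeEps_mem hx)).2.1
  map_mul x y := congrArg Prod.snd (freeEps_mul x y)
  map_one := congrArg Prod.snd (freeEps_one (T := fibreProduct S R))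
  map_d x := congrArg Prod.snd (freeEps_d x)
  surj st y hy := by
    obtain ⟨z, hz, hyz⟩ := S.isResolution.isTrivialFibration.surj st (R.aug y)
      (R.isResolution.isBidgaMap.map_mem _ _ hy)
    obtain ⟨x, hx, hxy⟩ := freeEps_surj (fibreProduct_neg S R)
      (y := ((z, y) : S.carrier × R.carrier)) (mem_fibreProduct.2 ⟨hz, hy, hyz⟩)
    exact ⟨x, hx, congrArg Prod.snd hxy⟩
  exact s t x hx hx0 hdx := by
    obtain ⟨h2, -, h3⟩ := mem_fibreProduct.1 (freeEps_mem hx)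
    have h4 := freeEps_d (T := fibreProduct S R) x
    rw [hdx, map_zero] at h4
    have hx0' : (freeEps (fibreProduct S R) x).2 = 0 := hx0
    rw [hx0', map_zero] at h3
    obtain ⟨y, hy, hy0, hyx⟩ := S.isResolution.isTrivialFibration.exact s t _ h2 h3
      (congrArg Prod.fst h4).symm
    rcases lt_or_ge s 0 with hs | hs
    · rw [BigradedModule.piece_neg _ s t hs, Submodule.mem_bot] at hx
      exact ⟨0, Submodule.zero_mem _, map_zero _, by rw [map_zero, hx]⟩
    obtain ⟨x', h5, h6, h7⟩ := freeEps_exact hx hdx (y := ((y, 0) : S.carrier × R.carrier))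
      (mem_fibreProduct.2 ⟨hy, Submodule.zero_mem _, by rw [map_zero]; exact hy0⟩)
      (Prod.ext hyx.symm (hx0'.trans (map_zero R.d).symm)) (fun h => absurd hs (not_le.2 h))
    exact ⟨x', h5, congrArg Prod.snd h6, h7⟩

/-- A resolution which maps to two given ones. -/
def span : Resolution Λ where
  toBidgaData := freeBidga (fibreProduct S R)
  aug := S.aug ∘ₗ spanFst S R
  isResolution := by
    have hp := spanFst_isTrivialFibration S R
    have hS := S.isResolution
    have hP := (validGen_good (fibreProduct S R)).isBidga
    refine ⟨hP, (validGen_good (fibreProduct S R)).projective,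
      fun t x hx => hS.aug_mem t _ (hp.map_mem _ _ hx),
      fun s t x hs hx => hS.aug_zero s t _ hs (hp.map_mem _ _ hx), fun x y => ?_, ?_, fun x => ?_, ?_⟩
    · exact (congrArg S.aug (hp.map_mul x y)).trans (hS.aug_mul _ _)
    · exact (congrArg S.aug hp.map_one).trans hS.aug_one
    · exact (congrArg S.aug (hp.map_d x)).trans (hS.aug_d _)
    -- The composite of a trivial fibration with an equivalence is an equivalence: primitives and
    -- cycles in S are lifted and corrected by elements of the acyclic kernel.
    · obtain ⟨-, h2, h3⟩ := inducesIterIso_zero_iff.1 hS.isE2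
      refine inducesIterIso_zero_iff.2 ⟨fun x => Or.inl ?_, fun x hdx hx => ?_, fun y => ?_⟩
      · exact (congrArg S.aug (hp.map_d x)).trans (hS.aug_d _)
      · obtain ⟨y, hy⟩ := h2 (spanFst S R x)
          ((hp.map_d x).symm.trans ((congrArg (spanFst S R) hdx).trans (map_zero _))) hx
        obtain ⟨y, rfl⟩ := hp.surjective y
        obtain ⟨z, -, hz⟩ := hp.exists_d_eq hP
          (x := x - (freeBidga (fibreProduct S R)).d y)
          (by rw [map_sub, hp.map_d]; exact sub_eq_zero.2 hy.symm)
          (by rw [map_sub]; exact sub_eq_zero.2 (hdx.trans (hP.d_d y).symm))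
        exact ⟨z + y, by rw [map_add]; exact (congrArg (· + _) hz).trans (sub_add_cancel _ _)⟩
      · obtain ⟨s, hds, hs⟩ := h3 y
        obtain ⟨x, rfl⟩ := hp.surjective s
        obtain ⟨z, hz0, hz⟩ := hp.exists_d_eq hP (x := (freeBidga (fibreProduct S R)).d x)
          (by rw [hp.map_d]; exact hds) (hP.d_d x)
        refine ⟨x - z, by rw [map_sub]; exact sub_eq_zero.2 hz.symm, ?_⟩
        rw [LinearMap.comp_apply, map_sub, hz0, sub_zero]
        exact hs

/-- The map to the first resolution. -/
def span.fst : ResolutionMap (span S R) S where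
  map := spanFst S R
  isBidgaMap := (spanFst_isTrivialFibration S R).toIsBidgaMap
  aug_map _ := rfl

/-- The map to the second resolution. -/
def span.snd : ResolutionMap (span S R) R where
  map := spanSnd S R
  isBidgaMap := (spanSnd_isTrivialFibration S R).toIsBidgaMap
  aug_map x := (aug_spanFst S R x).symm

variable {S} {S' : Resolution Λ} (α : ResolutionMap S S')

theorem fibreProduct_isHom : Labels.IsHom (T := fibreProduct S R) (T' := fibreProduct S' R)
    (α.map.prodMap LinearMap.id) where
  map_mem st x hx := by
    obtain ⟨h1, h2, h3⟩ := mem_fibreProduct.1 hx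
    exact mem_fibreProduct.2 ⟨α.isBidgaMap.map_mem _ _ h1, h2, (α.aug_map _).trans h3⟩
  map_one := Prod.ext α.isBidgaMap.map_one rfl
  map_mul x y := by
    have h := α.isBidgaMap.map_mul x.1 y.1
    exact Prod.ext h rfl
  map_d x := Prod.ext (α.isBidgaMap.map_d x.1) rfl

/-- The span is functorial in its first argument. -/
def span.map : ResolutionMap (span S R) (span S' R) where
  map := freeMap (fibreProduct_isHom R α)
  isBidgaMap := freeMap_isBidgaMap _
  aug_map x := by
    have h := congrArg Prod.fst (freeEps_freeMap (fibreProduct_isHom R α) x)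
    exact (congrArg S'.aug h).trans (α.aug_map _)

theorem span.fst_map (x) : (span.fst S' R).map ((span.map R α).map x) =
    α.map ((span.fst S R).map x) :=
  congrArg Prod.fst (freeEps_freeMap (fibreProduct_isHom R α) x)

theorem span.snd_map (x) : (span.snd S' R).map ((span.map R α).map x) = (span.snd S R).map x :=
  congrArg Prod.snd (freeEps_freeMap (fibreProduct_isHom R α) x)

end Span

/-! ### Derived Hochschild cohomology is computed by every resolution -/

section Derived

variable {k : Type u} [CommRing k] {Λ : GradedAlg k} {q t : ℤ}

theorem restrict_fst_bijective (S R : Resolution Λ) :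
    Function.Bijective ((span.fst S R).restrict q t) :=
  (span.fst S R).restrict_bijective (spanFst_isTrivialFibration S R) q t

theorem restrict_snd_bijective (S R : Resolution Λ) :
    Function.Bijective ((span.snd S R).restrict q t) :=
  (span.snd S R).restrict_bijective (spanSnd_isTrivialFibration S R) q t

/-- The components of an element of derived Hochschild cohomology agree after restriction. -/
theorem dHochschild.restrict_augHH (z : dHochschild Λ q t) {R S : Resolution Λ}
    (α : ResolutionMap R S) :
    augHH R q t (z.1 R) = α.restrict q t (augHH S q t (z.1 S)) :=
  (push_eq_pull_iff α q t _ _).1 (z.2 R S α)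

/-- The components at S and R agree over their span, so each determines the other: both restrictions
to the span are bijective. -/
theorem dHochschild.fst_eq_snd (z : dHochschild Λ q t) (S R : Resolution Λ) :
    (span.fst S R).restrict q t (augHH S q t (z.1 S)) =
      (span.snd S R).restrict q t (augHH R q t (z.1 R)) :=
  (restrict_augHH z (span.fst S R)).symm.trans (restrict_augHH z (span.snd S R))

theorem dHochschild.eval_injective (R : Resolution Λ) :
    Function.Injective (dHochschild.eval R q t) := by
  intro z z' hz
  have hz' : z.1 R = z'.1 R := hz
  refine Subtype.ext (funext fun S => (augHH_bijective S q t).1 ((restrict_fst_bijective S R).1 ?_))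
  rw [fst_eq_snd z S R, fst_eq_snd z' S R, hz']

/-- The component at S is defined by transport along S ← span → R, and compatibility along a map of
resolutions comes from functoriality of the span in its first argument. -/
theorem dHochschild.eval_surjective (R : Resolution Λ) :
    Function.Surjective (dHochschild.eval R q t) := by
  intro w
  -- The transported class is `v` rather than the image of `w`: the two projections of `span R R`
  -- have not been shown to induce the same map, and `v` is chosen so that the transport to S = R
  -- returns `w`.
  obtain ⟨v, hv⟩ := (restrict_snd_bijective R R).2
    ((span.fst R R).restrict q t (augHH R q t w))
  choose ζ hζ using fun S => (restrict_fst_bijective S R).2 ((span.snd S R).restrict q t v)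
  choose z hz using fun S => (augHH_bijective S q t).2 (ζ S)
  refine ⟨⟨z, fun S S' α => ?_⟩, ?_⟩
  · rw [push_eq_pull_iff, hz, hz]
    refine (restrict_fst_bijective S R).1 ?_
    -- Both sides are the restriction along the single map from `span S R` to S'.
    have h1 : (span.map R α).restrict q t ((span.fst S' R).restrict q t (ζ S')) =
        (span.fst S R).restrict q t (α.restrict q t (ζ S')) := by
      rw [(span.fst S R).restrict_restrict α
          (α' := ⟨α.map ∘ₗ (span.fst S R).map, ⟨fun st x hx => α.isBidgaMap.map_mem _ _
            ((span.fst S R).isBidgaMap.map_mem _ _ hx), fun x y => by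
              simp [(span.fst S R).isBidgaMap.map_mul, α.isBidgaMap.map_mul], by
              simp [(span.fst S R).isBidgaMap.map_one, α.isBidgaMap.map_one], fun x => by
              simp [(span.fst S R).isBidgaMap.map_d, α.isBidgaMap.map_d]⟩,
            fun x => (α.aug_map _).trans ((span.fst S R).aug_map x)⟩) (fun _ => rfl)]
      exact (span.map R α).restrict_restrict (span.fst S' R) (fun x => span.fst_map R α x) q t _
    rw [← h1, hζ, hζ]
    exact ((span.map R α).restrict_restrict (span.snd S' R) (fun x => span.snd_map R α x)
      q t v).symm
  · refine (augHH_bijective R q t).1 ?_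
    change augHH R q t (z R) = _
    rw [hz]
    refine (restrict_fst_bijective R R).1 ?_
    rw [hζ, hv]

theorem dHochschild.eval_bijective (R : Resolution Λ) :
    Function.Bijective (dHochschild.eval R q t) :=
  ⟨dHochschild.eval_injective R, dHochschild.eval_surjective R⟩

end Derived

/-! ### Hochschild differentials with few arguments -/

section FewArguments

variable {k : Type u} [CommRing k]

theorem vec_one {V : Type u} (x : Fin 1 → V) : x = ![x 0] := by
  ext l; fin_cases l; rfl

theorem vec_two {V : Type u} (x : Fin 2 → V) : x = ![x 0, x 1] := by
  ext l; fin_cases l <;> rfl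

theorem vec_three {V : Type u} (x : Fin 3 → V) : x = ![x 0, x 1, x 2] := by
  ext l; fin_cases l <;> rfl

theorem vec_four {V : Type u} (x : Fin 4 → V) : x = ![x 0, x 1, x 2, x 3] := by
  ext l; fin_cases l <;> rfl

section Apply

variable {E F : BidgaData k} (φ : E.carrier →ₗ[k] F.carrier) (s t : ℤ)

theorem homDiff_one (c : Mult k E.carrier F.carrier 1) (x : E.carrier) :
    homDiff s c ![x] = F.d (c ![x]) - (s.negOnePow : ℤ) • c ![E.d x] := by
  rw [homDiff, Fin.sum_univ_one]
  exact congrArg (fun y => F.d (c ![x]) - (s.negOnePow : ℤ) • c y) (vec_one _)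

theorem homDiff_two (c : Mult k E.carrier F.carrier 2) (x y : E.carrier) :
    homDiff s c ![x, y] = F.d (c ![x, y]) -
      (s.negOnePow : ℤ) • (c ![E.d x, y] + c ![E.sgn 1 0 x, E.d y]) := by
  rw [homDiff, Fin.sum_univ_two]
  refine congrArg (fun z : F.carrier => F.d (c ![x, y]) - (s.negOnePow : ℤ) • z) (congrArg₂ _ ?_ ?_)
  · exact congrArg c (vec_two _)
  · exact congrArg c (vec_two _)

theorem homDiff_three (c : Mult k E.carrier F.carrier 3) (x y z : E.carrier) :
    homDiff s c ![x, y, z] = F.d (c ![x, y, z]) - (s.negOnePow : ℤ) • (c ![E.d x, y, z] +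
      c ![E.sgn 1 0 x, E.d y, z] + c ![E.sgn 1 0 x, E.sgn 1 0 y, E.d z]) := by
  rw [homDiff, Fin.sum_univ_three]
  refine congrArg (fun w : F.carrier => F.d (c ![x, y, z]) - (s.negOnePow : ℤ) • w) ?_
  refine congrArg₂ _ (congrArg₂ _ ?_ ?_) ?_
  · exact congrArg c (vec_three _)
  · exact congrArg c (vec_three _)
  · exact congrArg c (vec_three _)

theorem hochDiff_one (c : Mult k E.carrier F.carrier 1) (x y : E.carrier) :
    hochDiff φ s t c ![x, y] = F.mul (φ (E.sgn s t x)) (c ![y]) + F.mul (c ![x]) (φ y) -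
      c ![E.mul x y] := by
  have h0 : Fin.tail ![x, y] = ![y] := vec_one _
  have h1 : Fin.init ![x, y] = ![x] := vec_one _
  have h2 : Fin.contractNth (Fin.castSucc 0) (fun a b => E.mul a b) ![x, y] = ![E.mul x y] :=
    vec_one _
  rw [hochDiff, Fin.sum_univ_one, h0, h1, h2]
  simp [sub_eq_add_neg]

theorem hochDiff_two (c : Mult k E.carrier F.carrier 2) (x y z : E.carrier) :
    hochDiff φ s t c ![x, y, z] = F.mul (φ (E.sgn s t x)) (c ![y, z]) -
      F.mul (c ![x, y]) (φ z) - c ![E.mul x y, z] + c ![x, E.mul y z] := by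
  have h0 : Fin.tail ![x, y, z] = ![y, z] := vec_two _
  have h1 : Fin.init ![x, y, z] = ![x, y] := vec_two _
  have h2 : Fin.contractNth (Fin.castSucc 0) (fun a b => E.mul a b) ![x, y, z] =
    ![E.mul x y, z] := vec_two _
  have h3 : Fin.contractNth (Fin.castSucc 1) (fun a b => E.mul a b) ![x, y, z] =
    ![x, E.mul y z] := vec_two _
  rw [hochDiff, Fin.sum_univ_two, h0, h1, h2, h3]
  simp
  abel

theorem hochDiff_three (c : Mult k E.carrier F.carrier 3) (x y z w : E.carrier) :
    hochDiff φ s t c ![x, y, z, w] = F.mul (φ (E.sgn s t x)) (c ![y, z, w]) +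
      F.mul (c ![x, y, z]) (φ w) - c ![E.mul x y, z, w] + c ![x, E.mul y z, w] -
        c ![x, y, E.mul z w] := by
  have h0 : Fin.tail ![x, y, z, w] = ![y, z, w] := vec_three _
  have h1 : Fin.init ![x, y, z, w] = ![x, y, z] := vec_three _
  have h2 : Fin.contractNth (Fin.castSucc 0) (fun a b => E.mul a b) ![x, y, z, w] =
    ![E.mul x y, z, w] := vec_three _
  have h3 : Fin.contractNth (Fin.castSucc 1) (fun a b => E.mul a b) ![x, y, z, w] =
    ![x, E.mul y z, w] := vec_three _
  have h4 : Fin.contractNth (Fin.castSucc 2) (fun a b => E.mul a b) ![x, y, z, w] =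
    ![x, y, E.mul z w] := vec_three _
  rw [hochDiff, Fin.sum_univ_three, h0, h1, h2, h3, h4]
  simp
  abel

theorem homDiff_zero_cochain {r : ℕ} (x : Fin r → E.carrier) :
    homDiff s (0 : Mult k E.carrier F.carrier r) x = 0 := by
  simp [homDiff]

theorem hochDiff_zero_cochain {r : ℕ} (x : Fin (r + 1) → E.carrier) :
    hochDiff φ s t (0 : Mult k E.carrier F.carrier r) x = 0 := by
  simp [hochDiff]

end Apply

/-! ### Bilinear maps as multilinear maps with two arguments. -/

section Bilinear

variable {V W : Type u} [AddCommGroup V] [Module k V] [AddCommGroup W] [Module k W]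

/-- A multilinear map with two arguments as a bilinear map. -/
def bil (m : Mult k V W 2) : V →ₗ[k] V →ₗ[k] W :=
  (MultilinearMap.ofSubsingletonₗ k k V W (0 : Fin 1)).symm.toLinearMap ∘ₗ cur m

@[simp] theorem bil_apply (m : Mult k V W 2) (x y : V) : bil m x y = m ![x, y] :=
  congrArg m (by ext l; fin_cases l <;> rfl)

/-- A bilinear map as a multilinear map with two arguments. -/
def ofBil (b : V →ₗ[k] V →ₗ[k] W) : Mult k V W 2 :=
  unc ((MultilinearMap.ofSubsingletonₗ k k V W (0 : Fin 1)).toLinearMap ∘ₗ b)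

@[simp] theorem ofBil_apply (b : V →ₗ[k] V →ₗ[k] W) (x : Fin 2 → V) :
    ofBil b x = b (x 0) (x 1) := by
  rw [apply_eq_cur, ofBil, cur_unc]
  rfl

end Bilinear

end FewArguments

/-! ### Representing cycles -/

section Representatives

variable {k : Type u} [CommRing k] {A : DGA k}

/-- The cycle `z` represents the homology class `h`. -/
def DGA.IsRep (A : DGA k) (z : A.carrier) (h : A.homology.toBidga.carrier) : Prop :=
  ∃ hz : A.d z = 0, A.cls ⟨z, hz⟩ = h

namespace DGA.IsRep

variable {z z' : A.carrier} {h h' : A.homology.toBidga.carrier}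

theorem add (H : A.IsRep z h) (H' : A.IsRep z' h') : A.IsRep (z + z') (h + h') := by
  obtain ⟨hz, rfl⟩ := H
  obtain ⟨hz', rfl⟩ := H'
  exact ⟨by rw [map_add, hz, hz', add_zero], map_add A.cls ⟨z, hz⟩ ⟨z', hz'⟩⟩

theorem neg (H : A.IsRep z h) : A.IsRep (-z) (-h) := by
  obtain ⟨hz, rfl⟩ := H
  exact ⟨by rw [map_neg, hz, neg_zero], map_neg A.cls ⟨z, hz⟩⟩

theorem sub (H : A.IsRep z h) (H' : A.IsRep z' h') : A.IsRep (z - z') (h - h') := by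
  rw [sub_eq_add_neg, sub_eq_add_neg]
  exact H.add H'.neg

theorem smul (c : k) (H : A.IsRep z h) : A.IsRep (c • z) (c • h) := by
  obtain ⟨hz, rfl⟩ := H
  exact ⟨by rw [map_smul, hz, smul_zero], map_smul A.cls c ⟨z, hz⟩⟩

theorem mul (H : A.IsRep z h) (H' : A.IsRep z' h') :
    A.IsRep (z * z') (A.homology.toBidga.mul h h') := by
  obtain ⟨hz, rfl⟩ := H
  obtain ⟨hz', rfl⟩ := H'
  exact ⟨by rw [A.d_mul_of_cycle _ _ hz', hz, zero_mul], map_mul A.cls ⟨z, hz⟩ ⟨z', hz'⟩⟩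

theorem unique (H : A.IsRep z h) (H' : A.IsRep z h') : h = h' := by
  obtain ⟨hz, rfl⟩ := H
  obtain ⟨hz', rfl⟩ := H'
  rfl

theorem of_d (w : A.carrier) : A.IsRep (A.d w) 0 :=
  ⟨A.d_d w, Ideal.Quotient.eq_zero_iff_mem.2 ⟨w, rfl⟩⟩

theorem add_d (H : A.IsRep z h) (w : A.carrier) : A.IsRep (z + A.d w) h := by
  simpa using H.add (of_d w)

theorem exists_d (H : A.IsRep z 0) : ∃ w, A.d w = z := by
  obtain ⟨hz, h⟩ := H
  exact A.mem_boundaries.1 (Ideal.Quotient.eq_zero_iff_mem.1 h)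

theorem mem (H : A.IsRep z h) {st : ℤ × ℤ} (hz : z ∈ A.toBigradedModule.piece st) :
    h ∈ A.homology.toBidga.piece st := by
  obtain ⟨hz', rfl⟩ := H
  obtain ⟨s, t⟩ := st
  rcases A.eq_zero_or_of_mem hz with h0 | ⟨h0, h1⟩
  · have h2 : (⟨z, hz'⟩ : A.cycles) = 0 := Subtype.ext h0
    rw [h2]
    exact (map_zero A.cls).symm ▸ Submodule.zero_mem _
  · obtain rfl : s = 0 := h0
    exact GradedAlg.mem_piece.2 ⟨⟨z, hz'⟩, h1, rfl⟩

end DGA.IsRep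

variable {V : Type u} [AddCommGroup V] [Module k V]

theorem DGA.exists_rep (b : V →ₗ[k] A.carrier) (hb : ∀ x, A.d (b x) = 0) :
    ∃ B : V →ₗ[k] A.homology.toBidga.carrier, ∀ x, A.IsRep (b x) (B x) :=
  ⟨A.cls.toLinearMap ∘ₗ b.codRestrict (Subalgebra.toSubmodule A.cycles) hb, fun x => ⟨hb x, rfl⟩⟩

/-- Linearity of the classes in the first argument follows from `DGA.IsRep.unique`, as a cycle has
only one class. -/
theorem DGA.exists_rep₂ (b : V →ₗ[k] V →ₗ[k] A.carrier) (hb : ∀ x y, A.d (b x y) = 0) :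
    ∃ B : V →ₗ[k] V →ₗ[k] A.homology.toBidga.carrier, ∀ x y, A.IsRep (b x y) (B x y) := by
  choose B hB using fun x => A.exists_rep (b x) (hb x)
  refine ⟨{ toFun := B, map_add' := fun x y => ?_, map_smul' := fun c x => ?_ }, hB⟩
  · refine LinearMap.ext fun z => (hB (x + y) z).unique ?_
    rw [map_add]
    exact (hB x z).add (hB y z)
  · refine LinearMap.ext fun z => (hB (c • x) z).unique ?_
    rw [map_smul]
    exact (hB x z).smul c

end Representatives

/-! ### Maps to a dga which are multiplicative up to homotopy, and their obstruction -/

section Obstruction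

variable {k : Type u} [CommRing k]

theorem BigradedModule.sgn_zero_neg_one (E : BigradedModule k) (x : E.carrier) :
    E.sgn 0 (-1) x = E.sgn 0 1 x := by
  induction x using E.induction with
  | h0 => simp
  | hom st x hx =>
    rw [E.sgn_of_mem _ _ hx, E.sgn_of_mem _ _ hx]
    simp [Int.negOnePow_neg]
  | add x y hx hy => rw [map_add, map_add, hx, hy]

theorem BigradedModule.sgn_one_neg_one (E : BigradedModule k) (x : E.carrier) :
    E.sgn 1 (-1) x = E.sgn 1 0 (E.sgn 0 1 x) := by
  rw [← E.sgn_zero_neg_one, ← E.sgn_add, add_zero, zero_add]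

/-- A map of complexes from a bidga to a dga, where `P` has the zero differential, which respects
the products up to the homotopy `a` and the horizontal differentials up to the homotopy `e`. -/
structure HomotopyMap (P : BidgaData k) (A : DGA k) where
  f : P.carrier →ₗ[k] A.carrier
  a : P.carrier →ₗ[k] P.carrier →ₗ[k] A.carrier
  e : P.carrier →ₗ[k] A.carrier
  f_mem : ∀ s t x, x ∈ P.piece (s, t) → f x ∈ A.toBigradedModule.piece (s, t)
  a_mem : ∀ s t s' t' x y, x ∈ P.piece (s, t) → y ∈ P.piece (s', t') →
    a x y ∈ A.toBigradedModule.piece (s + s', t + t' + 1)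
  e_mem : ∀ s t x, x ∈ P.piece (s, t) → e x ∈ A.toBigradedModule.piece (s - 1, t + 1)
  d_f : ∀ x, A.d (f x) = 0
  d_a : ∀ x y, A.d (a x y) = f (P.mul x y) - f x * f y
  d_e : ∀ x, A.d (e x) = f (P.d x)

namespace HomotopyMap

variable {P Q : BidgaData k} {A : DGA k}

/-- The restriction along a map of bidgas. -/
def comp (h : HomotopyMap P A) {π : Q.carrier →ₗ[k] P.carrier} (hπ : IsBidgaMap Q P π) :
    HomotopyMap Q A where
  f := h.f ∘ₗ π
  a := h.a.compl₁₂ π π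
  e := h.e ∘ₗ π
  f_mem s t x hx := h.f_mem s t _ (hπ.map_mem _ _ hx)
  a_mem s t s' t' x y hx hy := h.a_mem s t s' t' _ _ (hπ.map_mem _ _ hx) (hπ.map_mem _ _ hy)
  e_mem s t x hx := h.e_mem s t _ (hπ.map_mem _ _ hx)
  d_f x := h.d_f _
  d_a x y := by
    simp only [LinearMap.compl₁₂_apply, LinearMap.comp_apply, h.d_a, hπ.map_mul]
  d_e x := by simp only [LinearMap.comp_apply, h.d_e, hπ.map_d]

/-- The cochain `c` is the class of the cocycle which the homotopies of `h` define. -/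
structure IsObstruction (h : HomotopyMap P A) (c : Cochain P A.homology.toBidga) : Prop where
  zero : c 0 = 0
  one : ∀ x, A.IsRep (h.e (P.d x)) (c 1 ![x])
  two : ∀ x y, A.IsRep (-h.a (P.d x) y - h.a (P.sgn 1 0 x) (P.d y) + h.e (P.mul x y) -
    h.f (P.sgn 1 0 (P.sgn 0 1 x)) * h.e y - h.e x * h.f y) (c 2 ![x, y])
  three : ∀ x y z, A.IsRep (-(h.f (P.sgn 0 1 x) * h.a y z) + h.a x y * h.f z +
    h.a (P.mul x y) z - h.a x (P.mul y z)) (c 3 ![x, y, z])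
  high : ∀ r, c (r + 4) = 0

theorem IsObstruction.comp {h : HomotopyMap P A} {c : Cochain P A.homology.toBidga}
    (hc : h.IsObstruction c) {π : Q.carrier →ₗ[k] P.carrier} (hπ : IsBidgaMap Q P π) :
    (h.comp hπ).IsObstruction (pullCochain π c) where
  zero := by
    have h1 : pullCochain π c 0 = (c 0).compLinearMap fun _ => π := rfl
    rw [h1, hc.zero]
    rfl
  one x := by
    have h1 : pullCochain π c 1 ![x] = c 1 ![π x] := congrArg (c 1) (vec_one _)
    rw [h1]
    simpa only [HomotopyMap.comp, LinearMap.comp_apply, hπ.map_d] using hc.one (π x)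
  two x y := by
    have h1 : pullCochain π c 2 ![x, y] = c 2 ![π x, π y] := congrArg (c 2) (vec_two _)
    rw [h1]
    simpa only [HomotopyMap.comp, LinearMap.comp_apply, LinearMap.compl₁₂_apply, hπ.map_d,
      hπ.map_sgn, hπ.map_mul] using hc.two (π x) (π y)
  three x y z := by
    have h1 : pullCochain π c 3 ![x, y, z] = c 3 ![π x, π y, π z] := congrArg (c 3) (vec_three _)
    rw [h1]
    simpa only [HomotopyMap.comp, LinearMap.comp_apply, LinearMap.compl₁₂_apply, hπ.map_d,
      hπ.map_sgn, hπ.map_mul] using hc.three (π x) (π y) (π z)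
  high r := by
    have h1 : pullCochain π c (r + 4) = (c (r + 4)).compLinearMap fun _ => π := rfl
    rw [h1, hc.high]
    rfl

/-- These lemmas move the Koszul sign from values in A to the arguments: `f` preserves the vertical
degree, while `e` and `a` raise it by one and produce a minus sign. -/
theorem sgn_f (h : HomotopyMap P A) (x : P.carrier) :
    A.toBigradedModule.sgn 0 1 (h.f x) = h.f (P.sgn 0 1 x) := by
  have h1 := BigradedModule.sgn_map (E := P.toBigradedModule) (F := A.toBigradedModule) h.f 0 0
    (fun s t x hx => by rw [sub_zero, sub_zero]; exact h.f_mem s t x hx) 0 1 x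
  simpa using h1

theorem sgn_e (h : HomotopyMap P A) (x : P.carrier) :
    A.toBigradedModule.sgn 0 1 (h.e x) = -h.e (P.sgn 0 1 x) := by
  have h1 := BigradedModule.sgn_map (E := P.toBigradedModule) (F := A.toBigradedModule) h.e 1 (-1)
    (fun s t x hx => by rw [sub_neg_eq_add]; exact h.e_mem s t x hx) 0 1 x
  simpa using h1

theorem sgn_a (h : HomotopyMap P A) (x y : P.carrier) :
    A.toBigradedModule.sgn 0 1 (h.a x y) = -h.a (P.sgn 0 1 x) (P.sgn 0 1 y) := by
  induction x using P.induction with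
  | h0 => simp
  | hom st x hx =>
    have h1 := BigradedModule.sgn_map (E := P.toBigradedModule) (F := A.toBigradedModule) (h.a x)
      (-st.1) (-st.2 - 1) (fun s t y hy => by
        have h2 := h.a_mem _ _ _ _ _ _ hx hy
        rwa [show st.1 + s = s - -st.1 by ring,
          show st.2 + t + 1 = t - (-st.2 - 1) by ring] at h2) 0 1 y
    rw [h1, P.sgn_of_mem 0 1 hx, map_zsmul, LinearMap.smul_apply]
    simp [Int.negOnePow_sub, Int.negOnePow_neg]
  | add x x' hx hx' => simp only [map_add, LinearMap.add_apply, hx, hx']; abel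

theorem d_f_mul (h : HomotopyMap P A) (x : P.carrier) (z : A.carrier) :
    A.d (h.f x * z) = h.f (P.sgn 0 1 x) * A.d z := by
  rw [A.op_sgn_mul, h.d_f, zero_mul, zero_add]
  exact congrArg (· * A.d z) (sgn_f h x)

theorem d_e_mul (h : HomotopyMap P A) (x : P.carrier) (z : A.carrier) :
    A.d (h.e x * z) = h.f (P.d x) * z - h.e (P.sgn 0 1 x) * A.d z := by
  rw [A.op_sgn_mul, h.d_e, sub_eq_add_neg, ← neg_mul]
  exact congrArg (fun y : A.carrier => h.f (P.d x) * z + y * A.d z) (sgn_e h x)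

theorem d_a_mul (h : HomotopyMap P A) (x y : P.carrier) (z : A.carrier) :
    A.d (h.a x y * z) = (h.f (P.mul x y) - h.f x * h.f y) * z -
      h.a (P.sgn 0 1 x) (P.sgn 0 1 y) * A.d z := by
  rw [A.op_sgn_mul, h.d_a, sub_eq_add_neg (_ * z), ← neg_mul]
  exact congrArg (fun w : A.carrier => (h.f (P.mul x y) - h.f x * h.f y) * z + w * A.d z)
    (sgn_a h x y)

/-- Two homotopy maps which agree in homology differ by a homotopy. -/
theorem exists_homotopy (hP : ∀ st, Module.Projective k (P.piece st)) {h h' : HomotopyMap P A}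
    {ε : P.carrier →ₗ[k] A.homology.toBidga.carrier} (hε : ∀ x, A.IsRep (h.f x) (ε x))
    (hε' : ∀ x, A.IsRep (h'.f x) (ε x)) : ∃ g : P.carrier →ₗ[k] A.carrier,
      (∀ s t x, x ∈ P.piece (s, t) → g x ∈ A.toBigradedModule.piece (s, t + 1)) ∧
      ∀ x, A.d (g x) = h'.f x - h.f x := by
  obtain ⟨g, hg⟩ := P.exists_lift hP (fun _ => True)
    (fun st => A.toBigradedModule.piece (st.1, st.2 + 1)) (fun _ => A.d) (h'.f - h.f) (by
      rintro ⟨s, t⟩ x - hx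
      obtain ⟨w, hw⟩ := DGA.IsRep.exists_d (A := A) (z := h'.f x - h.f x) (by
        have h1 := (hε' x).sub (hε x)
        rwa [sub_self] at h1)
      have hm : h'.f x - h.f x ∈ A.toBigradedModule.piece (s, t) :=
        Submodule.sub_mem _ (h'.f_mem s t x hx) (h.f_mem s t x hx)
      rcases A.eq_zero_or_of_mem hm with h0 | ⟨h0, h1⟩
      · exact ⟨0, Submodule.zero_mem _, by rw [map_zero]; exact h0.symm⟩
      -- Only the component of `w` in degree t + 1 contributes to a boundary of degree t.
      · refine ⟨DirectSum.decompose A.grading w (t + 1), A.mem_piece h0 (Subtype.mem _), ?_⟩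
        rw [A.d_component, hw, add_sub_cancel_right, DirectSum.decompose_of_mem_same _ h1]
        rfl)
  refine ⟨g, fun s t x hx => (hg (s, t) x trivial hx).1, fun x => ?_⟩
  have h1 : A.d ∘ₗ g = h'.f - h.f :=
    BigradedModule.linearMap_ext fun st x hx => (hg st x trivial hx).2
  exact LinearMap.congr_fun h1 x

/-- The class of the obstruction cocycle depends only on the map in homology. -/
theorem sub_mem_coboundaries (hP : P.IsBidga) (hproj : ∀ st, Module.Projective k (P.piece st))
    {h h' : HomotopyMap P A} {ε : P.carrier →ₗ[k] A.homology.toBidga.carrier}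
    (hε : ∀ x, A.IsRep (h.f x) (ε x)) (hε' : ∀ x, A.IsRep (h'.f x) (ε x))
    {c c' : Cochain P A.homology.toBidga} (hc : h.IsObstruction c) (hc' : h'.IsObstruction c') :
    c' - c ∈ coboundaries (F := A.homology.toBidga) ε 3 (-1) := by
  obtain ⟨g, hg, hdg⟩ := exists_homotopy hproj hε hε'
  have sgn_g : ∀ x, A.toBigradedModule.sgn 0 1 (g x) = -g (P.sgn 0 1 x) := fun x => by
    have h1 := BigradedModule.sgn_map (E := P.toBigradedModule) (F := A.toBigradedModule) g 0 (-1)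
      (fun s t x hx => by rw [sub_neg_eq_add, sub_zero]; exact hg s t x hx) 0 1 x
    simpa using h1
  have d_g_mul : ∀ x (z : A.carrier), A.d (g x * z) =
      (h'.f x - h.f x) * z - g (P.sgn 0 1 x) * A.d z := fun x z => by
    rw [A.op_sgn_mul, hdg, sub_eq_add_neg (_ * z), ← neg_mul]
    exact congrArg (fun w : A.carrier => (h'.f x - h.f x) * z + w * A.d z) (sgn_g x)
  have hss : ∀ x, P.sgn 0 1 (P.sgn 0 1 x) = x := P.sgn_sgn 0 1
  have hcomm : ∀ x, P.sgn 0 1 (P.sgn 1 0 x) = P.sgn 1 0 (P.sgn 0 1 x) := P.sgn_comm 0 1 1 0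
  have htwo : ((2 : ℤ).negOnePow : ℤ) = 1 := by rw [Int.negOnePow_even _ even_two]; rfl
  have hds : ∀ x, P.sgn 0 1 (P.d x) = P.d (P.sgn 0 1 x) := fun x => by
    rw [hP.sgn_d]; simp
  -- The products f'(x)f'(y) and f(x)f(y) are joined by `h'.a`, `h.a` and `g` of the product on one
  -- side, and by `g` in each factor on the other; their difference is a cycle.
  let b₂ : P.carrier →ₗ[k] P.carrier →ₗ[k] A.carrier := h'.a - h.a - P.mul.compr₂ g +
    (LinearMap.mul k A.carrier).compl₁₂ g h'.f +
    (LinearMap.mul k A.carrier).compl₁₂ (h.f ∘ₗ P.sgn 0 1) g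
  have hb₂ : ∀ x y, b₂ x y = h'.a x y - h.a x y - g (P.mul x y) + g x * h'.f y +
    h.f (P.sgn 0 1 x) * g y := fun x y => rfl
  -- Likewise, this compares the two homotopies for the horizontal differential; its boundary
  -- vanishes because d g = f' - f.
  let b₁ : P.carrier →ₗ[k] A.carrier := h'.e - h.e - g ∘ₗ P.d
  have hb₁ : ∀ x, b₁ x = h'.e x - h.e x - g (P.d x) := fun x => rfl
  obtain ⟨B₂, hB₂⟩ := A.exists_rep₂ b₂ (fun x y => by
    simp only [hb₂, map_add, map_sub, d_f_mul, d_g_mul, h.d_a, h'.d_a, hdg, h'.d_f, hss,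
      mul_zero]
    noncomm_ring)
  obtain ⟨B₁, hB₁⟩ := A.exists_rep b₁ (fun x => by
    simp only [hb₁, map_sub, h.d_e, h'.d_e, hdg, sub_self])
  let B₁' : Mult k P.carrier A.homology.toBidga.carrier 1 :=
    MultilinearMap.ofSubsingleton k _ _ (0 : Fin 1) B₁
  have hB₁' : ∀ x, A.IsRep (b₁ x) (B₁' ![x]) := hB₁
  let β : Cochain P A.homology.toBidga := fun r => match r with
    | 1 => B₁'
    | 2 => ofBil B₂
    | _ => 0
  refine ⟨β, fun r => ?_, fun r x => ?_⟩
  · match r with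
    | 0 => exact fun _ _ _ => Submodule.zero_mem _
    | 1 =>
      intro deg x hx
      refine (hB₁ (x 0)).mem ?_
      have h0 := hx 0
      have h1 := Submodule.sub_mem _ (Submodule.sub_mem _ (h'.e_mem _ _ _ h0) (h.e_mem _ _ _ h0))
        (hg _ _ _ (hP.d_mem _ _ _ h0))
      rw [Fin.sum_univ_one]
      rw [hb₁]
      convert h1 using 2
      ext <;> simp
    | 2 =>
      intro deg x hx
      have h2 : β 2 x = B₂ (x 0) (x 1) := ofBil_apply _ _
      rw [h2]
      refine (hB₂ (x 0) (x 1)).mem ?_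
      have h0 := hx 0
      have h1 := hx 1
      have hmul : ∀ st st' x y, x ∈ A.toBigradedModule.piece st →
          y ∈ A.toBigradedModule.piece st' → (x * y : A.carrier) ∈
          A.toBigradedModule.piece (st + st') := by
        rintro ⟨s, t⟩ ⟨s', t'⟩ x y hx hy
        rcases A.eq_zero_or_of_mem hx with h0 | ⟨h0, h0'⟩
        · rw [h0, zero_mul]; exact Submodule.zero_mem _
        rcases A.eq_zero_or_of_mem hy with h1 | ⟨h1, h1'⟩
        · rw [h1, mul_zero]; exact Submodule.zero_mem _
        exact A.mem_piece (by simp [show s = 0 from h0, show s' = 0 from h1])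
          (SetLike.GradedMul.mul_mem (A := A.grading) h0' h1')
      have e1 : ∑ l, deg l - (3 - 1 - ((2 : ℕ) : ℤ), -1) =
          ((deg 0).1 + (deg 1).1, (deg 0).2 + (deg 1).2 + 1) := by
        rw [Fin.sum_univ_two]; ext <;> simp
      have h3 := hg _ _ _ (hP.mul_mem _ _ _ _ h0 h1)
      have h4 := hmul _ _ _ _ (hg _ _ _ h0) (h'.f_mem _ _ _ h1)
      have h5 := hmul _ _ _ _ (h.f_mem _ _ _ (P.sgn_mem 0 1 h0)) (hg _ _ _ h1)
      rw [e1, hb₂]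
      refine Submodule.add_mem _ (Submodule.add_mem _ (Submodule.sub_mem _ (Submodule.sub_mem _
        (h'.a_mem _ _ _ _ _ _ h0 h1) (h.a_mem _ _ _ _ _ _ h0 h1)) h3) ?_) ?_
      · convert h4 using 2
        ext <;> simp <;> ring
      · convert h5 using 2
        ext <;> simp <;> ring
    | r + 3 => exact fun _ _ _ => Submodule.zero_mem _
  · match r with
    | 0 =>
      have h1 : (c' - c) 0 = 0 := by rw [Pi.sub_apply, hc.zero, hc'.zero, sub_zero]
      rw [h1]
      exact homDiff_zero_cochain _ _
    | 1 =>
      rw [vec_one x]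
      generalize x 0 = x
      change homDiff _ B₁' ![x] - _ • hochDiff ε _ _ (0 : Mult k _ _ 0) ![x] =
        c' 1 ![x] - c 1 ![x]
      rw [hochDiff_zero_cochain, smul_zero, sub_zero, homDiff_one]
      have h1 := (hB₁' (P.d x))
      have h2 := (hc'.one x).sub (hc.one x)
      rw [hb₁, hP.d_d, map_zero, sub_zero] at h1
      rw [h2.unique h1]
      have h3 : A.homology.toBidga.d (B₁' ![x]) = 0 := rfl
      rw [h3]
      simp
    | 2 =>
      rw [vec_two x]
      generalize x 0 = y
      generalize x 1 = z
      change homDiff _ (ofBil B₂) ![y, z] - _ • hochDiff ε _ _ B₁' ![y, z] =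
        c' 2 ![y, z] - c 2 ![y, z]
      -- The cycles representing the two sides differ by the boundary of this element: `g` in one
      -- factor and a horizontal homotopy in the other.
      have h1 := ((hc'.two y z).sub (hc.two y z)).add_d
        (g (P.sgn 1 0 (P.sgn 0 1 y)) * h'.e z - h.e (P.sgn 0 1 y) * g z)
      have h2 := ((((hB₂ (P.d y) z).neg.sub (hB₂ (P.sgn 1 0 y) (P.d z))).add
        (hB₁' (P.mul y z))).sub ((hε (P.sgn 1 0 (P.sgn 0 1 y))).mul (hB₁' z))).sub
        ((hB₁' y).mul (hε' z))
      have h3 : ∀ y, A.homology.toBidga.d y = 0 := fun _ => rfl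
      rw [homDiff_two, hochDiff_one, h3]
      norm_num
      rw [P.sgn_one_neg_one, htwo, one_smul]
      refine Eq.trans ?_ ((congrArg (A.IsRep · _) ?_ |>.mp h2).unique h1)
      · abel
      · simp only [hb₂, hb₁, map_sub, d_g_mul, d_e_mul, h'.d_e, hdg, hcomm, hss, hds, hP.d_mul,
          map_add]
        noncomm_ring
    | 3 =>
      rw [vec_three x]
      generalize x 0 = y
      generalize x 1 = z
      generalize x 2 = w
      change homDiff _ (0 : Mult k _ _ 3) ![y, z, w] - _ • hochDiff ε _ _ (ofBil B₂) ![y, z, w] =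
        c' 3 ![y, z, w] - c 3 ![y, z, w]
      -- Again the representing cycles agree only up to a boundary, here of `g` in an outer factor
      -- times a product homotopy for the other two.
      have h1 := ((hc'.three y z w).sub (hc.three y z w)).add_d
        (g (P.sgn 0 1 y) * h'.a z w + h.a (P.sgn 0 1 y) (P.sgn 0 1 z) * g w)
      have h2 := ((((hε (P.sgn 0 1 y)).mul (hB₂ z w)).neg.add ((hB₂ y z).mul (hε' w))).add
        (hB₂ (P.mul y z) w)).sub (hB₂ y (P.mul z w))
      rw [homDiff_zero_cochain, hochDiff_two]
      norm_num
      simp only [P.sgn_zero_neg_one, htwo, one_smul]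
      refine Eq.trans ?_ ((congrArg (A.IsRep · _) ?_ |>.mp h2).unique h1)
      · abel
      · simp only [hb₂, map_add, d_g_mul, d_a_mul, h'.d_a, hdg, hss, hP.sgn_mul, hP.mul_assoc]
        noncomm_ring
    | r + 4 =>
      have h1 : (c' - c) (r + 4) = 0 := by rw [Pi.sub_apply, hc.high, hc'.high, sub_zero]
      rw [h1]
      change homDiff _ (0 : Mult k _ _ (r + 4)) x - _ • hochDiff ε _ _ (0 : Mult k _ _ (r + 3)) x
        = 0
      rw [hochDiff_zero_cochain, smul_zero, sub_zero, homDiff_zero_cochain]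

end HomotopyMap

end Obstruction

/-! ### The structure equations of a map to a dga -/

section Relations

variable {k : Type u} [CommRing k]

theorem filter_antidiagonal_one : (Finset.HasAntidiagonal.antidiagonal 1).filter
    (fun jq : ℕ × ℕ => 1 ≤ jq.1 ∧ 1 ≤ jq.2) = ∅ := by decide

theorem filter_antidiagonal_five : (Finset.HasAntidiagonal.antidiagonal (4 + 1)).filter
    (fun jq : ℕ × ℕ => 1 ≤ jq.1 ∧ 1 ≤ jq.2) = {(1, 4), (2, 3), (3, 2), (4, 1)} := by decide

theorem sum_antidiagonalTuple_two {N : Type u} [AddCommMonoid N] (n : ℕ) (G : (Fin 2 → ℕ) → N) :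
    ∑ p ∈ Finset.Nat.antidiagonalTuple 2 n, G p =
      ∑ p ∈ Finset.HasAntidiagonal.antidiagonal n, G ![p.1, p.2] := by
  rw [Finset.Nat.antidiagonalTuple_two, Finset.sum_map]
  rfl

theorem sum_antidiagonalTuple_two_pos {N : Type u} [AddCommMonoid N] (n : ℕ)
    (G : (Fin 2 → ℕ) → N) :
    ∑ p ∈ (Finset.Nat.antidiagonalTuple 2 n).filter (fun q => ∀ a, 1 ≤ q a), G p =
      ∑ p ∈ (Finset.HasAntidiagonal.antidiagonal n).filter (fun jq => 1 ≤ jq.1 ∧ 1 ≤ jq.2),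
        G ![p.1, p.2] := by
  rw [Finset.sum_filter, Finset.sum_filter, sum_antidiagonalTuple_two]
  simp [Fin.forall_fin_two]

/-- The structure equations of a map to a dga, where only two terms involve the dga. -/
theorem DMap.rel_dga {A : DGA k} {E : DAlgebra k} (f : DMap E A.toDAlgebra) (u v : ℕ)
    (hv : 1 ≤ v) (x : ℕ → E.carrier) :
    ∑ ip ∈ Finset.HasAntidiagonal.antidiagonal u,
      ∑ jq ∈ (Finset.HasAntidiagonal.antidiagonal (v + 1)).filter (fun jq => 1 ≤ jq.1 ∧ 1 ≤ jq.2),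
        ∑ rt ∈ Finset.HasAntidiagonal.antidiagonal (jq.1 - 1),
          (-1 : ℤ) ^ (rt.1 * jq.2 + rt.2 + ip.2 * jq.1) •
            f.f ip.1 jq.1 (fun l => E.insertAt ip.2 (2 - (ip.2 + jq.2))
              (E.m ip.2 jq.2) rt.1 x l) =
    (-1 : ℤ) ^ u • A.d (f.f u v fun c => x c) +
      ∑ p ∈ Finset.HasAntidiagonal.antidiagonal u,
        ∑ q ∈ (Finset.HasAntidiagonal.antidiagonal v).filter (fun jq => 1 ≤ jq.1 ∧ 1 ≤ jq.2),
          (-1 : ℤ) ^ (u + (p.1 + q.1) + q.1 * (p.2 + q.2)) •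
            LinearMap.mul k A.carrier (f.f p.1 q.1 fun c => E.sgn p.2 (1 - (p.2 + q.2)) (x c))
              (f.f p.2 q.2 fun c => x (q.1 + c)) := by
  rw [f.rel u v hv x]
  have hop : ∀ i j, ¬ (i = 0 ∧ (j = 1 ∨ j = 2)) → A.toDAlgebra.m i j = 0 := A.op_eq_zero
  have Ioi_zero : Finset.Ioi (0 : Fin 2) = {1} := by decide
  have Ioi_one : Finset.Ioi (1 : Fin 2) = ∅ := by decide
  have Iio_zero : Finset.Iio (0 : Fin 2) = ∅ := by decide
  have Iio_one : Finset.Iio (1 : Fin 2) = {0} := by decide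
  -- A dga has no operations of positive horizontal degree, so the outer operation takes no part of
  -- u.
  have hi : ∀ (j : ℕ) (G : ℕ × ℕ → (Fin j → ℕ) → (Fin j → ℕ) → Fin j → A.toDAlgebra.carrier)
      (e : (Fin j → ℕ) → (Fin j → ℕ) → ℕ),
      (∑ iP ∈ Finset.HasAntidiagonal.antidiagonal u,
        ∑ p ∈ Finset.Nat.antidiagonalTuple j iP.2,
          ∑ q ∈ (Finset.Nat.antidiagonalTuple j v).filter (fun q => ∀ a, 1 ≤ q a),
            (-1 : ℤ) ^ e p q • A.toDAlgebra.m iP.1 j (G iP p q)) =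
        ∑ p ∈ Finset.Nat.antidiagonalTuple j u,
          ∑ q ∈ (Finset.Nat.antidiagonalTuple j v).filter (fun q => ∀ a, 1 ≤ q a),
            (-1 : ℤ) ^ e p q • A.toDAlgebra.m 0 j (G (0, u) p q) := by
    intro j G e
    refine Finset.sum_eq_single_of_mem (0, u) (by simp) fun iP hiP hne => ?_
    have h0 : iP.1 ≠ 0 := fun h => hne (Prod.ext h (by simpa [h] using hiP))
    refine Finset.sum_eq_zero fun p _ => Finset.sum_eq_zero fun q _ => ?_
    rw [hop _ _ (fun h => h0 h.1)]
    exact smul_zero _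
  simp only [hi]
  -- The range is enlarged so that it contains {1, 2} even for v = 1. The extra term is empty, as v
  -- is not a sum of v + 1 positive integers; terms with j ≥ 3 vanish in a dga.
  rw [Finset.sum_subset (s₂ := Finset.Icc 1 (v + 1)) (Finset.Icc_subset_Icc_right (by omega)),
    ← Finset.sum_subset (s₁ := {1, 2}), Finset.sum_pair (by norm_num)]
  · congr 1
    · have h1 : (Finset.Nat.antidiagonalTuple 1 v).filter (fun q => ∀ a, 1 ≤ q a) = {![v]} := by
        rw [Finset.Nat.antidiagonalTuple_one, Finset.filter_singleton, if_pos]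
        intro a; fin_cases a; exact hv
      rw [h1, Finset.Nat.antidiagonalTuple_one, Finset.sum_singleton, Finset.sum_singleton]
      have h2 : mapSignExponent u 1 ![u] ![v] = u := by simp [mapSignExponent]
      rw [h2]
      refine congrArg (fun y => (-1 : ℤ) ^ u • A.d y) ?_
      refine congrArg (f.f u v) (funext fun c => ?_)
      have h3 := E.sgn_zero_zero
      simpa using h3 (x c)
    · rw [sum_antidiagonalTuple_two]
      refine Finset.sum_congr rfl fun p _ => ?_
      rw [sum_antidiagonalTuple_two_pos]
      refine Finset.sum_congr rfl fun q _ => ?_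
      have h2 : mapSignExponent u 2 ![p.1, p.2] ![q.1, q.2] =
          u + (p.1 + q.1) + q.1 * (p.2 + q.2) := by
        simp [mapSignExponent, Fin.sum_univ_two, Ioi_zero, Ioi_one]
      rw [h2]
      congr 1
      refine (A.op_two _).trans ?_
      refine congrArg₂ (fun y z : A.carrier => y * z) ?_ ?_
      · refine congrArg (f.f p.1 q.1) (funext fun c => ?_)
        simp [Ioi_zero, Iio_zero]
      · refine congrArg (f.f p.2 q.2) (funext fun c => ?_)
        simp [Ioi_one, Iio_one, E.sgn_zero_zero]
  · intro j; simp; omega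
  · intro j hj hj'
    simp at hj hj'
    refine Finset.sum_eq_zero fun p _ => Finset.sum_eq_zero fun q _ => ?_
    rw [hop _ _ (by omega)]
    exact smul_zero _
  · intro j hj hj'
    simp at hj hj'
    obtain rfl : j = v + 1 := by omega
    refine Finset.sum_eq_zero fun p _ => ?_
    rw [Finset.filter_eq_empty_iff.2, Finset.sum_empty]
    intro q hq h
    rw [Finset.Nat.mem_antidiagonalTuple] at hq
    have := Finset.sum_le_sum (s := Finset.univ) fun a _ => h a
    simp at this
    omega

section InsertAt

variable (E : BigradedModule k) (a b : ℤ) {q : ℕ} (g : (Fin q → E.carrier) → E.carrier) (r : ℕ)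
  (x : ℕ → E.carrier)

theorem insertAt_two : (fun l : Fin 2 => E.insertAt a b g r x l) =
    ![E.insertAt a b g r x 0, E.insertAt a b g r x 1] := vec_two _

theorem insertAt_three : (fun l : Fin 3 => E.insertAt a b g r x l) =
    ![E.insertAt a b g r x 0, E.insertAt a b g r x 1, E.insertAt a b g r x 2] := vec_three _

theorem insertAt_four : (fun l : Fin 4 => E.insertAt a b g r x l) =
    ![E.insertAt a b g r x 0, E.insertAt a b g r x 1, E.insertAt a b g r x 2,
      E.insertAt a b g r x 3] := vec_four _

end InsertAt

section ZeroArguments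

variable {V W : Type u} [AddCommGroup V] [Module k V] [AddCommGroup W] [Module k W]

theorem mult_zero_one (m : Mult k V W 1) : m ![0] = 0 := m.map_coord_zero 0 rfl

theorem mult_zero_two_left (m : Mult k V W 2) (y : V) : m ![0, y] = 0 := m.map_coord_zero 0 rfl

theorem mult_zero_two_right (m : Mult k V W 2) (x : V) : m ![x, 0] = 0 := m.map_coord_zero 1 rfl

theorem mult_zero_three_left (m : Mult k V W 3) (y z : V) : m ![0, y, z] = 0 :=
  m.map_coord_zero 0 rfl

theorem mult_zero_three_middle (m : Mult k V W 3) (x z : V) : m ![x, 0, z] = 0 :=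
  m.map_coord_zero 1 rfl

theorem mult_zero_three_right (m : Mult k V W 3) (x y : V) : m ![x, y, 0] = 0 :=
  m.map_coord_zero 2 rfl

theorem mult_zero_four_first (m : Mult k V W 4) (y z w : V) : m ![0, y, z, w] = 0 :=
  m.map_coord_zero 0 rfl

theorem mult_zero_four_second (m : Mult k V W 4) (x z w : V) : m ![x, 0, z, w] = 0 :=
  m.map_coord_zero 1 rfl

theorem mult_zero_four_third (m : Mult k V W 4) (x y w : V) : m ![x, y, 0, w] = 0 :=
  m.map_coord_zero 2 rfl

theorem mult_zero_four_fourth (m : Mult k V W 4) (x y z : V) : m ![x, y, z, 0] = 0 :=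
  m.map_coord_zero 3 rfl

theorem vec_const {V : Type u} (x : V) : (fun _ : Fin 1 => x) = ![x] := vec_one _

end ZeroArguments

end Relations

/-! ### The structure equations of a minimal model in low degrees. -/

namespace MinimalModel

variable {k : Type u} [CommRing k] {A : DGA k} (M : MinimalModel A)

theorem exists_seq {V : Type u} (a b c d : V) :
    ∃ x : ℕ → V, x 0 = a ∧ x 1 = b ∧ x 2 = c ∧ x 3 = d :=
  ⟨fun n => if n = 0 then a else if n = 1 then b else if n = 2 then c else d, rfl, rfl, rfl, rfl⟩

section SimpSet

variable (x : ℕ → M.E.carrier)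

theorem vec_seq_two (n : ℕ) : (fun l : Fin 2 => x (n + l)) = ![x n, x (n + 1)] := vec_two _

theorem vec_seq_three (n : ℕ) : (fun l : Fin 3 => x (n + l)) = ![x n, x (n + 1), x (n + 2)] :=
  vec_three _

end SimpSet

/-- Equation (u, v) = (0, 3): the associativity homotopy enters only together with m_{01}, which
vanishes. For the same reason (1, 2) and (2, 1) give the strict laws in `m_leibniz` and `m_d_d`. -/
theorem m_assoc (a b c : M.E.carrier) :
    M.E.m 0 2 ![M.E.m 0 2 ![a, b], c] = M.E.m 0 2 ![a, M.E.m 0 2 ![b, c]] := by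
  obtain ⟨x, rfl, rfl, rfl, -⟩ := exists_seq a b c 0
  have h := M.E.rel 0 3 (by norm_num) x
  rw [filter_antidiagonal_four] at h
  simp [-Matrix.cons_val_zero, -Matrix.cons_val_one, insertAt_two, insertAt_three,
    Finset.Nat.antidiagonal_succ] at h
  have r1 : (fun l : Fin 2 => x l) = ![x 0, x 1] := vec_two _
  simp [BigradedModule.insertAt, M.minimal, r1, vec_seq_two, BigradedModule.sgn_zero_zero,
    mult_zero_three_left, mult_zero_three_middle, mult_zero_three_right] at h
  rw [neg_add_eq_zero] at h
  exact h

theorem m_leibniz (a b : M.E.carrier) : M.E.m 1 1 ![M.E.m 0 2 ![a, b]] =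
    M.E.m 0 2 ![M.E.m 1 1 ![a], b] + M.E.m 0 2 ![M.E.sgn 1 0 a, M.E.m 1 1 ![b]] := by
  obtain ⟨x, rfl, rfl, -, -⟩ := exists_seq a b 0 0
  have h := M.E.rel 1 2 (by norm_num) x
  rw [filter_antidiagonal_three] at h
  simp [-Matrix.cons_val_zero, -Matrix.cons_val_one, insertAt_two,
    Finset.Nat.antidiagonal_succ] at h
  have r1 : (fun l : Fin 2 => x l) = ![x 0, x 1] := vec_two _
  simp [BigradedModule.insertAt, M.minimal, r1, vec_const,
    mult_zero_two_left, mult_zero_two_right] at h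
  rw [← sub_eq_zero, ← h]
  abel

theorem m_d_d (a : M.E.carrier) : M.E.m 1 1 ![M.E.m 1 1 ![a]] = 0 := by
  obtain ⟨x, rfl, -, -, -⟩ := exists_seq a 0 0 0
  have h := M.E.rel 2 1 (by norm_num) x
  rw [filter_antidiagonal_two] at h
  simp [Finset.Nat.antidiagonal_succ] at h
  simpa [BigradedModule.insertAt, M.minimal, vec_const, mult_zero_one] using h

/-- By minimality, the equations with u + v = 4 involve only m_{02}, m_{11} and the three components
of the cochain; together they are the cocycle condition, component by component. -/
theorem m_rel_zero_four (a b c d : M.E.carrier) :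
    M.E.m 0 2 ![M.E.m 0 3 ![a, b, c], d] + M.E.m 0 2 ![M.E.sgn 0 1 a, M.E.m 0 3 ![b, c, d]] =
      M.E.m 0 3 ![M.E.m 0 2 ![a, b], c, d] - M.E.m 0 3 ![a, M.E.m 0 2 ![b, c], d] +
        M.E.m 0 3 ![a, b, M.E.m 0 2 ![c, d]] := by
  obtain ⟨x, rfl, rfl, rfl, rfl⟩ := exists_seq a b c d
  have h := M.E.rel 0 4 (by norm_num) x
  rw [filter_antidiagonal_five] at h
  simp [-Matrix.cons_val_zero, -Matrix.cons_val_one, insertAt_two, insertAt_three, insertAt_four,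
    Finset.Nat.antidiagonal_succ] at h
  have r1 : (fun l : Fin 2 => x l) = ![x 0, x 1] := vec_two _
  have r2 : (fun l : Fin 3 => x l) = ![x 0, x 1, x 2] := vec_three _
  simp [BigradedModule.insertAt, M.minimal, r1, r2, vec_seq_two, vec_seq_three,
    BigradedModule.sgn_zero_zero, BigradedModule.sgn_zero_neg_one, mult_zero_four_first,
    mult_zero_four_second, mult_zero_four_third, mult_zero_four_fourth] at h
  rw [← sub_eq_zero, ← neg_eq_zero, ← h]
  abel

theorem m_rel_one_three (a b c : M.E.carrier) :
    M.E.m 1 1 ![M.E.m 0 3 ![a, b, c]] - M.E.m 0 3 ![M.E.m 1 1 ![a], b, c] -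
      M.E.m 0 3 ![M.E.sgn 1 0 a, M.E.m 1 1 ![b], c] -
        M.E.m 0 3 ![M.E.sgn 1 0 a, M.E.sgn 1 0 b, M.E.m 1 1 ![c]] =
    M.E.m 0 2 ![M.E.m 1 2 ![a, b], c] -
      M.E.m 0 2 ![M.E.sgn 1 0 (M.E.sgn 0 1 a), M.E.m 1 2 ![b, c]] +
        M.E.m 1 2 ![M.E.m 0 2 ![a, b], c] - M.E.m 1 2 ![a, M.E.m 0 2 ![b, c]] := by
  obtain ⟨x, rfl, rfl, rfl, -⟩ := exists_seq a b c 0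
  have h := M.E.rel 1 3 (by norm_num) x
  rw [filter_antidiagonal_four] at h
  simp [-Matrix.cons_val_zero, -Matrix.cons_val_one, insertAt_two, insertAt_three,
    Finset.Nat.antidiagonal_succ] at h
  have r1 : (fun l : Fin 2 => x l) = ![x 0, x 1] := vec_two _
  have r2 : (fun l : Fin 3 => x l) = ![x 0, x 1, x 2] := vec_three _
  simp [BigradedModule.insertAt, M.minimal, r1, r2, vec_seq_two, vec_const,
    BigradedModule.sgn_zero_zero, BigradedModule.sgn_one_neg_one, mult_zero_three_left,
    mult_zero_three_middle, mult_zero_three_right] at h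
  rw [← sub_eq_zero, ← h]
  abel

theorem m_rel_two_two (a b : M.E.carrier) :
    M.E.m 1 1 ![M.E.m 1 2 ![a, b]] + M.E.m 1 2 ![M.E.m 1 1 ![a], b] +
      M.E.m 1 2 ![M.E.sgn 1 0 a, M.E.m 1 1 ![b]] =
    -M.E.m 0 2 ![M.E.m 2 1 ![a], b] - M.E.m 0 2 ![M.E.sgn 0 1 a, M.E.m 2 1 ![b]] +
      M.E.m 2 1 ![M.E.m 0 2 ![a, b]] := by
  obtain ⟨x, rfl, rfl, -, -⟩ := exists_seq a b 0 0
  have h := M.E.rel 2 2 (by norm_num) x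
  rw [filter_antidiagonal_three] at h
  simp [-Matrix.cons_val_zero, -Matrix.cons_val_one, insertAt_two,
    Finset.Nat.antidiagonal_succ] at h
  have r1 : (fun l : Fin 2 => x l) = ![x 0, x 1] := vec_two _
  have r2 : ∀ y, M.E.sgn 2 (-1) y = M.E.sgn 0 1 y := fun y => by
    rw [show (2 : ℤ) = 1 + 1 by norm_num, show (-1 : ℤ) = 0 + -1 by norm_num,
      M.E.sgn_add, M.E.sgn_one_neg_one, M.E.sgn_sgn]
  simp [BigradedModule.insertAt, M.minimal, r1, r2, vec_const,
    mult_zero_two_left, mult_zero_two_right] at h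
  rw [← sub_eq_zero, ← neg_eq_zero, ← h]
  abel

theorem m_rel_three_one (a : M.E.carrier) :
    M.E.m 1 1 ![M.E.m 2 1 ![a]] = M.E.m 2 1 ![M.E.m 1 1 ![a]] := by
  obtain ⟨x, rfl, -, -, -⟩ := exists_seq a 0 0 0
  have h := M.E.rel 3 1 (by norm_num) x
  rw [filter_antidiagonal_two] at h
  simp [Finset.Nat.antidiagonal_succ] at h
  simp [BigradedModule.insertAt, M.minimal, vec_const, mult_zero_one] at h
  rw [← sub_eq_zero, ← h]
  abel

/-- The bilinear map `f_{02}`. -/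
def mulHomotopy : M.E.carrier →ₗ[k] M.E.carrier →ₗ[k] A.carrier := bil (M.f.f 0 2)

/-- The linear map `f_{11}`. -/
def diffHomotopy : M.E.carrier →ₗ[k] A.carrier :=
  (MultilinearMap.ofSubsingleton k M.E.carrier A.carrier (0 : Fin 1)).symm (M.f.f 1 1)

theorem mulHomotopy_apply (a b : M.E.carrier) : M.mulHomotopy a b = M.f.f 0 2 ![a, b] :=
  bil_apply _ _ _

theorem diffHomotopy_apply (a : M.E.carrier) : M.diffHomotopy a = M.f.f 1 1 ![a] :=
  congrArg (M.f.f 1 1) (vec_const a)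

theorem linear_apply (a : M.E.carrier) : (M.f.linear a : A.carrier) = M.f.f 0 1 ![a] :=
  congrArg (M.f.f 0 1) (vec_const a)

/-- The linear map `f_{01}`. -/
def toDGA : M.E.carrier →ₗ[k] A.carrier := M.f.linear

theorem toDGA_apply (a : M.E.carrier) : M.toDGA a = M.f.f 0 1 ![a] := M.linear_apply a

theorem toDGA_mul (a b : M.E.carrier) : M.toDGA (M.E.m 0 2 ![a, b]) =
    A.d (M.mulHomotopy a b) + M.toDGA a * M.toDGA b := by
  obtain ⟨x, rfl, rfl, -, -⟩ := exists_seq a b 0 0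
  have h := M.f.rel_dga 0 2 (by norm_num) x
  rw [filter_antidiagonal_three, filter_antidiagonal_two] at h
  simp [-Matrix.cons_val_zero, -Matrix.cons_val_one, insertAt_two,
    Finset.Nat.antidiagonal_succ] at h
  have r1 : (fun l : Fin 2 => x l) = ![x 0, x 1] := vec_two _
  simp [BigradedModule.insertAt, M.minimal, r1, vec_const,
    BigradedModule.sgn_zero_zero, mult_zero_two_left, mult_zero_two_right] at h
  simp only [toDGA_apply, mulHomotopy_apply]
  exact h

theorem toDGA_d (a : M.E.carrier) : M.toDGA (M.E.m 1 1 ![a]) = A.d (M.diffHomotopy a) := by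
  obtain ⟨x, rfl, -, -, -⟩ := exists_seq a 0 0 0
  have h := M.f.rel_dga 1 1 (by norm_num) x
  rw [filter_antidiagonal_two, filter_antidiagonal_one] at h
  simp [Finset.Nat.antidiagonal_succ] at h
  simp [BigradedModule.insertAt, M.minimal, vec_const, mult_zero_one] at h
  simp only [toDGA_apply, diffHomotopy_apply]
  exact neg_injective h

/-- The witness is f_{03}. The higher components of f enter the equations with u + v = 3 only as
boundaries, so they are invisible in homology; likewise f_{12} and f_{21} in the next two lemmas. -/
theorem toDGA_m_zero_three (a b c : M.E.carrier) : ∃ w, M.toDGA (M.E.m 0 3 ![a, b, c]) =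
    -(M.toDGA (M.E.sgn 0 1 a) * M.mulHomotopy b c) + M.mulHomotopy a b * M.toDGA c +
      M.mulHomotopy (M.E.m 0 2 ![a, b]) c - M.mulHomotopy a (M.E.m 0 2 ![b, c]) + A.d w := by
  obtain ⟨x, rfl, rfl, rfl, -⟩ := exists_seq a b c 0
  have h := M.f.rel_dga 0 3 (by norm_num) x
  rw [filter_antidiagonal_four, filter_antidiagonal_three] at h
  simp [-Matrix.cons_val_zero, -Matrix.cons_val_one, insertAt_two,
    insertAt_three, Finset.Nat.antidiagonal_succ] at h
  have r1 : (fun l : Fin 2 => x l) = ![x 0, x 1] := vec_two _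
  have r2 : (fun l : Fin 3 => x l) = ![x 0, x 1, x 2] := vec_three _
  simp [BigradedModule.insertAt, M.minimal, r1, r2, vec_seq_two, vec_const,
    BigradedModule.sgn_zero_zero, BigradedModule.sgn_zero_neg_one, mult_zero_three_left,
    mult_zero_three_middle, mult_zero_three_right] at h
  refine ⟨M.f.f 0 3 ![x 0, x 1, x 2], ?_⟩
  have h' : M.toDGA (M.E.m 0 3 ![x 0, x 1, x 2]) + (-M.mulHomotopy (M.E.m 0 2 ![x 0, x 1]) (x 2) +
      M.mulHomotopy (x 0) (M.E.m 0 2 ![x 1, x 2])) = A.d (M.f.f 0 3 ![x 0, x 1, x 2]) +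
      ((-1) ^ 3 * (M.toDGA (M.E.sgn 0 1 (x 0)) * M.mulHomotopy (x 1) (x 2)) +
        (-1) ^ 4 * (M.mulHomotopy (x 0) (x 1) * M.toDGA (x 2))) := by
    simp only [toDGA_apply, mulHomotopy_apply]
    exact h
  rw [← eq_sub_iff_add_eq] at h'
  rw [h']
  noncomm_ring

theorem toDGA_m_one_two (a b : M.E.carrier) : ∃ w, M.toDGA (M.E.m 1 2 ![a, b]) =
    -M.mulHomotopy (M.E.m 1 1 ![a]) b - M.mulHomotopy (M.E.sgn 1 0 a) (M.E.m 1 1 ![b]) +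
      M.diffHomotopy (M.E.m 0 2 ![a, b]) -
      M.toDGA (M.E.sgn 1 0 (M.E.sgn 0 1 a)) * M.diffHomotopy b - M.diffHomotopy a * M.toDGA b +
      A.d w := by
  obtain ⟨x, rfl, rfl, -, -⟩ := exists_seq a b 0 0
  have h := M.f.rel_dga 1 2 (by norm_num) x
  rw [filter_antidiagonal_three, filter_antidiagonal_two] at h
  simp [-Matrix.cons_val_zero, -Matrix.cons_val_one, insertAt_two,
    Finset.Nat.antidiagonal_succ] at h
  have r1 : (fun l : Fin 2 => x l) = ![x 0, x 1] := vec_two _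
  simp [BigradedModule.insertAt, M.minimal, r1, vec_const,
    BigradedModule.sgn_zero_zero, BigradedModule.sgn_one_neg_one, mult_zero_two_left,
    mult_zero_two_right] at h
  refine ⟨M.f.f 1 2 ![x 0, x 1], ?_⟩
  have h' : -M.toDGA (M.E.m 1 2 ![x 0, x 1]) + (-M.mulHomotopy (M.E.m 1 1 ![x 0]) (x 1) +
      -M.mulHomotopy (M.E.sgn 1 0 (x 0)) (M.E.m 1 1 ![x 1])) +
      M.diffHomotopy (M.E.m 0 2 ![x 0, x 1]) = -A.d (M.f.f 1 2 ![x 0, x 1]) +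
      ((-1) ^ 4 * (M.toDGA (M.E.sgn 1 0 (M.E.sgn 0 1 (x 0))) * M.diffHomotopy (x 1)) +
        (-1) ^ 4 * (M.diffHomotopy (x 0) * M.toDGA (x 1))) := by
    simp only [toDGA_apply, mulHomotopy_apply, diffHomotopy_apply]
    exact h
  rw [← sub_eq_zero] at h' ⊢
  rw [← neg_eq_zero, ← h']
  noncomm_ring

theorem toDGA_m_two_one (a : M.E.carrier) : ∃ w, M.toDGA (M.E.m 2 1 ![a]) =
    M.diffHomotopy (M.E.m 1 1 ![a]) + A.d w := by
  obtain ⟨x, rfl, -, -, -⟩ := exists_seq a 0 0 0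
  have h := M.f.rel_dga 2 1 (by norm_num) x
  rw [filter_antidiagonal_two, filter_antidiagonal_one] at h
  simp [Finset.Nat.antidiagonal_succ] at h
  simp [BigradedModule.insertAt, M.minimal, vec_const, mult_zero_one] at h
  refine ⟨M.f.f 2 1 ![x 0], ?_⟩
  have h' : M.toDGA (M.E.m 2 1 ![x 0]) + -M.diffHomotopy (M.E.m 1 1 ![x 0]) =
      A.d (M.f.f 2 1 ![x 0]) := by
    simp only [toDGA_apply, diffHomotopy_apply]
    exact h
  rw [← h']
  abel

end MinimalModel

/-! ### Minimal models as resolutions -/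

/-- The cocycle condition for a cochain of total degree `3` with only three components. -/
theorem mem_cocycles_three {k : Type u} [CommRing k] {E : BidgaData k} {c : Cochain E E}
    (hc : c ∈ cochains E E 3 (-1)) (h0 : c 0 = 0) (h4 : ∀ r, c (r + 4) = 0)
    (r1 : ∀ x, E.d (c 1 ![x]) = c 1 ![E.d x])
    (r2 : ∀ x y, E.d (c 2 ![x, y]) + c 2 ![E.d x, y] + c 2 ![E.sgn 1 0 x, E.d y] =
      -E.mul (c 1 ![x]) y - E.mul (E.sgn 0 1 x) (c 1 ![y]) + c 1 ![E.mul x y])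
    (r3 : ∀ x y z, E.d (c 3 ![x, y, z]) - c 3 ![E.d x, y, z] - c 3 ![E.sgn 1 0 x, E.d y, z] -
        c 3 ![E.sgn 1 0 x, E.sgn 1 0 y, E.d z] =
      E.mul (c 2 ![x, y]) z - E.mul (E.sgn 1 0 (E.sgn 0 1 x)) (c 2 ![y, z]) +
        c 2 ![E.mul x y, z] - c 2 ![x, E.mul y z])
    (r4 : ∀ x y z w, E.mul (c 3 ![x, y, z]) w + E.mul (E.sgn 0 1 x) (c 3 ![y, z, w]) =
      c 3 ![E.mul x y, z, w] - c 3 ![x, E.mul y z, w] + c 3 ![x, y, E.mul z w]) :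
    c ∈ cocycles (LinearMap.id : E.carrier →ₗ[k] E.carrier) 3 (-1) := by
  have hthree : ((3 : ℤ).negOnePow : ℤ) = -1 := by
    rw [Int.negOnePow_odd _ (by decide)]; rfl
  have htwo : ((2 : ℤ).negOnePow : ℤ) = 1 := by rw [Int.negOnePow_even _ even_two]; rfl
  -- Koszul signs depend on parities only.
  have hsgn : ∀ y, E.sgn 2 (-1) y = E.sgn 0 1 y := fun y => by
    rw [show (2 : ℤ) = 1 + 1 by norm_num, show (-1 : ℤ) = 0 + -1 by norm_num,
      E.sgn_add, E.sgn_one_neg_one, E.sgn_sgn]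
  refine ⟨hc, fun r x => ?_⟩
  match r with
  | 0 => rw [totDiff, h0, homDiff_zero_cochain]
  | 1 =>
    rw [totDiff, h0, hochDiff_zero_cochain, vec_one x, homDiff_one]
    norm_num
    rw [htwo, one_smul, r1, sub_self]
  | 2 =>
    change homDiff _ (c 2) x - _ • hochDiff LinearMap.id _ _ (c 1) x = 0
    rw [vec_two x, homDiff_two, hochDiff_one]
    norm_num
    rw [hthree, hsgn, ← sub_eq_zero.2 (r2 (x 0) (x 1))]
    abel
  | 3 =>
    change homDiff _ (c 3) x - _ • hochDiff LinearMap.id _ _ (c 2) x = 0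
    rw [vec_three x, homDiff_three, hochDiff_two]
    norm_num
    rw [hthree, E.sgn_one_neg_one, ← sub_eq_zero.2 (r3 (x 0) (x 1) (x 2))]
    abel
  | 4 =>
    rw [totDiff, h4 0, homDiff_zero_cochain, vec_four x, hochDiff_three]
    norm_num
    rw [E.sgn_zero_neg_one, ← sub_eq_zero.2 (r4 (x 0) (x 1) (x 2) (x 3))]
    abel
  | r + 5 =>
    rw [totDiff, h4 (r + 1), h4 r, hochDiff_zero_cochain, homDiff_zero_cochain, smul_zero,
      sub_zero]

namespace MinimalModel

variable {k : Type u} [CommRing k] {A : DGA k} (M : MinimalModel A)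

theorem diff_one_apply (a : M.E.carrier) : M.E.diff 1 a = M.E.m 1 1 ![a] :=
  congrArg (M.E.m 1 1) (vec_const a)

theorem isBidga : M.toBidgaData.IsBidga where
  mul_mem st st' x y hx hy := by
    have h := M.E.homogeneous 0 2 (by norm_num) ![st, st'] ![x, y] (fun l => by
      fin_cases l
      · exact hx
      · exact hy)
    rw [Fin.sum_univ_two] at h
    have h1 : ![st, st'] 0 + ![st, st'] 1 -
        (((0 : ℕ) : ℤ), (2 : ℤ) - (((0 : ℕ) : ℤ) + ((2 : ℕ) : ℤ))) = st + st' := by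
      ext <;> simp
    rw [h1] at h
    exact h
  one_mem := M.E.one_mem
  d_mem s t := fun (x : M.E.carrier) hx => by
    have h := M.E.homogeneous 1 1 le_rfl ![(s, t)] ![x] (fun l => by
      fin_cases l
      exact hx)
    rw [Fin.sum_univ_one, ← M.diff_one_apply] at h
    have h1 : ![(s, t)] 0 - (((1 : ℕ) : ℤ), (2 : ℤ) - (((1 : ℕ) : ℤ) + ((1 : ℕ) : ℤ))) =
        (s - 1, t) := by
      ext <;> simp
    rw [h1] at h
    exact h
  mul_assoc := M.m_assoc
  one_mul := M.E.one_mul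
  mul_one := M.E.mul_one
  d_d := fun (x : M.E.carrier) => by
    have h := M.m_d_d x
    rw [← M.diff_one_apply, ← M.diff_one_apply] at h
    exact h
  leibniz s t := fun (x y : M.E.carrier) hx => by
    have h := M.m_leibniz x y
    have h1 : M.E.sgn 1 0 x = (s.negOnePow : ℤ) • x := by
      simp [M.E.sgn_of_mem 1 0 hx]
    have h2 := map_zsmul (M.E.mul.flip (M.E.diff 1 y)) (s.negOnePow : ℤ) x
    rw [← M.diff_one_apply, ← M.diff_one_apply, ← M.diff_one_apply, h1] at h
    exact h.trans (congrArg (M.E.m 0 2 ![M.E.diff 1 x, y] + ·) h2)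

theorem isRep_aug (x : M.E.carrier) : A.IsRep (M.toDGA x) (M.aug x) := ⟨M.d_linear x, rfl⟩

theorem toDGA_mem (s t : ℤ) (x : M.E.carrier) (hx : x ∈ M.E.piece (s, t)) :
    M.toDGA x ∈ A.toBigradedModule.piece (s, t) := by
  have h := M.f.homogeneous 0 1 le_rfl ![(s, t)] ![x] (fun l => by
    fin_cases l
    exact hx)
  rw [Fin.sum_univ_one] at h
  rw [toDGA_apply]
  have h1 : ![(s, t)] 0 - (((0 : ℕ) : ℤ), (1 : ℤ) - (((0 : ℕ) : ℤ) + ((1 : ℕ) : ℤ))) = (s, t) := by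
    ext <;> simp
  rw [h1] at h
  exact h

theorem aug_mul (x y : M.E.carrier) : M.aug (M.E.m 0 2 ![x, y]) = M.aug x * M.aug y := by
  refine (M.isRep_aug (M.E.m 0 2 ![x, y])).unique ?_
  rw [M.toDGA_mul, add_comm]
  exact ((M.isRep_aug x).mul (M.isRep_aug y)).add_d _

theorem aug_diff (x : M.E.carrier) : M.aug (M.E.diff 1 x) = 0 := by
  refine (M.isRep_aug (M.E.diff 1 x)).unique ?_
  rw [M.diff_one_apply, M.toDGA_d]
  exact DGA.IsRep.of_d _

theorem isResolution : M.toResolutionData.IsResolution where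
  isBidga := M.isBidga
  projective := M.projective
  aug_mem t x hx := GradedAlg.mem_piece.1 ((M.isRep_aug x).mem (M.toDGA_mem _ _ x hx))
  aug_zero s t x hs hx :=
    GradedAlg.eq_zero_of_mem_piece hs ((M.isRep_aug x).mem (M.toDGA_mem _ _ x hx))
  aug_mul := M.aug_mul
  aug_one := by
    refine (M.isRep_aug M.E.one).unique ?_
    have h : M.toDGA M.E.one = 1 := M.f.f_one
    rw [h]
    exact ⟨A.d_one, map_one A.cls⟩
  aug_d := M.aug_diff
  isE2 := by
    have hd : M.E.diff 0 = 0 := by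
      rw [DAlgebra.diff, M.minimal]
      rfl
    have hA : A.toDAlgebra.diff 1 = 0 := by
      have h : A.toDAlgebra.m 1 1 = 0 := A.op_eq_zero 1 1 (by omega)
      rw [DAlgebra.diff, h]
      rfl
    have hE := M.isE2
    -- As m_{01} of E and m_{11} of A vanish, the hypothesis compares the homology of (E, m_{11})
    -- with that of (A, d), which is the condition on the augmentation.
    rw [DMap.IsE2Equivalence, hd, hA, inducesIterIso_iff] at hE
    simp only [mem_iterCycles_zero_left, mem_iterCycles_zero_right, mem_iterBoundaries_zero_left,
      mem_iterBoundaries_zero_right] at hE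
    obtain ⟨-, h2, h3⟩ := hE
    refine inducesIterIso_zero_iff.2 ⟨fun x => Or.inl (M.aug_diff x), fun x hx hx' => ?_,
      fun y => ?_⟩
    · have h := M.isRep_aug x
      have hx' : M.aug x = 0 := hx'
      rw [hx'] at h
      exact (h2 x hx).1 h.exists_d
    · obtain ⟨⟨z, hz⟩, rfl⟩ := Ideal.Quotient.mk_surjective y
      obtain ⟨x, hx, w, hw⟩ := h3 z hz
      refine ⟨x, hx, (M.isRep_aug x).unique ?_⟩
      have h1 : M.toDGA x = z + A.d w := (eq_add_of_sub_eq' hw.symm)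
      rw [h1]
      exact DGA.IsRep.add_d ⟨hz, rfl⟩ w

/-- The resolution of the homology algebra given by a minimal model. -/
def resolution : Resolution A.homology := ⟨M.toResolutionData, M.isResolution⟩

theorem cochain_mem_cocycles :
    M.cochain ∈ cocycles (LinearMap.id : M.E.carrier →ₗ[k] M.E.carrier)
      (E := M.toBidgaData) (F := M.toBidgaData) 3 (-1) := by
  refine mem_cocycles_three (E := M.toBidgaData) (fun r => ?_) rfl (fun _ => rfl)
    (fun (x : M.E.carrier) => ?_) (fun (x y : M.E.carrier) => ?_)
    (fun (x y z : M.E.carrier) => ?_) M.m_rel_zero_four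
  · match r with
    | 0 => exact fun _ _ _ => Submodule.zero_mem _
    | 1 => exact M.E.homogeneous 2 1 le_rfl
    | 2 => exact M.E.homogeneous 1 2 (by norm_num)
    | 3 => exact M.E.homogeneous 0 3 (by norm_num)
    | r + 4 => exact fun _ _ _ => Submodule.zero_mem _
  · have h := M.m_rel_three_one x
    simp only [← M.diff_one_apply] at h
    exact h
  · have h := M.m_rel_two_two x y
    simp only [← M.diff_one_apply] at h
    exact h
  · have h := M.m_rel_one_three x y z
    simp only [← M.diff_one_apply] at h
    exact h

/-- The map `f_{01}` with its homotopies `f_{02}` and `f_{11}`. -/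
def homotopyMap : HomotopyMap M.toBidgaData A where
  f := M.toDGA
  a := M.mulHomotopy
  e := M.diffHomotopy
  f_mem := M.toDGA_mem
  a_mem s t s' t' := fun (x y : M.E.carrier) hx hy => by
    have h := M.f.homogeneous 0 2 (by norm_num) ![(s, t), (s', t')] ![x, y] (fun l => by
      fin_cases l
      · exact hx
      · exact hy)
    rw [Fin.sum_univ_two, ← M.mulHomotopy_apply] at h
    have h1 : ![(s, t), (s', t')] 0 + ![(s, t), (s', t')] 1 -
        (((0 : ℕ) : ℤ), (1 : ℤ) - (((0 : ℕ) : ℤ) + ((2 : ℕ) : ℤ))) = (s + s', t + t' + 1) := by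
      ext <;> simp
    rw [h1] at h
    exact h
  e_mem s t := fun (x : M.E.carrier) hx => by
    have h := M.f.homogeneous 1 1 le_rfl ![(s, t)] ![x] (fun l => by
      fin_cases l
      exact hx)
    rw [Fin.sum_univ_one, ← M.diffHomotopy_apply] at h
    have h1 : ![(s, t)] 0 - (((1 : ℕ) : ℤ), (1 : ℤ) - (((1 : ℕ) : ℤ) + ((1 : ℕ) : ℤ))) =
        (s - 1, t + 1) := by
      ext <;> simp
    rw [h1] at h
    exact h
  d_f := M.d_linear
  d_a x y := eq_sub_of_add_eq (M.toDGA_mul x y).symm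
  d_e := fun (x : M.E.carrier) => by
    have h := M.toDGA_d x
    rw [← M.diff_one_apply] at h
    exact h.symm

/-- The boundary in each of the map equations is moved to the other side and disappears in homology;
what remains is expressed in the homotopies f_{02} and f_{11}. -/
theorem isObstruction : M.homotopyMap.IsObstruction
    (pushCochain (E := M.toBidgaData) (F := M.toBidgaData) (G := A.homology.toBidga) M.aug
      M.cochain) where
  zero := MultilinearMap.ext fun _ => map_zero M.aug
  one := fun (x : M.E.carrier) => by
    obtain ⟨w, hw⟩ := M.toDGA_m_two_one x
    have h := (M.isRep_aug (M.E.m 2 1 ![x])).add_d (-w)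
    rw [hw, map_neg, add_neg_cancel_right, ← M.diff_one_apply] at h
    exact h
  two := fun (x y : M.E.carrier) => by
    obtain ⟨w, hw⟩ := M.toDGA_m_one_two x y
    have h := (M.isRep_aug (M.E.m 1 2 ![x, y])).add_d (-w)
    rw [hw, map_neg, add_neg_cancel_right, ← M.diff_one_apply, ← M.diff_one_apply] at h
    exact h
  three := fun (x y z : M.E.carrier) => by
    obtain ⟨w, hw⟩ := M.toDGA_m_zero_three x y z
    have h := (M.isRep_aug (M.E.m 0 3 ![x, y, z])).add_d (-w)
    rw [hw, map_neg, add_neg_cancel_right] at h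
    exact h
  high _ := MultilinearMap.ext fun _ => map_zero M.aug

/-- The class of the cocycle `m_{03} + m_{12} + m_{21}`. -/
def cochainClass : SelfHH M.resolution.toBidgaData 3 (-1) :=
  HH.mk LinearMap.id 3 (-1) M.cochain M.cochain_mem_cocycles

/-- The classes of two minimal models agree over the resolution which maps to both. -/
theorem restrict_cochainClass_eq (M N : MinimalModel A) :
    (span.fst M.resolution N.resolution).restrict 3 (-1) (augHH M.resolution 3 (-1) M.cochainClass) =
      (span.snd M.resolution N.resolution).restrict 3 (-1)
        (augHH N.resolution 3 (-1) N.cochainClass) := by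
  let P := span M.resolution N.resolution
  let p := span.fst M.resolution N.resolution
  let q := span.snd M.resolution N.resolution
  -- Both homotopy maps are restricted to the span. There they induce the same map to homology, the
  -- augmentation of the span, so their obstructions are cohomologous.
  have h := HomotopyMap.sub_mem_coboundaries P.isResolution.isBidga P.isResolution.projective
    (h := N.homotopyMap.comp q.isBidgaMap) (h' := M.homotopyMap.comp p.isBidgaMap) (ε := P.augB)
    (fun x => by
      have h1 := N.isRep_aug (q.map x)
      rw [show N.aug (q.map x) = P.augB x from q.aug_map x] at h1
      exact h1)
    (fun x => by
      have h1 := M.isRep_aug (p.map x)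
      rw [show M.aug (p.map x) = P.augB x from p.aug_map x] at h1
      exact h1)
    (N.isObstruction.comp q.isBidgaMap) (M.isObstruction.comp p.isBidgaMap)
  exact (Submodule.Quotient.eq _).2 h

end MinimalModel

end Dainf

end


/-! ### The universal class of a dga. -/

theorem proposition5 {k : Type u} [CommRing k] (A : Dainf.DGA k) :
    ∃ γ : Dainf.dHochschild A.homology 3 (-1),
      ∀ M : Dainf.MinimalModel A,
        ∃ (hR : M.toResolutionData.IsResolution)
          (hc : M.cochain ∈ Dainf.cocycles (LinearMap.id : M.E.carrier →ₗ[k] M.E.carrier)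
            (E := M.toBidgaData) (F := M.toBidgaData) 3 (-1)),
          Function.Bijective
            (Dainf.dHochschild.eval (⟨M.toResolutionData, hR⟩ : Dainf.Resolution A.homology) 3 (-1)) ∧
          Dainf.dHochschild.eval (⟨M.toResolutionData, hR⟩ : Dainf.Resolution A.homology) 3 (-1) γ =
            Dainf.HH.mk LinearMap.id 3 (-1) M.cochain hc := by
  have key : ∃ γ : Dainf.dHochschild A.homology 3 (-1), ∀ M : Dainf.MinimalModel A,
      Dainf.dHochschild.eval M.resolution 3 (-1) γ = M.cochainClass := by
    -- One minimal model determines the class. Without any, the condition is empty and 0 serves.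
    by_cases hA : Nonempty (Dainf.MinimalModel A)
    · obtain ⟨N⟩ := hA
      obtain ⟨γ, hγ⟩ := Dainf.dHochschild.eval_surjective N.resolution N.cochainClass
      refine ⟨γ, fun M => ?_⟩
      -- Equality of classes on M is tested in the cohomology of the span with values in homology,
      -- where the class of M has been identified with that of N.
      refine (Dainf.augHH_bijective M.resolution 3 (-1)).1
        ((Dainf.restrict_fst_bijective M.resolution N.resolution).1 ?_)
      rw [M.restrict_cochainClass_eq N, ← hγ]
      exact Dainf.dHochschild.fst_eq_snd γ M.resolution N.resolution
    · exact ⟨0, fun M => absurd ⟨M⟩ hA⟩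
  obtain ⟨γ, hγ⟩ := key
  exact ⟨γ, fun M => ⟨M.isResolution, M.cochain_mem_cocycles,
    Dainf.dHochschild.eval_bijective M.resolution, hγ M⟩⟩
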